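/- Let $n\ge 1$, $1<m<2$, $q=2-m$, and let $\exp_q t=[1+(1-q)t]_+^{1/(1-q)}$, $\ln_q t=(t^{1-q}-1)/(1-q)$, $U(t)=\int_0^t\exp_q s\,ds$. Let $\mathcal M$ be the family of $q$-Gaussian densities on $\mathbb R^n$ $$p_\omega(x)=G_q(x;\theta,\Theta)=\exp_q\big(\theta^Tx+x^T\Theta x-\psi(\theta,\Theta)\big),\qquad \omega=(\theta,\Theta),\ \theta\in\mathbb R^n,\ \Theta=\Theta^T<0,$$ where $\psi(\theta,\Theta)$ is the constant for which $\int p_\omega\,dx=1$. Equip $\mathcal M$, in the coordinates $\omega$, with the metric $g(\partial_i,\partial_j)=\int \partial_i p_\omega\,\partial_j\ln_q p_\omega\,dx$ and the mixture connection $g(\nabla^{(\mathrm m)}_{\partial_i}\partial_j,\partial_k)=\int\partial_i\partial_j p_\omega\,\partial_k\ln_q p_\omega\,dx$, whose affinely parametrized geodesics are called m-geodesics. An m-projection of a density $p$ to $\mathcal M$ is a minimizer over $\omega$ of $$\mathcal D[p\|p_\omega]=\int U(\ln_q p_\omega)-U(\ln_q p)-p\,\big[\theta^Tx+x^T\Theta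 x-\psi(\theta,\Theta)-\ln_q p\big]\,dx .$$ If $p^m$ is not integrable, the minimization is understood for the difference of these integrands for two values of $\omega$, in which the terms depending on $p$ alone cancel. Consider nonnegative weak solutions $u$ on $\mathbb R^n\times[0,\infty)$ of the porous medium equation $\partial_tu=\Delta u^m$, that is, $u\in C([0,\infty);L^1(\mathbb R^n))$, $u,u^m\in L^1(\mathbb R^n\times(0,T))$ for all $T>0$, and $$\int_0^\infty\!\!\int (u\,\partial_t\varphi+u^m\Delta\varphi)\,dx\,dt+\int u(x,0)\varphi(x,0)\,dx=0$$ for all $\varphi\in C_c^\infty(\mathbb R^n\times\mathbb R)$. **Theorem.** Let $\eta_0\in\mathbb R^n$ and $H_0\in\mathbb R^{n\times n}$ be the first moment vector $\int xp\,dx$ and second moment matrix $\int xx^Tp\,dx$ of some probability density $p$ on $\mathbb R^n$ with finite second moments. There are $a<0$ and an m-geodesic $\gamma:(a,\infty)\to\mathcal M$, depending only on $n$, $m$ and $(\eta_0,H_0)$, such that $\gamma(0)$ is the unique element of $\mathcal M$ with first and second moments $(\eta_0,H_0)$, such that $\gamma(s)$ has first and second moments $(\eta_0,H_0+sI)$ for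 all $s\ge0$, and such that the following holds for every weak solution $u$ whose initial datum $u(\cdot,0)$ is a probability density with finite second moments and with first and second moments $(\eta_0,H_0)$. The function $$\sigma_u(t)=2\int_0^t\!\!\int u(x,s)^m\,dx\,ds$$ is finite, continuous and strictly increasing on $[0,\infty)$, with $\sigma_u(0)=0$. For every $t\ge0$, $u(\cdot,t)$ is a probability density with finite second moments, its first moment is $\eta_0$, its second moment is $H_0+\sigma_u(t)I$, and its unique m-projection to $\mathcal M$ is $\gamma(\sigma_u(t))$. If moreover $\int u(x,t)^m\,dx<\infty$, then $\mathcal D[u(\cdot,t)\|p_\omega]$ is finite for all $\omega$ and $\gamma(\sigma_u(t))$ is its strict minimizer. So the m-projections of all these solutions move strictly monotonically along one common m-geodesic that starts at the $q$-Gaussian fixed by the initial moments. -/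

import Mathlib

open MeasureTheory Set Filter Topology
open scoped Matrix

noncomputable section

namespace PMEGeometry

/-- Euclidean space `ℝⁿ`. -/
abbrev Space (n : ℕ) := EuclideanSpace ℝ (Fin n)

/-! ### Densities and their moments -/

/-- `p` is a probability density on `ℝⁿ` (with respect to Lebesgue measure) whose second moments
are finite. -/
structure IsDensity {n : ℕ} (p : Space n → ℝ) : Prop where
  nonneg : ∀ᵐ x, 0 ≤ p x
  integrable : Integrable p
  mass : ∫ x, p x = 1
  second_moment : Integrable (fun x => ‖x‖ ^ 2 * p x)

/-- The first moment vector `∫ x p(x) dx`. -/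
def firstMoment {n : ℕ} (p : Space n → ℝ) : Fin n → ℝ :=
  fun i => ∫ x, x i * p x

/-- The second moment matrix `∫ x xᵀ p(x) dx`. -/
def secondMoment {n : ℕ} (p : Space n → ℝ) : Matrix (Fin n) (Fin n) ℝ :=
  Matrix.of fun i j => ∫ x, x i * x j * p x

/-! ### The porous medium equation -/

/-- `u : t ↦ u(·, t)` is a nonnegative (distributional) weak solution on `ℝⁿ × [0, ∞)` of the
Cauchy problem for `∂ₜ u = Δ u ^ m` with initial datum `u 0`: it is a continuous curve in `L¹(ℝⁿ)`,
`u` and `u ^ m` are integrable on `ℝⁿ × (0, T)` for every `T`, and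
`∫∫ (u ∂ₜφ + u ^ m Δφ) dx dt + ∫ u(x, 0) φ(x, 0) dx = 0` for all smooth compactly supported `φ`
(not required to vanish at `t = 0`). Values of `u` at negative times play no role. -/
structure IsWeakSolution {n : ℕ} (m : ℝ) (u : ℝ → Space n → ℝ) : Prop where
  nonneg : ∀ t, 0 ≤ t → ∀ᵐ x, 0 ≤ u t x
  integrable : ∀ t, 0 ≤ t → Integrable (u t)
  continuous_L1 : ∀ t₀, 0 ≤ t₀ →
    Tendsto (fun t => ∫ x, |u t x - u t₀ x|) (𝓝[Ici 0] t₀) (𝓝 0)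
  integrable_prod : ∀ T, 0 < T →
    Integrable (fun z : ℝ × Space n => u z.1 z.2)
      ((volume.restrict (Ioc 0 T)).prod volume)
  integrable_rpow_prod : ∀ T, 0 < T →
    Integrable (fun z : ℝ × Space n => u z.1 z.2 ^ m)
      ((volume.restrict (Ioc 0 T)).prod volume)
  weak_eq : ∀ φ : ℝ → Space n → ℝ,
    ContDiff ℝ ((⊤ : ℕ∞) : WithTop ℕ∞) (fun z : ℝ × Space n => φ z.1 z.2) →
    HasCompactSupport (fun z : ℝ × Space n => φ z.1 z.2) →
    (∫ t in Ioi (0 : ℝ), ∫ x,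
        (u t x * deriv (fun s => φ s x) t + u t x ^ m * Laplacian.laplacian (φ t) x))
      + ∫ x, u 0 x * φ 0 x = 0

/-- `σ_u(t) = 2 ∫₀ᵗ ∫ u(x, s) ^ m dx ds`. -/
def momentShift {n : ℕ} (m : ℝ) (u : ℝ → Space n → ℝ) (t : ℝ) : ℝ :=
  2 * ∫ s in (0 : ℝ)..t, ∫ x, u s x ^ m

/-! ### The `q`-Gaussian family -/

/-- The `q`-exponential `exp_q t = [1 + (1 - q) t]₊ ^ (1 / (1 - q))`. -/
def expq (q t : ℝ) : ℝ := (max 0 (1 + (1 - q) * t)) ^ (1 / (1 - q))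

/-- The `q`-logarithm `ln_q t = (t ^ (1 - q) - 1) / (1 - q)`. -/
def lnq (q t : ℝ) : ℝ := (t ^ (1 - q) - 1) / (1 - q)

/-- The pairs `(θ, Θ)` of a vector and a matrix. -/
abbrev Param (n : ℕ) := Space n × Matrix (Fin n) (Fin n) ℝ

/-- The canonical coordinate domain of the family: `Θ` symmetric negative definite. -/
def paramDomain (n : ℕ) : Set (Param n) := {ω | (-ω.2).PosDef}

/-- Tangent vectors of the coordinate domain: pairs with a symmetric matrix part. -/
def IsTangent {n : ℕ} (z : Param n) : Prop := z.2.IsSymm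

/-- `θᵀ x + xᵀ Θ x`. -/
def quadForm {n : ℕ} (ω : Param n) (x : Space n) : ℝ :=
  ω.1.ofLp ⬝ᵥ x.ofLp + x.ofLp ⬝ᵥ (ω.2 *ᵥ x.ofLp)

/-- The normalizing constant `ψ(θ, Θ)`: the number `c` with `∫ exp_q(θᵀx + xᵀΘx - c) dx = 1`. -/
def psi {n : ℕ} (q : ℝ) (ω : Param n) : ℝ :=
  Classical.epsilon fun c : ℝ => ∫ x : Space n, expq q (quadForm ω x - c) = 1

/-- The `q`-Gaussian density `G_q(x; θ, Θ)`. -/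
def qGauss {n : ℕ} (q : ℝ) (ω : Param n) (x : Space n) : ℝ :=
  expq q (quadForm ω x - psi q ω)

/-! ### Divergence and m-projection -/

/-- `U(t) = ∫₀ᵗ exp_q s ds`. -/
def potU (q t : ℝ) : ℝ := ∫ s in (0 : ℝ)..t, expq q s

/-- The integrand of the Bregman divergence `D[p ‖ G_q(·; θ, Θ)]`. -/
def divIntegrand {n : ℕ} (q : ℝ) (p : Space n → ℝ) (ω : Param n) (x : Space n) : ℝ :=
  potU q (lnq q (qGauss q ω x)) - potU q (lnq q (p x))
    - p x * (quadForm ω x - psi q ω - lnq q (p x))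

/-- The Bregman divergence `D[p ‖ G_q(·; θ, Θ)]`. -/
def bregmanDiv {n : ℕ} (q : ℝ) (p : Space n → ℝ) (ω : Param n) : ℝ :=
  ∫ x, divIntegrand q p ω x

/-- `G_q(·; ω₀)` is an m-projection of `p`: it minimizes the divergence `D[p ‖ ·]` over the family.
The comparison of `D[p ‖ ω]` with `D[p ‖ ω₀]` is made by integrating the difference of their
integrands, in which the terms that involve `p` alone cancel. So the definition makes sense also
when these terms are not integrable; when they are, it is the plain minimization of the divergence,
by `isMProjection_iff` below. -/
def IsMProjection {n : ℕ} (q : ℝ) (p : Space n → ℝ) (ω₀ : Param n) : Prop :=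
  ω₀ ∈ paramDomain n ∧ ∀ ω ∈ paramDomain n,
    Integrable (fun x => divIntegrand q p ω x - divIntegrand q p ω₀ x) ∧
    0 ≤ ∫ x, (divIntegrand q p ω x - divIntegrand q p ω₀ x)

theorem isMProjection_iff {n : ℕ} (q : ℝ) (p : Space n → ℝ) (ω₀ : Param n)
    (h : ∀ ω ∈ paramDomain n, Integrable (divIntegrand q p ω)) :
    IsMProjection q p ω₀ ↔
      ω₀ ∈ paramDomain n ∧ ∀ ω ∈ paramDomain n, bregmanDiv q p ω₀ ≤ bregmanDiv q p ω := by
  unfold IsMProjection bregmanDiv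
  refine and_congr_right fun h₀ => forall₂_congr fun ω hω => ?_
  rw [integral_sub (h ω hω) (h ω₀ h₀), sub_nonneg]
  exact and_iff_right ((h ω hω).sub (h ω₀ h₀))

/-! ### Riemannian metric, mixture connection, m-geodesics -/

/-- The Riemannian metric `g(z, w) = ∫ ∂_z p_ω(x) ∂_w ln_q p_ω(x) dx` at the point `ω`, where
`p_ω = G_q(·; ω)` and `∂_z` is the derivative with respect to `ω` in the direction `z`. -/
def metric {n : ℕ} (q : ℝ) (ω z w : Param n) : ℝ :=
  ∫ x : Space n, lineDeriv ℝ (fun ω' => qGauss q ω' x) ω z *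
    lineDeriv ℝ (fun ω' => lnq q (qGauss q ω' x)) ω w

/-- The components of the mixture connection at `ω`, in the canonical coordinates:
`g(∇_v w, z) = ∫ ∂_v ∂_w p_ω(x) ∂_z ln_q p_ω(x) dx` for constant vector fields `v`, `w`, `z`. -/
def mConnection {n : ℕ} (q : ℝ) (ω v w z : Param n) : ℝ :=
  ∫ x : Space n, lineDeriv ℝ (fun ω' => lineDeriv ℝ (fun ω'' => qGauss q ω'' x) ω' w) ω v *
    lineDeriv ℝ (fun ω' => lnq q (qGauss q ω' x)) ω z

/-- The derivative of a curve of coordinates (entrywise on the matrix part). -/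
def velocity {n : ℕ} (γ : ℝ → Param n) (s : ℝ) : Param n :=
  (deriv (fun r => (γ r).1) s, Matrix.of fun i j => deriv (fun r => (γ r).2 i j) s)

/-- `γ` is an affinely parametrized geodesic of the mixture connection on the open interval `J`,
in canonical coordinates: it is `C²`, stays in the coordinate domain, and `∇_γ' γ' = 0`, that is,
`∑ᵢⱼ Γᵢⱼ,ₖ γᵢ' γⱼ' + ∑ⱼ gⱼₖ γⱼ'' = 0` for all `k`. -/
structure IsMGeodesic {n : ℕ} (q : ℝ) (γ : ℝ → Param n) (J : Set ℝ) : Prop where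
  mem : ∀ s ∈ J, γ s ∈ paramDomain n
  contDiff_fst : ContDiffOn ℝ 2 (fun s => (γ s).1) J
  contDiff_snd : ∀ i j, ContDiffOn ℝ 2 (fun s => (γ s).2 i j) J
  geodesic_eq : ∀ s ∈ J, ∀ z : Param n, IsTangent z →
    mConnection q (γ s) (velocity γ s) (velocity γ s) z
      + metric q (γ s) (velocity (velocity γ) s) z = 0

end PMEGeometry

end

open PMEGeometry

/-!
The divergence `𝒟[p ‖ p_ω]` depends on `p`, up to a term without `ω`, only through the moments of
`p` of order at most two (`integral_divIntegrand_sub`), since `p` enters linearly and is paired with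
a quadratic polynomial. So the m-projection of `p` does not change when `p` is replaced by the
`q`-Gaussian with the same moments, for which the divergence is nonnegative and vanishes only at that
`q`-Gaussian itself (`integral_divIntegrand_sub_pos`). It remains to describe the moments of a
solution and the curve of `q`-Gaussians that carry them.

*Moments of solutions.* Testing the equation with `1`, `xᵢ` and `xᵢ xⱼ`, whose Laplacians are `0`,
`0` and `2 δᵢⱼ`, shows that mass and first moments are conserved and that the second moment matrix
grows by `σ_u(t) I`. As only compactly supported test functions are allowed, a homogeneous
polynomial `P` of degree `d` is cut off by `ζ(c x)`, `c → 0`. The Laplacian of `P ζ(c ·)` is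
`c ^ (2 - d)` times a fixed bounded function of `c x`, hence bounded and convergent for `d ≤ 2`
(`integral_mul_homogeneous`), and monotone convergence shows that second moments stay finite
(`integrable_norm_sq_mul`).

*The `q`-Gaussians.* With `k = 1 / (m - 1)` we have `p_ω = P ^ k` where the pressure `P` is positive
and `p_ω = 0` elsewhere; `P` is a quadratic polynomial, which becomes `λ (1 - |y|²)` in suitable
affine coordinates. This gives `ψ`, and mean and covariance of `p_ω`, in closed form (`psi_eq`,
`firstMoment_qGauss`, `secondMoment_qGauss`); the latter can be inverted explicitly (`ofMeanCov`).
Hence every mean and positive definite covariance matrix belongs to exactly one `q`-Gaussian.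

*The geodesic.* Let `γ(s)` have mean `η₀` and covariance matrix `Σ₀ + s I`, for all `s` for which
this is positive definite. For every quadratic polynomial `φ`, the integral `∫ p_γ(s) φ` is affine in
`s`. Its second derivative at `s₀`, for the `φ` that is equal to `∂_z ln_q p_ω`, `ω = γ(s₀)`, on the
support of `p_ω`, is the left hand side of the geodesic equation in the direction `z`
(`isMGeodesic_of_affine_moments`). The analytic point is differentiation under the integral sign:
the second derivative of `P ^ k` contains `P ^ (k - 2)`, which is unbounded near the moving boundary
of the support when `k < 2`, but integrable as `k > 1`, that is, `m < 2`. The formula is proved by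
integrating along almost every line `x = const`, which meets the boundary at most countably often,
and by Fubini's theorem (`IsMovingProfile.hasDerivAt_integral`).
-/

noncomputable section

namespace PMEGeometry

/-! ### Powers of the positive part and the closed forms of the `q`-functions -/

theorem hasDerivAt_posPart_rpow {e : ℝ} (he : 1 < e) (w : ℝ) :
    HasDerivAt (fun w : ℝ => (max 0 w) ^ e) (e * (max 0 w) ^ (e - 1)) w := by
  rcases lt_trichotomy w 0 with hw | hw | hw
  · have h0 : (fun w : ℝ => (max 0 w) ^ e) =ᶠ[𝓝 w] fun _ => (0 : ℝ) := by
      filter_upwards [gt_mem_nhds hw] with v hv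
      rw [max_eq_left hv.le, Real.zero_rpow (by linarith)]
    rw [max_eq_left hw.le, Real.zero_rpow (by linarith), mul_zero]
    exact (hasDerivAt_const w (0 : ℝ)).congr_of_eventuallyEq h0
  · subst hw
    rw [max_self, Real.zero_rpow (by linarith), mul_zero, hasDerivAt_iff_isLittleO]
    simp only [max_self, Real.zero_rpow (show e ≠ 0 by linarith), sub_zero, smul_zero]
    refine Asymptotics.IsLittleO.of_norm_left ?_
    have h1 : (fun v : ℝ => |v| ^ e) =o[𝓝 0] fun v : ℝ => v := by
      have h2 : (fun v : ℝ => |v| ^ e) = fun v : ℝ => |v| ^ (e - 1) * |v| := by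
        ext v
        rcases eq_or_ne v 0 with rfl | hv
        · simp [Real.zero_rpow (show e ≠ 0 by linarith)]
        · rw [← Real.rpow_add_one (abs_pos.2 hv).ne']; ring_nf
      rw [h2]
      have h3 : Tendsto (fun v : ℝ => |v| ^ (e - 1)) (𝓝 0) (𝓝 0) := by
        have : ContinuousAt (fun v : ℝ => |v| ^ (e - 1)) 0 :=
          continuous_abs.continuousAt.rpow_const (Or.inr (by linarith))
        simpa [ContinuousAt, Real.zero_rpow (show e - 1 ≠ 0 by linarith)] using this
      have h4 := ((Asymptotics.isLittleO_one_iff ℝ).2 h3).mul_isBigO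
        (Asymptotics.isBigO_refl (fun v : ℝ => |v|) (𝓝 0))
      simp only [one_mul] at h4
      exact h4.trans_isBigO (Asymptotics.isBigO_refl _ _).abs_left
    refine Asymptotics.IsBigO.trans_isLittleO (Asymptotics.IsBigO.of_bound 1 ?_) h1
    filter_upwards with v
    have hb : (max 0 v) ^ e ≤ |v| ^ e :=
      Real.rpow_le_rpow (le_max_left _ _) (max_le (abs_nonneg _) (le_abs_self _)) (by linarith)
    have hp : 0 ≤ (max 0 v) ^ e := Real.rpow_nonneg (le_max_left _ _) _
    simp only [Real.norm_eq_abs, one_mul, abs_abs]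
    rw [abs_of_nonneg hp]
    exact hb.trans (le_abs_self _)
  · have h0 : (fun w : ℝ => (max 0 w) ^ e) =ᶠ[𝓝 w] fun w => w ^ e := by
      filter_upwards [lt_mem_nhds hw] with v hv
      rw [max_eq_right hv.le]
    rw [max_eq_right hw.le]
    exact (Real.hasDerivAt_rpow_const (Or.inl hw.ne')).congr_of_eventuallyEq h0

theorem continuous_posPart_rpow {e : ℝ} (he : 0 ≤ e) : Continuous fun w : ℝ => (max 0 w) ^ e :=
  (continuous_const.max continuous_id).rpow_const fun _ => Or.inr he

theorem expq_eq {m : ℝ} (t : ℝ) :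
    expq (2 - m) t = (max 0 (1 + (m - 1) * t)) ^ (1 / (m - 1)) := by
  unfold expq
  rw [show 1 - (2 - m) = m - 1 by ring]

theorem lnq_eq {m : ℝ} (t : ℝ) : lnq (2 - m) t = (t ^ (m - 1) - 1) / (m - 1) := by
  unfold lnq
  rw [show 1 - (2 - m) = m - 1 by ring]

theorem expq_nonneg (q t : ℝ) : 0 ≤ expq q t := Real.rpow_nonneg (le_max_left _ _) _

theorem expq_rpow_sub_one {m : ℝ} (hm : 1 < m) (t : ℝ) :
    expq (2 - m) t ^ (m - 1) = max 0 (1 + (m - 1) * t) := by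
  rw [expq_eq, ← Real.rpow_mul (le_max_left _ _), one_div,
    inv_mul_cancel₀ (by linarith), Real.rpow_one]

theorem expq_lnq {m v : ℝ} (hm : 1 < m) (hv : 0 ≤ v) : expq (2 - m) (lnq (2 - m) v) = v := by
  have h : m - 1 ≠ 0 := by linarith
  rw [expq_eq, lnq_eq, mul_div_cancel₀ _ h, add_sub_cancel, max_eq_right (by positivity),
    ← Real.rpow_mul hv, one_div, mul_inv_cancel₀ h, Real.rpow_one]

theorem expq_rpow {m : ℝ} (hm : 1 < m) (t : ℝ) :
    expq (2 - m) t ^ m = (max 0 (1 + (m - 1) * t)) ^ (1 / (m - 1) + 1) := by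
  have h : m - 1 ≠ 0 := by linarith
  rw [expq_eq, ← Real.rpow_mul (le_max_left _ _)]
  congr 1
  field_simp
  ring

theorem continuous_expq {m : ℝ} (hm : 1 < m) : Continuous (expq (2 - m)) := by
  have h : (0 : ℝ) ≤ 1 / (m - 1) := by
    have : 0 < m - 1 := by linarith
    positivity
  have : expq (2 - m) = (fun w : ℝ => (max 0 w) ^ (1 / (m - 1))) ∘ fun t => 1 + (m - 1) * t := by
    ext t; exact expq_eq t
  rw [this]
  exact (continuous_posPart_rpow h).comp (by fun_prop)

theorem potU_eq {m : ℝ} (hm : 1 < m) (t : ℝ) :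
    potU (2 - m) t = (expq (2 - m) t ^ m - 1) / m := by
  have h : 0 < m - 1 := by linarith
  have h1 : ∀ s : ℝ, HasDerivAt (fun t => expq (2 - m) t ^ m / m) (expq (2 - m) s) s := by
    intro s
    have ha := (hasDerivAt_posPart_rpow (e := 1 / (m - 1) + 1) (by
      have : 0 < 1 / (m - 1) := by positivity
      linarith) (1 + (m - 1) * s)).comp s
      (((hasDerivAt_id s).const_mul (m - 1)).const_add 1)
    have hb : (fun t => expq (2 - m) t ^ m) =
      ((fun w : ℝ => (max 0 w) ^ (1 / (m - 1) + 1)) ∘ fun t => 1 + (m - 1) * id t) := by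
      ext t; exact expq_rpow hm t
    have hc := ha.div_const m
    have hd : (1 / (m - 1) + 1) * max 0 (1 + (m - 1) * s) ^ (1 / (m - 1) + 1 - 1) * ((m - 1) * 1) / m
        = expq (2 - m) s := by
      rw [expq_eq, add_sub_cancel_right]
      field_simp
      ring
    rw [hd] at hc
    rw [← hb] at hc
    exact hc
  have h2 := intervalIntegral.integral_eq_sub_of_hasDerivAt (a := 0) (b := t) (fun s _ => h1 s)
    ((continuous_expq hm).intervalIntegrable _ _)
  unfold potU
  rw [h2, sub_div]
  simp [expq_eq]

/-- The tangent line inequality for the strictly convex function `v ↦ v ^ m`. -/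
theorem rpow_sub_tangent_pos {m v b : ℝ} (hm : 1 < m) (hv : 0 ≤ v) (hb : 0 ≤ b) (h : v ≠ b) :
    0 < v ^ m - b ^ m - m * b ^ (m - 1) * (v - b) := by
  rcases hb.eq_or_lt with rfl | hb
  · rw [Real.zero_rpow (by linarith), Real.zero_rpow (by linarith)]
    have : 0 < v := lt_of_le_of_ne hv h.symm
    simp only [sub_zero, mul_zero, zero_mul]
    positivity
  · have h1 : (v / b - 1) ≠ 0 := by
      rw [sub_ne_zero, Ne, div_eq_one_iff_eq hb.ne']; exact h
    have h2 := one_add_mul_self_lt_rpow_one_add (s := v / b - 1)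
      (by have : 0 ≤ v / b := by positivity
          linarith) h1 hm
    rw [add_sub_cancel, Real.div_rpow hv hb.le, lt_div_iff₀ (by positivity)] at h2
    have h3 : b ^ m = b ^ (m - 1) * b := by
      rw [← Real.rpow_add_one hb.ne']; ring_nf
    have h4 : (1 + m * (v / b - 1)) * b ^ m = b ^ m + m * b ^ (m - 1) * (v - b) := by
      rw [h3]; field_simp
    linarith

theorem qGauss_nonneg {n : ℕ} (q : ℝ) (ω : Param n) (x : Space n) : 0 ≤ qGauss q ω x :=
  expq_nonneg _ _

/-- The integrand of the divergence in closed form: `ω` and `p` meet only in a product of `p` with a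
quadratic polynomial. -/
theorem divIntegrand_eq {n : ℕ} {m : ℝ} (hm : 1 < m) (p : Space n → ℝ) (ω : Param n) (x : Space n)
    (hp : 0 ≤ p x) :
    divIntegrand (2 - m) p ω x = (qGauss (2 - m) ω x ^ m - p x ^ m) / m
      - p x * (quadForm ω x - psi (2 - m) ω) + (p x ^ m - p x) / (m - 1) := by
  unfold divIntegrand
  have h : m - 1 ≠ 0 := by linarith
  rw [potU_eq hm, potU_eq hm, expq_lnq hm (qGauss_nonneg _ _ _), expq_lnq hm hp, lnq_eq]
  have h1 : p x ^ m = p x ^ (m - 1) * p x := by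
    rcases hp.eq_or_lt with h0 | h0
    · rw [← h0]; simp [Real.zero_rpow (show m ≠ 0 by linarith)]
    · rw [← Real.rpow_add_one h0.ne']; ring_nf
  rw [h1]
  ring

/-- The integrand of the divergence is the gap between `v ↦ v ^ m` and its tangent line at the
`q`-Gaussian, plus a term that penalizes `p` outside the support of the `q`-Gaussian. -/
theorem divIntegrand_eq_gap {n : ℕ} {m : ℝ} (hm : 1 < m) (p : Space n → ℝ) (ω : Param n)
    (x : Space n) (hp : 0 ≤ p x) :
    divIntegrand (2 - m) p ω x = (p x ^ m - qGauss (2 - m) ω x ^ m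
        - m * qGauss (2 - m) ω x ^ (m - 1) * (p x - qGauss (2 - m) ω x)) / (m * (m - 1))
      + p x * (max 0 (1 + (m - 1) * (quadForm ω x - psi (2 - m) ω))
        - (1 + (m - 1) * (quadForm ω x - psi (2 - m) ω))) / (m - 1) := by
  rw [divIntegrand_eq hm p ω x hp]
  have h : m - 1 ≠ 0 := by linarith
  have h' : m ≠ 0 := by linarith
  have hg := qGauss_nonneg (2 - m) ω x
  have h1 : qGauss (2 - m) ω x ^ m = qGauss (2 - m) ω x ^ (m - 1) * qGauss (2 - m) ω x := by
    rcases hg.eq_or_lt with h0 | h0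
    · rw [← h0]; simp [Real.zero_rpow (show m ≠ 0 by linarith)]
    · rw [← Real.rpow_add_one h0.ne']; ring_nf
  have h2 : qGauss (2 - m) ω x ^ (m - 1) = max 0 (1 + (m - 1) * (quadForm ω x - psi (2 - m) ω)) :=
    expq_rpow_sub_one hm _
  rw [← h2, h1]
  generalize qGauss (2 - m) ω x ^ (m - 1) = a
  field_simp
  ring

theorem divIntegrand_nonneg {n : ℕ} {m : ℝ} (hm : 1 < m) (p : Space n → ℝ) (ω : Param n)
    (x : Space n) (hp : 0 ≤ p x) : 0 ≤ divIntegrand (2 - m) p ω x := by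
  rw [divIntegrand_eq_gap hm p ω x hp]
  have h : 0 < m - 1 := by linarith
  have h2 : 0 ≤ p x ^ m - qGauss (2 - m) ω x ^ m
        - m * qGauss (2 - m) ω x ^ (m - 1) * (p x - qGauss (2 - m) ω x) := by
    rcases eq_or_ne (p x) (qGauss (2 - m) ω x) with h0 | h0
    · rw [h0]; simp
    · exact (rpow_sub_tangent_pos hm hp (qGauss_nonneg _ _ _) h0).le
  have h3 := le_max_right 0 (1 + (m - 1) * (quadForm ω x - psi (2 - m) ω))
  have h4 := mul_nonneg hp (sub_nonneg.2 h3)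
  positivity

theorem eq_qGauss_of_divIntegrand_eq_zero {n : ℕ} {m : ℝ} (hm : 1 < m) (p : Space n → ℝ)
    (ω : Param n) (x : Space n) (hp : 0 ≤ p x) (h0 : divIntegrand (2 - m) p ω x = 0) :
    p x = qGauss (2 - m) ω x := by
  by_contra hne
  rw [divIntegrand_eq_gap hm p ω x hp] at h0
  have h : 0 < m - 1 := by linarith
  have h2 := rpow_sub_tangent_pos hm hp (qGauss_nonneg (2 - m) ω x) hne
  have h3 := le_max_right 0 (1 + (m - 1) * (quadForm ω x - psi (2 - m) ω))
  have h4 := mul_nonneg hp (sub_nonneg.2 h3)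
  have : 0 < m * (m - 1) := by positivity
  have h5 := div_pos h2 this
  have h6 := div_nonneg h4 h.le
  linarith

theorem divIntegrand_qGauss_self {n : ℕ} {m : ℝ} (hm : 1 < m) (ω : Param n) (x : Space n) :
    divIntegrand (2 - m) (qGauss (2 - m) ω) ω x = 0 := by
  rw [divIntegrand_eq_gap hm _ ω x (qGauss_nonneg _ _ _)]
  have h : 0 < m - 1 := by linarith
  rcases le_total 0 (1 + (m - 1) * (quadForm ω x - psi (2 - m) ω)) with h0 | h0
  · rw [max_eq_right h0]; simp
  · have : qGauss (2 - m) ω x = 0 := by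
      unfold qGauss
      rw [expq_eq, max_eq_left h0, Real.zero_rpow (by positivity)]
    rw [this]; simp

/-! ### Affine changes of variables -/

/-- The affine map `y ↦ η + B y` of `ℝⁿ`. -/
def affMap {n : ℕ} (η : Fin n → ℝ) (B : Matrix (Fin n) (Fin n) ℝ) (y : Space n) : Space n :=
  WithLp.toLp 2 (η + B *ᵥ y.ofLp)

theorem continuous_affMap {n : ℕ} (η : Fin n → ℝ) (B : Matrix (Fin n) (Fin n) ℝ) :
    Continuous (affMap η B) := by
  unfold affMap
  fun_prop

theorem injective_affMap {n : ℕ} (η : Fin n → ℝ) {B : Matrix (Fin n) (Fin n) ℝ} (hB : B.det ≠ 0) :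
    Function.Injective (affMap η B) := by
  intro x y h
  have h1 : η + B *ᵥ x.ofLp = η + B *ᵥ y.ofLp := congrArg WithLp.ofLp h
  have h2 := Matrix.mulVec_injective_of_isUnit
    ((Matrix.isUnit_iff_isUnit_det B).2 (isUnit_iff_ne_zero.2 hB)) (add_left_cancel h1)
  exact WithLp.ofLp_injective 2 h2

theorem measurableEmbedding_affMap {n : ℕ} (η : Fin n → ℝ) {B : Matrix (Fin n) (Fin n) ℝ}
    (hB : B.det ≠ 0) : MeasurableEmbedding (affMap η B) :=
  (continuous_affMap η B).measurableEmbedding (injective_affMap η hB)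

theorem map_affMap_volume {n : ℕ} (η : Fin n → ℝ) {B : Matrix (Fin n) (Fin n) ℝ}
    (hB : B.det ≠ 0) :
    Measure.map (affMap η B) volume = ENNReal.ofReal |B.det⁻¹| • (volume : Measure (Space n)) := by
  have h1 : affMap η B = (WithLp.toLp 2) ∘ (fun x => η + x) ∘ (Matrix.toLin' B) ∘
      (WithLp.ofLp : Space n → (Fin n → ℝ)) := by
    ext y i
    simp [affMap, Matrix.toLin'_apply]
  have hL : Measurable (Matrix.toLin' B) :=
    (LinearMap.continuous_of_finiteDimensional (Matrix.toLin' B)).measurable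
  have ho : Measurable (WithLp.ofLp : Space n → (Fin n → ℝ)) :=
    (PiLp.volume_preserving_ofLp (Fin n)).measurable
  have ht : Measurable (WithLp.toLp 2 : (Fin n → ℝ) → Space n) :=
    (PiLp.volume_preserving_toLp (Fin n)).measurable
  have ha : Measurable (fun x : Fin n → ℝ => η + x) := measurable_const_add η
  rw [h1, ← Measure.map_map ht (ha.comp (hL.comp ho)), ← Measure.map_map ha (hL.comp ho),
    ← Measure.map_map hL ho, (PiLp.volume_preserving_ofLp (Fin n)).map_eq,
    Real.map_matrix_volume_pi_eq_smul_volume_pi hB, Measure.map_smul,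
    (measurePreserving_add_left volume η).map_eq, Measure.map_smul,
    (PiLp.volume_preserving_toLp (Fin n)).map_eq]

theorem integral_affMap {n : ℕ} (η : Fin n → ℝ) {B : Matrix (Fin n) (Fin n) ℝ}
    (hB : B.det ≠ 0) (f : Space n → ℝ) :
    ∫ x, f x = |B.det| * ∫ y, f (affMap η B y) := by
  have h := (measurableEmbedding_affMap η hB).integral_map (μ := volume) f
  rw [map_affMap_volume η hB, integral_smul_measure] at h
  rw [← h, ENNReal.toReal_ofReal (abs_nonneg _), abs_inv, smul_eq_mul, ← mul_assoc,
    mul_inv_cancel₀ (abs_ne_zero.2 hB), one_mul]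

theorem integrable_comp_affMap_iff {n : ℕ} (η : Fin n → ℝ) {B : Matrix (Fin n) (Fin n) ℝ}
    (hB : B.det ≠ 0) (f : Space n → ℝ) :
    Integrable (fun y => f (affMap η B y)) ↔ Integrable f := by
  have h := (measurableEmbedding_affMap η hB).integrable_map_iff (μ := volume) (g := f)
  rw [map_affMap_volume η hB] at h
  have h2 : ENNReal.ofReal |B.det⁻¹| ≠ 0 := by
    simp [hB]
  rw [integrable_smul_measure h2 ENNReal.ofReal_ne_top] at h
  exact h.symm

theorem surjective_affMap {n : ℕ} (η : Fin n → ℝ) {B : Matrix (Fin n) (Fin n) ℝ}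
    (hB : B.det ≠ 0) : Function.Surjective (affMap η B) := by
  intro x
  refine ⟨WithLp.toLp 2 (B⁻¹ *ᵥ (x.ofLp - η)), ?_⟩
  ext i
  simp [affMap, Matrix.mulVec_mulVec, Matrix.mul_nonsing_inv _ (isUnit_iff_ne_zero.2 hB)]

theorem ae_affMap {n : ℕ} (η : Fin n → ℝ) {B : Matrix (Fin n) (Fin n) ℝ}
    (hB : B.det ≠ 0) {P : Space n → Prop} (h : ∀ᵐ y, P (affMap η B y)) : ∀ᵐ x, P x := by
  have h1 := (measurableEmbedding_affMap η hB).ae_map_iff (μ := volume) (p := P)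
  rw [map_affMap_volume η hB] at h1
  have h2 : ENNReal.ofReal |B.det⁻¹| ≠ 0 := by
    simp [hB]
  have h3 := h1.2 h
  rw [ae_iff, Measure.smul_apply, smul_eq_mul] at h3
  rw [ae_iff]
  exact (mul_eq_zero.1 h3).resolve_left h2

/-! ### Truncated powers and the weights `(1 - |y|²)₊ ^ e` on the unit ball -/

/-- The truncated power `w ↦ w ^ e · 1_{w > 0}`. The cut-off is put by hand, so that negative
exponents are allowed. -/
def truncPow (e w : ℝ) : ℝ := if 0 < w then w ^ e else 0

theorem truncPow_of_pos {e w : ℝ} (h : 0 < w) : truncPow e w = w ^ e := if_pos h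

theorem truncPow_of_nonpos {e w : ℝ} (h : w ≤ 0) : truncPow e w = 0 := if_neg h.not_gt

theorem truncPow_eq_posPart {e : ℝ} (he : e ≠ 0) (w : ℝ) : truncPow e w = (max 0 w) ^ e := by
  rcases le_or_gt w 0 with h | h
  · rw [truncPow_of_nonpos h, max_eq_left h, Real.zero_rpow he]
  · rw [truncPow_of_pos h, max_eq_right h.le]

theorem truncPow_nonneg (e w : ℝ) : 0 ≤ truncPow e w := by
  unfold truncPow
  split_ifs with h
  · exact Real.rpow_nonneg h.le _
  · exact le_rfl

theorem truncPow_mul {e a : ℝ} (ha : 0 < a) (w : ℝ) : truncPow e (a * w) = a ^ e * truncPow e w := by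
  rcases le_or_gt w 0 with h | h
  · rw [truncPow_of_nonpos h, truncPow_of_nonpos (mul_nonpos_of_nonneg_of_nonpos ha.le h), mul_zero]
  · rw [truncPow_of_pos h, truncPow_of_pos (by positivity), Real.mul_rpow ha.le h.le]

theorem measurable_truncPow (e : ℝ) : Measurable (truncPow e) :=
  Measurable.ite measurableSet_Ioi (measurable_id.pow_const e) measurable_const

theorem continuous_truncPow {e : ℝ} (he : 0 < e) : Continuous (truncPow e) := by
  rw [show truncPow e = fun w => (max 0 w) ^ e from funext (truncPow_eq_posPart he.ne')]
  exact continuous_posPart_rpow he.le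

theorem hasDerivAt_truncPow {e w : ℝ} (hw : w ≠ 0) :
    HasDerivAt (truncPow e) (e * truncPow (e - 1) w) w := by
  rcases lt_or_gt_of_ne hw with h | h
  · rw [truncPow_of_nonpos h.le, mul_zero]
    refine (hasDerivAt_const w (0 : ℝ)).congr_of_eventuallyEq ?_
    filter_upwards [gt_mem_nhds h] with v hv using truncPow_of_nonpos hv.le
  · rw [truncPow_of_pos h]
    refine (Real.hasDerivAt_rpow_const (Or.inl h.ne')).congr_of_eventuallyEq ?_
    filter_upwards [lt_mem_nhds h] with v hv using truncPow_of_pos hv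

/-- The weight `(1 - |y|²) ^ e` on the open unit ball, extended by zero. -/
def ballWeight {n : ℕ} (e : ℝ) (y : Space n) : ℝ := truncPow e (1 - ‖y‖ ^ 2)

theorem ballWeight_nonneg {n : ℕ} (e : ℝ) (y : Space n) : 0 ≤ ballWeight e y := truncPow_nonneg _ _

theorem ballWeight_eq_zero {n : ℕ} {e : ℝ} {y : Space n} (h : 1 ≤ ‖y‖) : ballWeight e y = 0 :=
  truncPow_of_nonpos (by nlinarith)

theorem measurable_ballWeight {n : ℕ} (e : ℝ) : Measurable (ballWeight (n := n) e) :=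
  (measurable_truncPow e).comp (by fun_prop)

theorem integrableOn_one_sub_sq_rpow {e : ℝ} (he : -1 < e) :
    IntegrableOn (fun r : ℝ => (1 - r ^ 2) ^ e) (Ioo 0 1) := by
  have h1 : IntegrableOn (fun r : ℝ => (1 - r) ^ e) (Ioo 0 1) := by
    have := (intervalIntegral.intervalIntegrable_rpow' (a := 0) (b := 1) he).comp_sub_left 1
    simp only [sub_zero, sub_self] at this
    exact ((intervalIntegrable_iff_integrableOn_Ioo_of_le zero_le_one).1 this.symm)
  have h2 : ContinuousOn (fun r : ℝ => (1 + r) ^ e) (Icc 0 1) := by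
    refine ContinuousOn.rpow_const (by fun_prop) fun x hx => Or.inl ?_
    have := hx.1
    positivity
  obtain ⟨C, hC⟩ := isCompact_Icc.exists_bound_of_continuousOn h2
  refine (h1.const_mul C).mono' ?_ ?_
  · exact Measurable.aestronglyMeasurable (by fun_prop)
  · filter_upwards [ae_restrict_mem measurableSet_Ioo] with r hr
    have ha : 0 ≤ 1 - r := by linarith [hr.2]
    have hb : 0 ≤ 1 + r := by linarith [hr.1]
    rw [show 1 - r ^ 2 = (1 + r) * (1 - r) by ring, Real.mul_rpow hb ha, norm_mul]
    have hc : 0 ≤ (1 - r) ^ e := Real.rpow_nonneg ha _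
    rw [Real.norm_of_nonneg hc]
    exact mul_le_mul_of_nonneg_right (hC r ⟨hr.1.le, hr.2.le⟩) hc

/-- Exponents in `(-1, 0)` are included; the second derivatives of the `q`-Gaussians involve them.
For `n = 0` there is no polar decomposition. -/
theorem integrable_ballWeight {n : ℕ} (hn : 1 ≤ n) {e : ℝ} (he : -1 < e) :
    Integrable (ballWeight (n := n) e) := by
  have : Nonempty (Fin n) := ⟨⟨0, hn⟩⟩
  have h := (integrableOn_fun_norm_addHaar (E := Space n) (volume : Measure (Space n))
    (f := fun r : ℝ => (1 - r ^ 2) ^ e) (r := 1)).2 (by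
      refine (integrableOn_one_sub_sq_rpow he).mono' ?_ ?_
      · exact Measurable.aestronglyMeasurable (by fun_prop)
      · filter_upwards [ae_restrict_mem measurableSet_Ioo] with r hr
        have ha : 0 ≤ (1 - r ^ 2) ^ e := Real.rpow_nonneg (by nlinarith [hr.1, hr.2]) _
        rw [norm_smul, Real.norm_of_nonneg ha, Real.norm_of_nonneg (pow_nonneg hr.1.le _)]
        exact mul_le_of_le_one_left ha (pow_le_one₀ hr.1.le hr.2.le))
  rw [← integrable_indicator_iff measurableSet_ball] at h
  refine h.congr (Eventually.of_forall fun y => ?_)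
  by_cases hy : ‖y‖ < 1
  · have : 0 < 1 - ‖y‖ ^ 2 := by nlinarith [norm_nonneg y]
    simp [hy, ballWeight, truncPow_of_pos this]
  · simp [hy, ballWeight_eq_zero (not_lt.1 hy)]

/-- Continuous functions are integrable against an integrable weight on the unit ball. -/
theorem integrable_ballWeight_mul {n : ℕ} (hn : 1 ≤ n) {e : ℝ} (he : -1 < e) {f : Space n → ℝ}
    (hf : Continuous f) : Integrable fun y => ballWeight e y * f y := by
  obtain ⟨C, hC⟩ := (isCompact_closedBall (0 : Space n) 1).exists_bound_of_continuousOn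
    hf.continuousOn
  refine ((integrable_ballWeight hn he).mul_const C).mono'
    ((measurable_ballWeight e).mul hf.measurable).aestronglyMeasurable
    (Eventually.of_forall fun y => ?_)
  rw [norm_mul, Real.norm_of_nonneg (ballWeight_nonneg _ _)]
  rcases le_or_gt 1 ‖y‖ with hy | hy
  · rw [ballWeight_eq_zero hy]; simp
  · exact mul_le_mul_of_nonneg_left (hC y (by simpa using hy.le)) (ballWeight_nonneg _ _)

theorem continuous_ballWeight {n : ℕ} {e : ℝ} (he : 0 < e) : Continuous (ballWeight (n := n) e) :=
  (continuous_truncPow he).comp (by fun_prop)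

theorem integral_ballWeight_pos (n : ℕ) {e : ℝ} (he : 0 < e) :
    0 < ∫ y : Space n, ballWeight e y := by
  refine (continuous_ballWeight he).integral_pos_of_hasCompactSupport_nonneg_nonzero ?_
    (ballWeight_nonneg e) (x := 0) ?_
  · refine HasCompactSupport.of_support_subset_isCompact (isCompact_closedBall (0 : Space n) 1) ?_
    intro y hy
    by_contra h
    exact hy (ballWeight_eq_zero (by simpa using (not_le.1 (by simpa using h)).le))
  · simp [ballWeight, truncPow_of_pos]

/-- The second moment of the weight `(1 - |y|²)₊ ^ e` in one coordinate direction. -/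
def ballMoment (n : ℕ) (e : ℝ) : ℝ := (∫ y : Space n, ballWeight e y * ‖y‖ ^ 2) / n

theorem integral_ballWeight_comp {n : ℕ} (e : ℝ) (f : Space n → ℝ) (g : Space n ≃ₗᵢ[ℝ] Space n) :
    ∫ y, ballWeight e y * f (g y) = ∫ y, ballWeight e y * f y := by
  rw [← g.measurePreserving.integral_comp g.toHomeomorph.measurableEmbedding
    (fun y => ballWeight e y * f y)]
  simp [ballWeight]

/-- Flipping the sign of one coordinate. -/
def flipSign {n : ℕ} (i : Fin n) : Space n ≃ₗᵢ[ℝ] Space n :=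
  LinearIsometryEquiv.piLpCongrRight 2 fun j =>
    if j = i then LinearIsometryEquiv.neg ℝ else LinearIsometryEquiv.refl ℝ ℝ

theorem flipSign_self {n : ℕ} (i : Fin n) (y : Space n) : flipSign i y i = - y i := by
  simp [flipSign]

theorem flipSign_of_ne {n : ℕ} {i j : Fin n} (h : j ≠ i) (y : Space n) :
    flipSign i y j = y j := by
  simp [flipSign, h]

theorem integral_ballWeight_coord {n : ℕ} (e : ℝ) (i : Fin n) :
    ∫ y : Space n, ballWeight e y * y i = 0 := by
  have h := integral_ballWeight_comp e (fun y => y i) (flipSign i)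
  simp only [flipSign_self, mul_neg, integral_neg] at h
  linarith

/-- Off-diagonal moments vanish by the reflections `yᵢ ↦ -yᵢ`, and the diagonal ones coincide by
the permutations of the coordinates. -/
theorem integral_ballWeight_coord_mul {n : ℕ} (hn : 1 ≤ n) {e : ℝ} (he : -1 < e) (i j : Fin n) :
    ∫ y : Space n, ballWeight e y * (y i * y j) = if i = j then ballMoment n e else 0 := by
  split_ifs with hij
  · subst hij
    have h1 : ∀ j : Fin n, ∫ y : Space n, ballWeight e y * (y j * y j) =
        ∫ y : Space n, ballWeight e y * (y i * y i) := by
      intro j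
      have h := integral_ballWeight_comp e (fun y => y i * y i)
        (LinearIsometryEquiv.piLpCongrLeft 2 ℝ ℝ (Equiv.swap i j))
      rw [← h]
      simp [LinearIsometryEquiv.piLpCongrLeft_apply, Equiv.piCongrLeft']
    have h2 : ∫ y : Space n, ballWeight e y * ‖y‖ ^ 2 =
        ∑ j : Fin n, ∫ y : Space n, ballWeight e y * (y j * y j) := by
      rw [← integral_finsetSum]
      · simp only [EuclideanSpace.real_norm_sq_eq, Finset.mul_sum]
        simp only [sq]
      · intro j _
        exact integrable_ballWeight_mul hn he (by fun_prop)
    have hn' : (n : ℝ) ≠ 0 := by positivity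
    rw [ballMoment, h2]
    simp only [h1]
    rw [Finset.sum_const, Finset.card_univ, Fintype.card_fin, nsmul_eq_mul]
    field_simp
  · have h := integral_ballWeight_comp e (fun y => y i * y j) (flipSign i)
    simp only [flipSign_self, flipSign_of_ne (Ne.symm hij), neg_mul, mul_neg, integral_neg] at h
    linarith

theorem ballMoment_pos {n : ℕ} (hn : 1 ≤ n) {e : ℝ} (he : 0 < e) : 0 < ballMoment n e := by
  have hn' : (0 : ℝ) < n := by exact_mod_cast hn
  refine div_pos ?_ hn'
  have : Nonempty (Fin n) := ⟨⟨0, hn⟩⟩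
  obtain ⟨x, hx⟩ := exists_norm_eq (Space n) (show (0 : ℝ) ≤ 1 / 2 by norm_num)
  refine Continuous.integral_pos_of_hasCompactSupport_nonneg_nonzero
    ((continuous_ballWeight he).mul (by fun_prop)) ?_
    (fun y => mul_nonneg (ballWeight_nonneg e y) (by positivity)) (x := x) ?_
  · refine HasCompactSupport.of_support_subset_isCompact (isCompact_closedBall (0 : Space n) 1) ?_
    intro y hy
    by_contra h
    refine hy ?_
    simp only
    rw [ballWeight_eq_zero (by simpa using (not_le.1 (by simpa using h)).le), zero_mul]
  · have : (0 : ℝ) < 1 - (1 / 2) ^ 2 := by norm_num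
    rw [ballWeight, hx, truncPow_of_pos this]
    positivity

theorem ae_norm_ne_one {n : ℕ} (hn : 1 ≤ n) : ∀ᵐ y : Space n, ‖y‖ ≠ 1 := by
  have : Nonempty (Fin n) := ⟨⟨0, hn⟩⟩
  have h := Measure.addHaar_sphere (volume : Measure (Space n)) 0 1
  rw [ae_iff]
  simpa [Metric.sphere] using h

/-! ### Integrals of truncated powers of concave quadratic polynomials -/

theorem expq_eq_truncPow {m : ℝ} (hm : 1 < m) (t : ℝ) :
    expq (2 - m) t = truncPow (1 / (m - 1)) (1 + (m - 1) * t) := by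
  have : 0 < m - 1 := by linarith
  rw [expq_eq, truncPow_eq_posPart (by positivity)]

theorem affMap_apply {n : ℕ} (η : Fin n → ℝ) (B : Matrix (Fin n) (Fin n) ℝ) (y : Space n)
    (i : Fin n) : affMap η B y i = η i + ∑ j, B i j * y j := by
  simp [affMap, Matrix.mulVec, dotProduct]

section Profile

variable {n : ℕ} {W : Space n → ℝ} {lam : ℝ} {η : Fin n → ℝ} {B : Matrix (Fin n) (Fin n) ℝ}

theorem truncPow_comp_affMap (hlam : 0 < lam) (hW : ∀ y, W (affMap η B y) = lam * (1 - ‖y‖ ^ 2))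
    (e : ℝ) (y : Space n) : truncPow e (W (affMap η B y)) = lam ^ e * ballWeight e y := by
  rw [hW, truncPow_mul hlam, ballWeight]

theorem integral_truncPow_mul (hB : B.det ≠ 0) (hlam : 0 < lam)
    (hW : ∀ y, W (affMap η B y) = lam * (1 - ‖y‖ ^ 2)) (e : ℝ) (f : Space n → ℝ) :
    ∫ x, truncPow e (W x) * f x =
      |B.det| * lam ^ e * ∫ y, ballWeight e y * f (affMap η B y) := by
  rw [integral_affMap η hB]
  simp only [truncPow_comp_affMap hlam hW, mul_assoc]
  rw [integral_const_mul]

theorem integrable_truncPow_mul (hn : 1 ≤ n) (hB : B.det ≠ 0) (hlam : 0 < lam)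
    (hW : ∀ y, W (affMap η B y) = lam * (1 - ‖y‖ ^ 2)) {e : ℝ} (he : -1 < e) {f : Space n → ℝ}
    (hf : Continuous f) : Integrable fun x => truncPow e (W x) * f x := by
  rw [← integrable_comp_affMap_iff η hB]
  simp only [truncPow_comp_affMap hlam hW, mul_assoc]
  exact (integrable_ballWeight_mul hn he (hf.comp (continuous_affMap η B))).const_mul _

theorem integral_truncPow (hB : B.det ≠ 0) (hlam : 0 < lam)
    (hW : ∀ y, W (affMap η B y) = lam * (1 - ‖y‖ ^ 2)) (e : ℝ) :
    ∫ x, truncPow e (W x) = |B.det| * lam ^ e * ∫ y : Space n, ballWeight e y := by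
  simpa using integral_truncPow_mul hB hlam hW e (fun _ => 1)

theorem integral_truncPow_coord (hn : 1 ≤ n) (hB : B.det ≠ 0) (hlam : 0 < lam)
    (hW : ∀ y, W (affMap η B y) = lam * (1 - ‖y‖ ^ 2)) {e : ℝ} (he : -1 < e)
    (hmass : ∫ x, truncPow e (W x) = 1) (i : Fin n) :
    ∫ x : Space n, truncPow e (W x) * x i = η i := by
  rw [integral_truncPow_mul hB hlam hW]
  rw [integral_truncPow hB hlam hW] at hmass
  have h1 : ∀ y : Space n, ballWeight e y * affMap η B y i =
      ballWeight e y * η i + ∑ j, B i j * (ballWeight e y * y j) := by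
    intro y
    rw [affMap_apply, mul_add, Finset.mul_sum]
    congr 1
    exact Finset.sum_congr rfl fun j _ => by ring
  simp only [h1]
  have hint : ∀ j : Fin n, Integrable fun y : Space n => B i j * (ballWeight e y * y j) :=
    fun j => (integrable_ballWeight_mul hn he (by fun_prop)).const_mul _
  rw [integral_add ((integrable_ballWeight hn he).mul_const _)
    (integrable_finsetSum _ fun j _ => hint j), integral_finsetSum _ fun j _ => hint j]
  simp only [integral_const_mul, integral_ballWeight_coord, mul_zero, Finset.sum_const_zero,
    add_zero, integral_mul_const]
  rw [← mul_assoc, hmass, one_mul]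

theorem integral_truncPow_coord_mul (hn : 1 ≤ n) (hB : B.det ≠ 0) (hlam : 0 < lam)
    (hW : ∀ y, W (affMap η B y) = lam * (1 - ‖y‖ ^ 2)) {e : ℝ} (he : -1 < e)
    (hmass : ∫ x, truncPow e (W x) = 1) (i j : Fin n) :
    ∫ x : Space n, truncPow e (W x) * (x i * x j) =
      η i * η j + ballMoment n e / (∫ y : Space n, ballWeight e y) * (B * Bᵀ) i j := by
  rw [integral_truncPow_mul hB hlam hW]
  rw [integral_truncPow hB hlam hW] at hmass
  have h1 : ∀ y : Space n, ballWeight e y * (affMap η B y i * affMap η B y j) =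
      ballWeight e y * (η i * η j) + ∑ l, (η i * B j l + η j * B i l) * (ballWeight e y * y l)
        + ∑ l, ∑ l', B i l * B j l' * (ballWeight e y * (y l * y l')) := by
    intro y
    have ha : ∑ l, (η i * B j l + η j * B i l) * (ballWeight e y * y l) =
        ballWeight e y * (η i * ∑ l, B j l * y l + η j * ∑ l, B i l * y l) := by
      simp only [Finset.mul_sum, ← Finset.sum_add_distrib]
      exact Finset.sum_congr rfl fun l _ => by ring
    have hb : ∑ l, ∑ l', B i l * B j l' * (ballWeight e y * (y l * y l')) =
        ballWeight e y * ((∑ l, B i l * y l) * ∑ l, B j l * y l) := by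
      rw [Finset.sum_mul_sum]
      simp only [Finset.mul_sum]
      exact Finset.sum_congr rfl fun l _ => Finset.sum_congr rfl fun l' _ => by ring
    rw [ha, hb, affMap_apply, affMap_apply]
    ring
  simp only [h1]
  have hint : ∀ (a : ℝ) (j : Fin n), Integrable fun y : Space n => a * (ballWeight e y * y j) :=
    fun a j => (integrable_ballWeight_mul hn he (by fun_prop)).const_mul _
  have hint2 : ∀ (a : ℝ) (l l' : Fin n),
      Integrable fun y : Space n => a * (ballWeight e y * (y l * y l')) :=
    fun a l l' => (integrable_ballWeight_mul hn he (by fun_prop)).const_mul _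
  have hi0 := (integrable_ballWeight hn he (n := n)).mul_const (η i * η j)
  have hi1 : Integrable fun y : Space n =>
      ∑ l, (η i * B j l + η j * B i l) * (ballWeight e y * y l) :=
    integrable_finsetSum _ fun j _ => hint _ j
  have hi2 : Integrable fun y : Space n =>
      ∑ l, ∑ l', B i l * B j l' * (ballWeight e y * (y l * y l')) :=
    integrable_finsetSum _ fun l _ => integrable_finsetSum _ fun l' _ => hint2 _ l l'
  have hadd := integral_add (hi0.add hi1) hi2
  simp only [Pi.add_apply] at hadd
  rw [hadd, integral_add hi0 hi1,
    integral_finsetSum _ fun j _ => hint _ j,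
    integral_finsetSum _ fun l _ => integrable_finsetSum _ fun l' _ => hint2 _ l l']
  simp only [integral_finsetSum _ fun l' _ => hint2 _ _ l']
  simp only [integral_const_mul, integral_ballWeight_coord, mul_zero, Finset.sum_const_zero,
    add_zero, integral_mul_const, integral_ballWeight_coord_mul hn he, mul_ite,
    Finset.sum_ite_eq, Finset.mem_univ, if_true]
  have hK : (∫ y : Space n, ballWeight e y) ≠ 0 := by
    intro h0
    rw [h0, mul_zero] at hmass
    exact zero_ne_one hmass
  have hc : |B.det| * lam ^ e = 1 / ∫ y : Space n, ballWeight e y := by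
    rw [eq_div_iff hK, hmass]
  rw [← Finset.sum_mul, hc, Matrix.mul_apply]
  simp only [Matrix.transpose_apply]
  field_simp

end Profile

/-! ### The normalization of the `q`-Gaussians -/

/-- A positive definite matrix is diagonalized by an orthogonal matrix. -/
theorem exists_orthogonal_diagonalization {n : ℕ} {A : Matrix (Fin n) (Fin n) ℝ} (hA : A.PosDef) :
    ∃ (V : Matrix (Fin n) (Fin n) ℝ) (d : Fin n → ℝ), Vᵀ * V = 1 ∧ V * Vᵀ = 1 ∧ (∀ i, 0 < d i) ∧
      A = V * Matrix.diagonal d * Vᵀ := by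
  refine ⟨hA.1.eigenvectorUnitary, hA.1.eigenvalues, ?_, ?_, hA.eigenvalues_pos, ?_⟩
  · have := Unitary.coe_star_mul_self hA.1.eigenvectorUnitary
    rwa [Matrix.star_eq_conjTranspose, Matrix.conjTranspose_eq_transpose_of_trivial] at this
  · have := Unitary.coe_mul_star_self hA.1.eigenvectorUnitary
    rwa [Unitary.coe_star, Matrix.star_eq_conjTranspose, Matrix.conjTranspose_eq_transpose_of_trivial] at this
  · have := hA.1.spectral_theorem
    rw [Unitary.conjStarAlgAut_apply, Matrix.star_eq_conjTranspose,
      Matrix.conjTranspose_eq_transpose_of_trivial] at this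
    exact this

/-- An inverse square root of a positive definite matrix. -/
theorem exists_conj_eq_one {n : ℕ} {A : Matrix (Fin n) (Fin n) ℝ} (hA : A.PosDef) :
    ∃ S : Matrix (Fin n) (Fin n) ℝ, Sᵀ * A * S = 1 ∧ S * Sᵀ = A⁻¹ ∧ |S.det| = (√A.det)⁻¹ := by
  obtain ⟨V, d, hV, -, hd, hAV⟩ := exists_orthogonal_diagonalization hA
  have h1 : ∃ S : Matrix (Fin n) (Fin n) ℝ, Sᵀ * A * S = 1 := by
    refine ⟨V * Matrix.diagonal fun i => (√(d i))⁻¹, ?_⟩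
    rw [Matrix.transpose_mul, Matrix.diagonal_transpose, hAV]
    calc Matrix.diagonal (fun i => (√(d i))⁻¹) * Vᵀ * (V * Matrix.diagonal d * Vᵀ) *
          (V * Matrix.diagonal fun i => (√(d i))⁻¹)
        = Matrix.diagonal (fun i => (√(d i))⁻¹) * (Vᵀ * V) * Matrix.diagonal d * (Vᵀ * V) *
          (Matrix.diagonal fun i => (√(d i))⁻¹) := by simp only [Matrix.mul_assoc]
      _ = 1 := by
          rw [hV, Matrix.mul_one, Matrix.mul_one, Matrix.diagonal_mul_diagonal,
            Matrix.diagonal_mul_diagonal, ← Matrix.diagonal_one]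
          congr 1
          ext i
          have : √(d i) ≠ 0 := (Real.sqrt_pos.2 (hd i)).ne'
          have h2 := Real.mul_self_sqrt (hd i).le
          field_simp
          rw [sq, h2]
  obtain ⟨S, hS⟩ := h1
  refine ⟨S, hS, ?_, ?_⟩
  · have h2 : S * Sᵀ * A = 1 := by
      rw [Matrix.mul_assoc]; exact mul_eq_one_comm.1 hS
    exact (Matrix.inv_eq_left_inv h2).symm
  · have h2 := congrArg Matrix.det hS
    rw [Matrix.det_mul, Matrix.det_mul, Matrix.det_transpose, Matrix.det_one] at h2
    have h3 : (|S.det| * √A.det) ^ 2 = 1 := by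
      rw [mul_pow, sq_abs, Real.sq_sqrt hA.det_pos.le]; linarith
    have h4 : |S.det| * √A.det = 1 := by
      exact (pow_eq_one_iff_of_nonneg (by positivity) two_ne_zero).1 h3
    exact eq_inv_of_mul_eq_one_left h4

/-- The maximum point of the quadratic polynomial `θᵀx + xᵀΘx`. -/
def center {n : ℕ} (ω : Param n) : Fin n → ℝ := (1 / 2 : ℝ) • ((-ω.2)⁻¹ *ᵥ ω.1.ofLp)

/-- The maximum of the quadratic polynomial `θᵀx + xᵀΘx`. -/
def height {n : ℕ} (ω : Param n) : ℝ := (1 / 2) * (ω.1.ofLp ⬝ᵥ center ω)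

theorem quadForm_affMap_center {n : ℕ} {ω : Param n} (hω : ω ∈ paramDomain n)
    (B : Matrix (Fin n) (Fin n) ℝ) (y : Space n) :
    quadForm ω (affMap (center ω) B y) =
      height ω - (B *ᵥ y.ofLp) ⬝ᵥ ((-ω.2) *ᵥ (B *ᵥ y.ofLp)) := by
  have hA : (-ω.2).PosDef := hω
  have hdet : IsUnit (-ω.2).det := isUnit_iff_ne_zero.2 hA.det_pos.ne'
  have h1 : (-ω.2) *ᵥ center ω = (1 / 2 : ℝ) • ω.1.ofLp := by
    rw [center, Matrix.mulVec_smul, Matrix.mulVec_mulVec, Matrix.mul_nonsing_inv _ hdet,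
      Matrix.one_mulVec]
  have hsymm : (-ω.2)ᵀ = -ω.2 := by
    have := hA.1
    rwa [Matrix.IsHermitian, Matrix.conjTranspose_eq_transpose_of_trivial] at this
  have h2 : ∀ u v : Fin n → ℝ, u ⬝ᵥ ((-ω.2) *ᵥ v) = v ⬝ᵥ ((-ω.2) *ᵥ u) := by
    intro u v
    rw [Matrix.dotProduct_mulVec, ← Matrix.mulVec_transpose, hsymm, dotProduct_comm]
  unfold quadForm height affMap
  generalize B *ᵥ y.ofLp = z
  have h3 : ω.2 = -(-ω.2) := (neg_neg _).symm
  rw [h3, Matrix.neg_mulVec, dotProduct_neg, Matrix.mulVec_add, dotProduct_add, add_dotProduct,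
    dotProduct_add, dotProduct_add, h2 (center ω) z, h1]
  simp only [neg_neg, dotProduct_smul, smul_eq_mul]
  rw [dotProduct_comm z, dotProduct_comm (center ω)]
  ring

/-- The value of `1 + (1 - q) (θᵀx + xᵀΘx - ψ(θ, Θ))` at its maximum point, as a function of
`det (-Θ)`. -/
def peak (n : ℕ) (m d : ℝ) : ℝ :=
  ((m - 1) ^ ((n : ℝ) / 2) * √d / ∫ y : Space n, ballWeight (1 / (m - 1)) y) ^
    (1 / (1 / (m - 1) + (n : ℝ) / 2))

theorem peak_pos (n : ℕ) {m d : ℝ} (hm : 1 < m) (hd : 0 < d) : 0 < peak n m d := by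
  have h : 0 < m - 1 := by linarith
  have hK := integral_ballWeight_pos n (e := 1 / (m - 1)) (by positivity)
  have := Real.sqrt_pos.2 hd
  unfold peak
  positivity

theorem one_add_quadForm_affMap {n : ℕ} (m : ℝ) {ω : Param n}
    (hω : ω ∈ paramDomain n) {S : Matrix (Fin n) (Fin n) ℝ} (hS : Sᵀ * (-ω.2) * S = 1) (c b : ℝ)
    (y : Space n) :
    1 + (m - 1) * (quadForm ω (affMap (center ω) (b • S) y) - c) =
      1 + (m - 1) * (height ω - c) - (m - 1) * b ^ 2 * ‖y‖ ^ 2 := by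
  rw [quadForm_affMap_center hω]
  have h1 : ((b • S) *ᵥ y.ofLp) ⬝ᵥ ((-ω.2) *ᵥ ((b • S) *ᵥ y.ofLp)) = b ^ 2 * ‖y‖ ^ 2 := by
    rw [Matrix.smul_mulVec, Matrix.mulVec_smul, smul_dotProduct, dotProduct_smul,
      dotProduct_comm, Matrix.mulVec_mulVec, dotProduct_comm, ← Matrix.vecMul_transpose,
      ← Matrix.dotProduct_mulVec, Matrix.mulVec_mulVec, ← Matrix.mul_assoc, hS,
      Matrix.one_mulVec, EuclideanSpace.real_norm_sq_eq]
    simp only [smul_eq_mul, dotProduct, ← sq]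
    ring
  rw [h1]
  ring

/-- There is exactly one normalizing constant: the mass is a multiple of a positive power of the
maximum of `1 + (1 - q) (θᵀx + xᵀΘx - c)` if this maximum is positive, and zero otherwise. -/
theorem integral_expq_quadForm {n : ℕ} {m : ℝ} (hm : 1 < m) {ω : Param n}
    (hω : ω ∈ paramDomain n) (c : ℝ) :
    ∫ x : Space n, expq (2 - m) (quadForm ω x - c) = 1 ↔
      c = (1 + (m - 1) * height ω - peak n m (-ω.2).det) / (m - 1) := by
  have hA : (-ω.2).PosDef := hω
  have h : 0 < m - 1 := by linarith
  obtain ⟨S, hS, -, hSdet⟩ := exists_conj_eq_one hA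
  have hd : 0 < √(-ω.2).det := Real.sqrt_pos.2 hA.det_pos
  have hS0 : S.det ≠ 0 := by
    rw [← abs_ne_zero, hSdet]; positivity
  have hK := integral_ballWeight_pos n (e := 1 / (m - 1)) (by positivity)
  set lam := 1 + (m - 1) * (height ω - c) with hlam
  have hc : c = (1 + (m - 1) * height ω - peak n m (-ω.2).det) / (m - 1) ↔
      lam = peak n m (-ω.2).det := by
    rw [eq_div_iff h.ne', hlam]
    constructor <;> intro h <;> linarith
  rw [hc]
  simp only [expq_eq_truncPow hm]
  rcases le_or_gt lam 0 with h0 | h0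
  · have hz : ∀ x : Space n, truncPow (1 / (m - 1)) (1 + (m - 1) * (quadForm ω x - c)) = 0 := by
      intro x
      obtain ⟨y, rfl⟩ := surjective_affMap (center ω) (B := (1 : ℝ) • S) (by simpa using hS0) x
      rw [one_add_quadForm_affMap m hω hS]
      refine truncPow_of_nonpos ?_
      have : 0 ≤ (m - 1) * 1 ^ 2 * ‖y‖ ^ 2 := by positivity
      linarith
    simp only [hz, integral_zero]
    have := peak_pos n hm hA.det_pos
    constructor <;> intro h
    · linarith
    · linarith
  · have hb : 0 < √(lam / (m - 1)) := Real.sqrt_pos.2 (by positivity)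
    have hBdet : (√(lam / (m - 1)) • S).det ≠ 0 := by
      rw [Matrix.det_smul]
      exact mul_ne_zero (by positivity) hS0
    have hW : ∀ y : Space n, 1 + (m - 1) *
        (quadForm ω (affMap (center ω) (√(lam / (m - 1)) • S) y) - c) = lam * (1 - ‖y‖ ^ 2) := by
      intro y
      rw [one_add_quadForm_affMap m hω hS, Real.sq_sqrt (by positivity), ← hlam]
      field_simp
    rw [integral_truncPow (W := fun x => 1 + (m - 1) * (quadForm ω x - c)) hBdet h0 hW,
      Matrix.det_smul, abs_mul, hSdet, abs_of_pos (by positivity), Fintype.card_fin]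
    -- the mass is a constant times `lam ^ (1 / (m - 1) + n / 2)`; `n / 2` is from the Jacobian
    have h1 : √(lam / (m - 1)) ^ n = lam ^ ((n : ℝ) / 2) / (m - 1) ^ ((n : ℝ) / 2) := by
      rw [← Real.rpow_natCast, Real.sqrt_eq_rpow, ← Real.rpow_mul (by positivity),
        Real.div_rpow h0.le h.le]
      ring_nf
    rw [h1]
    have hpos : 0 < 1 / (m - 1) + (n : ℝ) / 2 := by positivity
    have h2 : lam ^ ((n : ℝ) / 2) * lam ^ (1 / (m - 1)) = lam ^ (1 / (m - 1) + (n : ℝ) / 2) := by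
      rw [← Real.rpow_add h0, add_comm]
    have hq : 0 < (m - 1) ^ ((n : ℝ) / 2) := by positivity
    have h3 : lam ^ ((n : ℝ) / 2) / (m - 1) ^ ((n : ℝ) / 2) * (√(-ω.2).det)⁻¹ *
        lam ^ (1 / (m - 1)) * (∫ y : Space n, ballWeight (1 / (m - 1)) y) = 1 ↔
        lam ^ (1 / (m - 1) + (n : ℝ) / 2) = (m - 1) ^ ((n : ℝ) / 2) * √(-ω.2).det /
          ∫ y : Space n, ballWeight (1 / (m - 1)) y := by
      rw [← h2, eq_div_iff hK.ne']
      constructor <;> intro h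
      · field_simp at h
        linarith
      · field_simp
        linarith
    rw [h3]
    unfold peak
    constructor <;> intro h
    · rw [← h, ← Real.rpow_mul h0.le, mul_one_div_cancel hpos.ne', Real.rpow_one]
    · rw [h, ← Real.rpow_mul (by positivity), one_div_mul_cancel hpos.ne', Real.rpow_one]

/-- The closed form of the normalizing constant. -/
theorem psi_eq {n : ℕ} {m : ℝ} (hm : 1 < m) {ω : Param n} (hω : ω ∈ paramDomain n) :
    psi (2 - m) ω = (1 + (m - 1) * height ω - peak n m (-ω.2).det) / (m - 1) := by
  have h := Classical.epsilon_spec (p := fun c : ℝ =>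
    ∫ x : Space n, expq (2 - m) (quadForm ω x - c) = 1) ⟨_, (integral_expq_quadForm hm hω _).2 rfl⟩
  exact (integral_expq_quadForm hm hω _).1 h

theorem integral_qGauss {n : ℕ} {m : ℝ} (hm : 1 < m) {ω : Param n} (hω : ω ∈ paramDomain n) :
    ∫ x, qGauss (2 - m) ω x = 1 :=
  (integral_expq_quadForm hm hω _).2 (psi_eq hm hω)

/-- The pressure profile `1 + (1 - q) (θᵀx + xᵀΘx - ψ(θ, Θ))`, of which the `q`-Gaussian is a
truncated power. -/
def pressure {n : ℕ} (m : ℝ) (ω : Param n) (x : Space n) : ℝ :=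
  1 + (m - 1) * (quadForm ω x - psi (2 - m) ω)

theorem qGauss_eq {n : ℕ} {m : ℝ} (hm : 1 < m) (ω : Param n) (x : Space n) :
    qGauss (2 - m) ω x = truncPow (1 / (m - 1)) (pressure m ω x) :=
  expq_eq_truncPow hm _

theorem continuous_quadForm {n : ℕ} (ω : Param n) : Continuous (quadForm ω) := by
  unfold quadForm
  fun_prop

theorem continuous_pressure {n : ℕ} (m : ℝ) (ω : Param n) : Continuous (pressure m ω) := by
  have := continuous_quadForm ω
  unfold pressure
  fun_prop

theorem continuous_qGauss {n : ℕ} {m : ℝ} (hm : 1 < m) (ω : Param n) :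
    Continuous (qGauss (2 - m) ω) := by
  have h : 0 < m - 1 := by linarith
  rw [show qGauss (2 - m) ω = fun x => truncPow (1 / (m - 1)) (pressure m ω x) from
    funext (qGauss_eq hm ω)]
  exact (continuous_truncPow (by positivity)).comp (continuous_pressure m ω)

/-- In suitable affine coordinates the pressure profile of a `q`-Gaussian is a multiple of
`1 - |y|²`. -/
theorem exists_pressure_affMap {n : ℕ} {m : ℝ} (hm : 1 < m) {ω : Param n}
    (hω : ω ∈ paramDomain n) : ∃ B : Matrix (Fin n) (Fin n) ℝ, B.det ≠ 0 ∧
      B * Bᵀ = (peak n m (-ω.2).det / (m - 1)) • (-ω.2)⁻¹ ∧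
      ∀ y, pressure m ω (affMap (center ω) B y) = peak n m (-ω.2).det * (1 - ‖y‖ ^ 2) := by
  have hA : (-ω.2).PosDef := hω
  have h : 0 < m - 1 := by linarith
  obtain ⟨S, hS, hS2, hSdet⟩ := exists_conj_eq_one hA
  have hd : 0 < √(-ω.2).det := Real.sqrt_pos.2 hA.det_pos
  have hS0 : S.det ≠ 0 := by
    rw [← abs_ne_zero, hSdet]; positivity
  have hp := peak_pos n hm hA.det_pos
  have hb : 0 < √(peak n m (-ω.2).det / (m - 1)) := Real.sqrt_pos.2 (by positivity)
  refine ⟨√(peak n m (-ω.2).det / (m - 1)) • S, ?_, ?_, fun y => ?_⟩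
  · rw [Matrix.det_smul]
    exact mul_ne_zero (by positivity) hS0
  · rw [Matrix.transpose_smul, Matrix.smul_mul, Matrix.mul_smul, smul_smul,
      Real.mul_self_sqrt (by positivity), hS2]
  · unfold pressure
    rw [one_add_quadForm_affMap m hω hS, Real.sq_sqrt (by positivity), psi_eq hm hω]
    field_simp
    ring

theorem integrable_qGauss_mul {n : ℕ} (hn : 1 ≤ n) {m : ℝ} (hm : 1 < m) {ω : Param n}
    (hω : ω ∈ paramDomain n) {f : Space n → ℝ} (hf : Continuous f) :
    Integrable fun x => qGauss (2 - m) ω x * f x := by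
  have h : 0 < m - 1 := by linarith
  obtain ⟨B, hB, -, hW⟩ := exists_pressure_affMap hm hω
  simp only [qGauss_eq hm]
  have : 0 < 1 / (m - 1) := by positivity
  exact integrable_truncPow_mul hn hB (peak_pos n hm hω.det_pos) hW (by linarith) hf

theorem integrable_qGauss_rpow {n : ℕ} (hn : 1 ≤ n) {m : ℝ} (hm : 1 < m) {ω : Param n}
    (hω : ω ∈ paramDomain n) : Integrable fun x => qGauss (2 - m) ω x ^ m := by
  have h : 0 < m - 1 := by linarith
  have hc : Continuous fun x => qGauss (2 - m) ω x ^ (m - 1) :=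
    (continuous_qGauss hm ω).rpow_const fun _ => Or.inr h.le
  refine (integrable_qGauss_mul hn hm hω hc).congr (Eventually.of_forall fun x => ?_)
  have hg := qGauss_nonneg (2 - m) ω x
  rcases hg.eq_or_lt with h0 | h0
  · simp [← h0, Real.zero_rpow (show m ≠ 0 by linarith)]
  · simp only
    rw [mul_comm, ← Real.rpow_add_one h0.ne']; ring_nf

theorem isDensity_qGauss {n : ℕ} (hn : 1 ≤ n) {m : ℝ} (hm : 1 < m) {ω : Param n}
    (hω : ω ∈ paramDomain n) : IsDensity (qGauss (2 - m) ω) where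
  nonneg := Eventually.of_forall (qGauss_nonneg _ _)
  integrable := by simpa using integrable_qGauss_mul hn hm hω (f := fun _ => 1) continuous_const
  mass := integral_qGauss hm hω
  second_moment := by
    simpa only [mul_comm] using integrable_qGauss_mul hn hm hω (f := fun x => ‖x‖ ^ 2) (by fun_prop)

/-- The ratio between the covariance matrix of a `q`-Gaussian and `peak • (-Θ)⁻¹`. -/
def covRatio (n : ℕ) (m : ℝ) : ℝ :=
  ballMoment n (1 / (m - 1)) / (∫ y : Space n, ballWeight (1 / (m - 1)) y) / (m - 1)

theorem covRatio_pos {n : ℕ} (hn : 1 ≤ n) {m : ℝ} (hm : 1 < m) : 0 < covRatio n m := by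
  have h : 0 < m - 1 := by linarith
  have hK := integral_ballWeight_pos n (e := 1 / (m - 1)) (by positivity)
  have hM := ballMoment_pos hn (e := 1 / (m - 1)) (by positivity)
  unfold covRatio
  positivity

theorem firstMoment_qGauss {n : ℕ} (hn : 1 ≤ n) {m : ℝ} (hm : 1 < m) {ω : Param n}
    (hω : ω ∈ paramDomain n) : firstMoment (qGauss (2 - m) ω) = center ω := by
  have h : 0 < m - 1 := by linarith
  have h1 : 0 < 1 / (m - 1) := by positivity
  obtain ⟨B, hB, -, hW⟩ := exists_pressure_affMap hm hω
  have hmass := integral_qGauss hm hω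
  simp only [qGauss_eq hm] at hmass
  ext i
  unfold firstMoment
  simp only [qGauss_eq hm, fun x : Space n =>
    mul_comm (x i) (truncPow (1 / (m - 1)) (pressure m ω x))]
  exact integral_truncPow_coord hn hB (peak_pos n hm hω.det_pos) hW (by linarith) hmass i

theorem secondMoment_qGauss {n : ℕ} (hn : 1 ≤ n) {m : ℝ} (hm : 1 < m) {ω : Param n}
    (hω : ω ∈ paramDomain n) : secondMoment (qGauss (2 - m) ω) =
      Matrix.vecMulVec (center ω) (center ω) +
        (covRatio n m * peak n m (-ω.2).det) • (-ω.2)⁻¹ := by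
  have h : 0 < m - 1 := by linarith
  have h1 : 0 < 1 / (m - 1) := by positivity
  obtain ⟨B, hB, hBB, hW⟩ := exists_pressure_affMap hm hω
  have hmass := integral_qGauss hm hω
  simp only [qGauss_eq hm] at hmass
  ext i j
  unfold secondMoment
  simp only [qGauss_eq hm, Matrix.of_apply, fun x : Space n =>
    mul_comm (x i * x j) (truncPow (1 / (m - 1)) (pressure m ω x))]
  rw [integral_truncPow_coord_mul hn hB (peak_pos n hm hω.det_pos) hW (by linarith) hmass i j, hBB]
  simp only [covRatio, Matrix.add_apply, Matrix.vecMulVec_apply, Matrix.smul_apply, smul_eq_mul]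
  ring

/-! ### Quadratic polynomials and their integrals -/

theorem quadForm_eq_sum {n : ℕ} (z : Param n) (x : Space n) :
    quadForm z x = ∑ i, z.1 i * x i + ∑ i, ∑ j, z.2 i j * (x i * x j) := by
  unfold quadForm
  simp only [dotProduct, Matrix.mulVec, Finset.mul_sum]
  congr 1
  exact Finset.sum_congr rfl fun i _ => Finset.sum_congr rfl fun j _ => by ring

theorem quadForm_add {n : ℕ} (z w : Param n) (x : Space n) :
    quadForm (z + w) x = quadForm z x + quadForm w x := by
  simp only [quadForm_eq_sum, Prod.fst_add, Prod.snd_add, PiLp.add_apply, Matrix.add_apply,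
    add_mul, Finset.sum_add_distrib]
  ring

theorem quadForm_smul {n : ℕ} (c : ℝ) (z : Param n) (x : Space n) :
    quadForm (c • z) x = c * quadForm z x := by
  simp only [quadForm_eq_sum, Prod.smul_fst, Prod.smul_snd, PiLp.smul_apply, Matrix.smul_apply,
    smul_eq_mul, mul_assoc, mul_add, Finset.mul_sum]

theorem quadForm_sub {n : ℕ} (z w : Param n) (x : Space n) :
    quadForm (z - w) x = quadForm z x - quadForm w x := by
  have h := quadForm_add (z - w) w x
  rw [sub_add_cancel] at h
  linarith

/-- The integral of `θᵀx + xᵀΘx` against a density with first moment `η` and second moment `H`. -/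
def quadMoment {n : ℕ} (z : Param n) (η : Fin n → ℝ) (H : Matrix (Fin n) (Fin n) ℝ) : ℝ :=
  ∑ i, z.1 i * η i + ∑ i, ∑ j, z.2 i j * H i j

theorem abs_coord_le {n : ℕ} (x : Space n) (i : Fin n) : |x i| ≤ ‖x‖ := by
  simpa using PiLp.norm_apply_le x i

theorem integrable_coord_mul_coord_mul {n : ℕ} {p : Space n → ℝ} (hp : IsDensity p)
    (i j : Fin n) : Integrable fun x : Space n => x i * x j * p x := by
  refine hp.second_moment.norm.mono' ?_ (Eventually.of_forall fun x => ?_)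
  · exact (Continuous.aestronglyMeasurable (by fun_prop)).mul hp.integrable.1
  · rw [norm_mul, norm_mul, norm_mul, Real.norm_eq_abs, Real.norm_eq_abs, norm_pow, norm_norm, sq]
    exact mul_le_mul_of_nonneg_right (mul_le_mul (abs_coord_le x i) (abs_coord_le x j)
      (abs_nonneg _) (norm_nonneg _)) (norm_nonneg _)

theorem integrable_coord_mul {n : ℕ} {p : Space n → ℝ} (hp : IsDensity p)
    (i : Fin n) : Integrable fun x : Space n => x i * p x := by
  refine (hp.integrable.norm.add hp.second_moment.norm).mono' ?_ (Eventually.of_forall fun x => ?_)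
  · exact (Continuous.aestronglyMeasurable (by fun_prop)).mul hp.integrable.1
  · simp only [Pi.add_apply]
    rw [norm_mul, norm_mul, Real.norm_eq_abs, norm_pow, norm_norm, ← one_add_mul]
    refine mul_le_mul_of_nonneg_right ((abs_coord_le x i).trans ?_) (norm_nonneg _)
    nlinarith [sq_nonneg (‖x‖ - 1)]

theorem integrable_mul_quadForm {n : ℕ} {p : Space n → ℝ} (hp : IsDensity p) (z : Param n) :
    Integrable fun x => p x * quadForm z x := by
  have h : (fun x => p x * quadForm z x) = fun x : Space n => ∑ i, z.1 i * (x i * p x) +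
      ∑ i, ∑ j, z.2 i j * (x i * x j * p x) := by
    ext x
    rw [quadForm_eq_sum, mul_add, Finset.mul_sum, Finset.mul_sum]
    congr 1
    · exact Finset.sum_congr rfl fun i _ => by ring
    · refine Finset.sum_congr rfl fun i _ => ?_
      rw [Finset.mul_sum]
      exact Finset.sum_congr rfl fun j _ => by ring
  rw [h]
  exact (integrable_finsetSum _ fun i _ => (integrable_coord_mul hp i).const_mul _).add
    (integrable_finsetSum _ fun i _ => integrable_finsetSum _ fun j _ =>
      (integrable_coord_mul_coord_mul hp i j).const_mul _)

theorem integral_mul_quadForm {n : ℕ} {p : Space n → ℝ} (hp : IsDensity p) (z : Param n) :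
    ∫ x, p x * quadForm z x = quadMoment z (firstMoment p) (secondMoment p) := by
  have h : (fun x => p x * quadForm z x) = fun x : Space n => ∑ i, z.1 i * (x i * p x) +
      ∑ i, ∑ j, z.2 i j * (x i * x j * p x) := by
    ext x
    rw [quadForm_eq_sum, mul_add, Finset.mul_sum, Finset.mul_sum]
    congr 1
    · exact Finset.sum_congr rfl fun i _ => by ring
    · refine Finset.sum_congr rfl fun i _ => ?_
      rw [Finset.mul_sum]
      exact Finset.sum_congr rfl fun j _ => by ring
  have h1 := fun i : Fin n => (integrable_coord_mul hp i).const_mul (z.1 i)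
  have h2 := fun i j : Fin n => (integrable_coord_mul_coord_mul hp i j).const_mul (z.2 i j)
  rw [h, integral_add (integrable_finsetSum _ fun i _ => h1 i)
    (integrable_finsetSum _ fun i _ => integrable_finsetSum _ fun j _ => h2 i j),
    integral_finsetSum _ fun i _ => h1 i,
    integral_finsetSum _ fun i _ => integrable_finsetSum _ fun j _ => h2 i j]
  simp only [integral_finsetSum _ fun j _ => h2 _ j, integral_const_mul]
  simp only [quadMoment, firstMoment, secondMoment, Matrix.of_apply]

/-- A quadratic polynomial without constant term, locally constant somewhere, vanishes. -/
theorem eq_zero_of_quadForm_eventually_const {n : ℕ} {z : Param n} (hz : IsTangent z)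
    {x₀ : Space n} {c : ℝ} (h : ∀ᶠ x in 𝓝 x₀, quadForm z x = c) : z = 0 := by
  have hsymm : z.2ᵀ = z.2 := hz
  -- along each line the polynomial has vanishing first and second order coefficients
  have hline : ∀ v : Fin n → ℝ, v ⬝ᵥ (z.2 *ᵥ v) = 0 ∧
      z.1.ofLp ⬝ᵥ v + (x₀.ofLp ⬝ᵥ (z.2 *ᵥ v) + v ⬝ᵥ (z.2 *ᵥ x₀.ofLp)) = 0 := by
    intro v
    have hexp : ∀ t : ℝ, quadForm z (x₀ + t • WithLp.toLp 2 v) = quadForm z x₀ +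
        t * (z.1.ofLp ⬝ᵥ v + (x₀.ofLp ⬝ᵥ (z.2 *ᵥ v) + v ⬝ᵥ (z.2 *ᵥ x₀.ofLp))) +
        t ^ 2 * (v ⬝ᵥ (z.2 *ᵥ v)) := by
      intro t
      simp only [quadForm, WithLp.ofLp_add, WithLp.ofLp_smul, Matrix.mulVec_add,
        Matrix.mulVec_smul, dotProduct_add, add_dotProduct, dotProduct_smul, smul_dotProduct,
        smul_eq_mul]
      ring
    have hcont : Tendsto (fun t : ℝ => x₀ + t • (WithLp.toLp 2 v : Space n)) (𝓝 0) (𝓝 x₀) := by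
      have : Continuous fun t : ℝ => x₀ + t • (WithLp.toLp 2 v : Space n) := by fun_prop
      simpa using this.tendsto 0
    obtain ⟨δ, hδ, hball⟩ := Metric.eventually_nhds_iff.1 (hcont.eventually h)
    -- compare the values at `±δ/2` with the value at `0`
    have h0 : quadForm z x₀ = c := h.self_of_nhds
    have h1 := hball (y := δ / 2) (by simp [abs_of_pos hδ]; linarith)
    have h2 := hball (y := -(δ / 2)) (by simp [abs_of_pos hδ]; linarith)
    rw [hexp, h0] at h1 h2
    have hq : (δ / 2) ^ 2 * (v ⬝ᵥ (z.2 *ᵥ v)) = 0 := by linarith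
    have hq' := (mul_eq_zero.1 hq).resolve_left (by positivity)
    rw [hq'] at h1
    have hl : (δ / 2) * (z.1.ofLp ⬝ᵥ v + (x₀.ofLp ⬝ᵥ (z.2 *ᵥ v) + v ⬝ᵥ (z.2 *ᵥ x₀.ofLp))) = 0 := by
      linarith
    exact ⟨hq', (mul_eq_zero.1 hl).resolve_left (by positivity)⟩
  have h2 : z.2 = 0 := by
    ext i j
    have ha := (hline (Pi.single i 1 + Pi.single j 1)).1
    have hb := (hline (Pi.single i 1)).1
    have hc := (hline (Pi.single j 1)).1
    have hs : z.2 j i = z.2 i j := congrFun (congrFun hsymm i) j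
    simp only [Matrix.mulVec_add, add_dotProduct, dotProduct_add, Matrix.mulVec_single_one,
      single_one_dotProduct, Matrix.col_apply] at ha hb hc
    simp only [Matrix.zero_apply]
    linarith
  refine Prod.ext ?_ h2
  ext i
  have := (hline (Pi.single i 1)).2
  rw [h2, Matrix.zero_mulVec, Matrix.zero_mulVec, dotProduct_zero, dotProduct_zero] at this
  simpa using this

/-! ### The m-projection is determined by the moments -/

/-- Near the maximum point of `q`-Gaussians that coincide, both are positive, so their quadratic
polynomials agree up to a constant. -/
theorem qGauss_injOn {n : ℕ} {m : ℝ} (hm : 1 < m) {ω ω₀ : Param n} (hω : ω ∈ paramDomain n)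
    (hω₀ : ω₀ ∈ paramDomain n) (h : qGauss (2 - m) ω = qGauss (2 - m) ω₀) : ω = ω₀ := by
  have hm' : 0 < m - 1 := by linarith
  obtain ⟨B, -, -, hW⟩ := exists_pressure_affMap hm hω₀
  have hpos : 0 < pressure m ω₀ (affMap (center ω₀) B 0) := by
    rw [hW]; simpa using peak_pos n hm hω₀.det_pos
  have hev : ∀ᶠ x in 𝓝 (affMap (center ω₀) B 0),
      quadForm (ω - ω₀) x = psi (2 - m) ω - psi (2 - m) ω₀ := by
    filter_upwards [(continuous_pressure m ω₀).continuousAt.eventually (lt_mem_nhds hpos)] with x hx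
    have h1 := congrFun h x
    rw [qGauss_eq hm, qGauss_eq hm, truncPow_of_pos hx] at h1
    have h2 : 0 < pressure m ω x := by
      by_contra hneg
      rw [truncPow_of_nonpos (not_lt.1 hneg)] at h1
      exact (Real.rpow_pos_of_pos hx _).ne h1
    rw [truncPow_of_pos h2, Real.rpow_left_inj h2.le hx.le (by positivity)] at h1
    unfold pressure at h1
    have h3 : quadForm ω x - psi (2 - m) ω = quadForm ω₀ x - psi (2 - m) ω₀ :=
      mul_left_cancel₀ hm'.ne' (by linarith)
    rw [quadForm_sub]
    linarith
  have hs : ∀ ω : Param n, ω ∈ paramDomain n → ω.2ᵀ = ω.2 := by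
    intro ω hω
    have := hω.1
    rw [Matrix.IsHermitian, Matrix.conjTranspose_eq_transpose_of_trivial] at this
    simpa using this
  refine sub_eq_zero.1 (eq_zero_of_quadForm_eventually_const ?_ hev)
  change (ω.2 - ω₀.2)ᵀ = _
  rw [Matrix.transpose_sub, hs ω hω, hs ω₀ hω₀]
  rfl

theorem divIntegrand_sub_ae_eq {n : ℕ} {m : ℝ} (hm : 1 < m) {p : Space n → ℝ} (hp : IsDensity p)
    (ω ω₀ : Param n) :
    (fun x => divIntegrand (2 - m) p ω x - divIntegrand (2 - m) p ω₀ x) =ᵐ[volume] fun x =>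
      (qGauss (2 - m) ω x ^ m / m - qGauss (2 - m) ω₀ x ^ m / m) -
      (p x * quadForm (ω - ω₀) x - p x * (psi (2 - m) ω - psi (2 - m) ω₀)) := by
  filter_upwards [hp.nonneg] with x hx
  rw [divIntegrand_eq hm p ω x hx, divIntegrand_eq hm p ω₀ x hx, quadForm_sub]
  ring

theorem integrable_divIntegrand_sub {n : ℕ} (hn : 1 ≤ n) {m : ℝ} (hm : 1 < m) {p : Space n → ℝ}
    (hp : IsDensity p) {ω ω₀ : Param n} (hω : ω ∈ paramDomain n) (hω₀ : ω₀ ∈ paramDomain n) :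
    Integrable fun x => divIntegrand (2 - m) p ω x - divIntegrand (2 - m) p ω₀ x :=
  ((((integrable_qGauss_rpow hn hm hω).div_const m).sub
    ((integrable_qGauss_rpow hn hm hω₀).div_const m)).sub
    ((integrable_mul_quadForm hp _).sub (hp.integrable.mul_const _))).congr
    (divIntegrand_sub_ae_eq hm hp ω ω₀).symm

/-- Differences of divergences from `p` see only the first and second moments of `p`. -/
theorem integral_divIntegrand_sub {n : ℕ} (hn : 1 ≤ n) {m : ℝ} (hm : 1 < m) {p : Space n → ℝ}
    (hp : IsDensity p) {ω ω₀ : Param n} (hω : ω ∈ paramDomain n) (hω₀ : ω₀ ∈ paramDomain n) :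
    ∫ x, (divIntegrand (2 - m) p ω x - divIntegrand (2 - m) p ω₀ x) =
      ((∫ x, qGauss (2 - m) ω x ^ m) / m - (∫ x, qGauss (2 - m) ω₀ x ^ m) / m) -
      (quadMoment (ω - ω₀) (firstMoment p) (secondMoment p)
        - (psi (2 - m) ω - psi (2 - m) ω₀)) := by
  have h1 := (integrable_qGauss_rpow hn hm hω).div_const m
  have h2 := (integrable_qGauss_rpow hn hm hω₀).div_const m
  have h3 := integrable_mul_quadForm hp (ω - ω₀)
  have h4 := hp.integrable.mul_const (psi (2 - m) ω - psi (2 - m) ω₀)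
  rw [integral_congr_ae (divIntegrand_sub_ae_eq hm hp ω ω₀)]
  have h5 := integral_sub (h1.sub h2) (h3.sub h4)
  simp only [Pi.sub_apply] at h5
  rw [h5, integral_sub h1 h2, integral_sub h3 h4, integral_mul_quadForm hp, integral_div,
    integral_div, integral_mul_const, hp.mass, one_mul]

/-- The Pythagorean relation in its strict form: among all `q`-Gaussians, the one with the moments
of `p` is strictly closest to `p`. -/
theorem integral_divIntegrand_sub_pos {n : ℕ} (hn : 1 ≤ n) {m : ℝ} (hm : 1 < m)
    {p : Space n → ℝ} (hp : IsDensity p) {ω ω₀ : Param n} (hω : ω ∈ paramDomain n)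
    (hω₀ : ω₀ ∈ paramDomain n) (h1 : firstMoment (qGauss (2 - m) ω₀) = firstMoment p)
    (h2 : secondMoment (qGauss (2 - m) ω₀) = secondMoment p) (hne : ω ≠ ω₀) :
    0 < ∫ x, (divIntegrand (2 - m) p ω x - divIntegrand (2 - m) p ω₀ x) := by
  have hd := isDensity_qGauss hn hm hω₀
  have hint := integrable_divIntegrand_sub hn hm hd hω hω₀
  -- `p` may be replaced by the `q`-Gaussian at `ω₀`, which has the same moments
  rw [integral_divIntegrand_sub hn hm hp hω hω₀, ← h1, ← h2,
    ← integral_divIntegrand_sub hn hm hd hω hω₀]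
  simp only [divIntegrand_qGauss_self hm, sub_zero] at hint ⊢
  have hnn : 0 ≤ fun x => divIntegrand (2 - m) (qGauss (2 - m) ω₀) ω x :=
    fun x => divIntegrand_nonneg hm _ _ _ (qGauss_nonneg _ _ _)
  refine lt_of_le_of_ne (integral_nonneg hnn) fun h0 => hne ?_
  have hz := (integral_eq_zero_iff_of_nonneg hnn hint).1 h0.symm
  have hae : qGauss (2 - m) ω₀ =ᵐ[volume] qGauss (2 - m) ω := by
    filter_upwards [hz] with x hx
    exact eq_qGauss_of_divIntegrand_eq_zero hm _ ω x (qGauss_nonneg _ _ _) hx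
  exact qGauss_injOn hm hω hω₀ (((continuous_qGauss hm ω₀).ae_eq_iff_eq volume
    (continuous_qGauss hm ω)).1 hae).symm

/-- A `q`-Gaussian is determined by its moments: otherwise each of two would be strictly closer than
the other to the first of them. -/
theorem eq_of_moments_eq {n : ℕ} (hn : 1 ≤ n) {m : ℝ} (hm : 1 < m) {ω ω₀ : Param n}
    (hω : ω ∈ paramDomain n) (hω₀ : ω₀ ∈ paramDomain n)
    (h1 : firstMoment (qGauss (2 - m) ω) = firstMoment (qGauss (2 - m) ω₀))
    (h2 : secondMoment (qGauss (2 - m) ω) = secondMoment (qGauss (2 - m) ω₀)) : ω = ω₀ := by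
  by_contra hne
  have ha := integral_divIntegrand_sub_pos hn hm (isDensity_qGauss hn hm hω₀) hω hω₀ rfl rfl hne
  have hb := integral_divIntegrand_sub_pos hn hm (isDensity_qGauss hn hm hω₀) hω₀ hω h1 h2
    (Ne.symm hne)
  rw [integral_divIntegrand_sub hn hm (isDensity_qGauss hn hm hω₀) hω₀ hω] at hb
  rw [integral_divIntegrand_sub hn hm (isDensity_qGauss hn hm hω₀) hω hω₀] at ha
  have hq : ∀ z w : Param n, ∀ η H, quadMoment (z - w) η H = quadMoment z η H - quadMoment w η H := by
    intro z w η H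
    simp only [quadMoment, Prod.fst_sub, Prod.snd_sub, PiLp.sub_apply, Matrix.sub_apply, sub_mul,
      Finset.sum_sub_distrib]
    ring
  rw [hq] at ha hb
  linarith

theorem isMProjection_iff_eq {n : ℕ} (hn : 1 ≤ n) {m : ℝ} (hm : 1 < m) {p : Space n → ℝ}
    (hp : IsDensity p) {ω₀ : Param n} (hω₀ : ω₀ ∈ paramDomain n)
    (h1 : firstMoment (qGauss (2 - m) ω₀) = firstMoment p)
    (h2 : secondMoment (qGauss (2 - m) ω₀) = secondMoment p) (ω : Param n) :
    IsMProjection (2 - m) p ω ↔ ω = ω₀ := by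
  constructor
  · rintro ⟨hω, hmin⟩
    by_contra hne
    have ha := integral_divIntegrand_sub_pos hn hm hp hω hω₀ h1 h2 hne
    have hb := (hmin ω₀ hω₀).2
    have hc : ∀ x, divIntegrand (2 - m) p ω₀ x - divIntegrand (2 - m) p ω x =
        -(divIntegrand (2 - m) p ω x - divIntegrand (2 - m) p ω₀ x) := fun x => by ring
    simp only [hc, integral_neg] at hb
    linarith
  · rintro rfl
    refine ⟨hω₀, fun ω' hω' => ⟨integrable_divIntegrand_sub hn hm hp hω' hω₀, ?_⟩⟩
    rcases eq_or_ne ω' ω with rfl | hne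
    · simp
    · exact (integral_divIntegrand_sub_pos hn hm hp hω' hω₀ h1 h2 hne).le

theorem integrable_divIntegrand {n : ℕ} (hn : 1 ≤ n) {m : ℝ} (hm : 1 < m) {p : Space n → ℝ}
    (hp : IsDensity p) (hpm : Integrable fun x => p x ^ m) {ω : Param n} (hω : ω ∈ paramDomain n) :
    Integrable (divIntegrand (2 - m) p ω) := by
  refine (((((integrable_qGauss_rpow hn hm hω).sub hpm).div_const m).sub
    ((integrable_mul_quadForm hp ω).sub (hp.integrable.mul_const (psi (2 - m) ω)))).add
    ((hpm.sub hp.integrable).div_const (m - 1))).congr ?_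
  filter_upwards [hp.nonneg] with x hx
  rw [divIntegrand_eq hm p ω x hx]
  simp only [Pi.add_apply, Pi.sub_apply]
  ring

theorem bregmanDiv_lt {n : ℕ} (hn : 1 ≤ n) {m : ℝ} (hm : 1 < m) {p : Space n → ℝ}
    (hp : IsDensity p) (hpm : Integrable fun x => p x ^ m) {ω ω₀ : Param n}
    (hω : ω ∈ paramDomain n) (hω₀ : ω₀ ∈ paramDomain n)
    (h1 : firstMoment (qGauss (2 - m) ω₀) = firstMoment p)
    (h2 : secondMoment (qGauss (2 - m) ω₀) = secondMoment p) (hne : ω ≠ ω₀) :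
    bregmanDiv (2 - m) p ω₀ < bregmanDiv (2 - m) p ω := by
  have h := integral_divIntegrand_sub_pos hn hm hp hω hω₀ h1 h2 hne
  rw [integral_sub (integrable_divIntegrand hn hm hp hpm hω)
    (integrable_divIntegrand hn hm hp hpm hω₀)] at h
  exact sub_pos.1 h

/-! ### Time cut-offs -/

/-- A smooth function of time that is `1` on `[-1, t]` and `0` outside of `[-2, t + ε]`. -/
def timeCutoff (t ε s : ℝ) : ℝ :=
  Real.smoothTransition ((t + ε - s) / ε) * Real.smoothTransition (s + 2)

theorem contDiff_timeCutoff (t ε : ℝ) :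
    ContDiff ℝ ((⊤ : ℕ∞) : WithTop ℕ∞) (timeCutoff t ε) :=
  (Real.smoothTransition.contDiff.comp (by fun_prop)).mul
    (Real.smoothTransition.contDiff.comp (by fun_prop))

theorem timeCutoff_eq_zero {t ε s : ℝ} (hε : 0 < ε) (hs : t + ε ≤ s) : timeCutoff t ε s = 0 := by
  rw [timeCutoff, Real.smoothTransition.zero_of_nonpos, zero_mul]
  exact div_nonpos_of_nonpos_of_nonneg (by linarith) hε.le

theorem hasCompactSupport_timeCutoff (t : ℝ) {ε : ℝ} (hε : 0 < ε) :
    HasCompactSupport (timeCutoff t ε) := by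
  refine HasCompactSupport.of_support_subset_isCompact (isCompact_Icc (a := -2) (b := t + ε)) ?_
  intro s hs
  by_contra hmem
  rw [mem_Icc, not_and_or, not_le, not_le] at hmem
  refine hs ?_
  rcases hmem with h | h
  · rw [timeCutoff, Real.smoothTransition.zero_of_nonpos (x := s + 2) (by linarith), mul_zero]
  · exact timeCutoff_eq_zero hε h.le

theorem timeCutoff_of_nonneg {t ε s : ℝ} (hs : -1 ≤ s) :
    timeCutoff t ε s = Real.smoothTransition ((t + ε - s) / ε) := by
  rw [timeCutoff, Real.smoothTransition.one_of_one_le (x := s + 2) (by linarith), mul_one]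

theorem timeCutoff_eq_one {t ε s : ℝ} (hε : 0 < ε) (hs : -1 ≤ s) (hst : s ≤ t) :
    timeCutoff t ε s = 1 := by
  rw [timeCutoff_of_nonneg hs, Real.smoothTransition.one_of_one_le]
  rw [le_div_iff₀ hε]
  linarith

theorem timeCutoff_nonneg (t ε s : ℝ) : 0 ≤ timeCutoff t ε s :=
  mul_nonneg (Real.smoothTransition.nonneg _) (Real.smoothTransition.nonneg _)

theorem timeCutoff_le_one (t ε s : ℝ) : timeCutoff t ε s ≤ 1 :=
  mul_le_one₀ (Real.smoothTransition.le_one _) (Real.smoothTransition.nonneg _)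
    (Real.smoothTransition.le_one _)

theorem deriv_timeCutoff_nonpos {t ε s : ℝ} (hε : 0 < ε) (hs : 0 < s) :
    deriv (timeCutoff t ε) s ≤ 0 := by
  have h1 : timeCutoff t ε =ᶠ[𝓝 s] fun s => Real.smoothTransition ((t + ε - s) / ε) := by
    filter_upwards [lt_mem_nhds hs] with r hr using timeCutoff_of_nonneg (by linarith)
  rw [h1.deriv_eq]
  refine Antitone.deriv_nonpos fun a b hab => Real.smoothTransition.monotone ?_
  gcongr

theorem deriv_timeCutoff_eq_zero {t ε s : ℝ} (hε : 0 < ε) (hs : 0 < s) (h : s ∉ Icc t (t + ε)) :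
    deriv (timeCutoff t ε) s = 0 := by
  rw [mem_Icc, not_and_or, not_le, not_le] at h
  rcases h with h | h
  · have h1 : timeCutoff t ε =ᶠ[𝓝 s] fun _ => 1 := by
      filter_upwards [lt_mem_nhds hs, gt_mem_nhds h] with r hr hr'
      exact timeCutoff_eq_one hε (by linarith) hr'.le
    rw [h1.deriv_eq, deriv_const]
  · have h1 : timeCutoff t ε =ᶠ[𝓝 s] fun _ => 0 := by
      filter_upwards [lt_mem_nhds h] with r hr using timeCutoff_eq_zero hε hr.le
    rw [h1.deriv_eq, deriv_const]

theorem integrable_deriv_timeCutoff (t : ℝ) {ε : ℝ} (hε : 0 < ε) :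
    Integrable (deriv (timeCutoff t ε)) :=
  ((contDiff_timeCutoff t ε).continuous_deriv (by simp)).integrable_of_hasCompactSupport
    (hasCompactSupport_timeCutoff t hε).deriv

theorem integral_deriv_timeCutoff {t ε : ℝ} (ht : 0 ≤ t) (hε : 0 < ε) :
    ∫ s in Ioi (0 : ℝ), deriv (timeCutoff t ε) s = -1 := by
  have hd : Differentiable ℝ (timeCutoff t ε) :=
    (contDiff_timeCutoff t ε).differentiable (by simp)
  rw [integral_Ioi_of_hasDerivAt_of_tendsto (f := timeCutoff t ε) (m := 0)
    hd.continuous.continuousWithinAt (fun x _ => (hd x).hasDerivAt)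
    (integrable_deriv_timeCutoff t hε).integrableOn, timeCutoff_eq_one hε (by norm_num) ht, zero_sub]
  refine tendsto_const_nhds.congr' ?_
  filter_upwards [eventually_ge_atTop (t + ε)] with s hs using (timeCutoff_eq_zero hε hs).symm

theorem Ioi_zero_eq_iUnion_Ioc : Ioi (0 : ℝ) = ⋃ k : ℕ, Ioc 0 ((k : ℝ) + 1) := by
  ext s
  simp only [mem_Ioi, mem_iUnion, mem_Ioc]
  constructor
  · intro hs
    obtain ⟨k, hk⟩ := exists_nat_ge s
    exact ⟨k, hs, by linarith⟩
  · rintro ⟨k, hs, -⟩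
    exact hs

/-- A continuous function whose distributional derivative on `[0, ∞)`, with initial value, is the
locally integrable function `b`, is a primitive of `b`. -/
theorem eq_add_integral_of_weak_deriv {A b : ℝ → ℝ} (hA : ContinuousOn A (Ici 0))
    (hb : ∀ T, 0 < T → IntegrableOn b (Ioc 0 T))
    (h : ∀ χ : ℝ → ℝ, ContDiff ℝ ((⊤ : ℕ∞) : WithTop ℕ∞) χ → HasCompactSupport χ →
      (∫ s in Ioi (0 : ℝ), (deriv χ s * A s + χ s * b s)) + χ 0 * A 0 = 0)
    {t : ℝ} (ht : 0 ≤ t) : A t = A 0 + ∫ s in (0 : ℝ)..t, b s := by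
  obtain ⟨C, hC⟩ := (isCompact_Icc (a := (0 : ℝ)) (b := t + 1)).exists_bound_of_continuousOn
    (hA.mono fun x hx => hx.1)
  have hχA : ∀ ε, 0 < ε → ε ≤ 1 →
      IntegrableOn (fun s => deriv (timeCutoff t ε) s * A s) (Ioi 0) := by
    intro ε hε hε1
    refine ((integrable_deriv_timeCutoff t hε).norm.mul_const C).integrableOn.mono' ?_ ?_
    · exact (integrable_deriv_timeCutoff t hε).integrableOn.1.mul
        ((hA.mono Ioi_subset_Ici_self).aestronglyMeasurable measurableSet_Ioi)
    · filter_upwards [ae_restrict_mem measurableSet_Ioi] with s hs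
      rw [norm_mul]
      by_cases hmem : s ∈ Icc t (t + ε)
      · exact mul_le_mul_of_nonneg_left (hC s ⟨(mem_Ioi.1 hs).le, hmem.2.trans (by linarith)⟩)
          (norm_nonneg _)
      · simp [deriv_timeCutoff_eq_zero hε hs hmem]
  -- `b` on `(0, t + 1]` dominates all the products with cut-offs
  have hbound : ∀ ε, 0 < ε → ε ≤ 1 → ∀ s ∈ Ioi (0 : ℝ),
      ‖timeCutoff t ε s * b s‖ ≤ ‖(Ioc 0 (t + 1)).indicator b s‖ := by
    intro ε hε hε1 s hs
    rcases le_or_gt s (t + 1) with hle | hlt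
    · rw [indicator_of_mem (show s ∈ Ioc 0 (t + 1) from ⟨hs, hle⟩), norm_mul,
        Real.norm_of_nonneg (timeCutoff_nonneg _ _ _)]
      exact mul_le_of_le_one_left (norm_nonneg _) (timeCutoff_le_one _ _ _)
    · rw [timeCutoff_eq_zero hε (by linarith)]; simp
  have hbi : IntegrableOn (fun s => ‖(Ioc 0 (t + 1)).indicator b s‖) (Ioi 0) :=
    (((hb (t + 1) (by linarith)).integrable_indicator measurableSet_Ioc).norm).integrableOn
  have hbm : AEStronglyMeasurable b (volume.restrict (Ioi 0)) := by
    rw [Ioi_zero_eq_iUnion_Ioc, aestronglyMeasurable_iUnion_iff]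
    exact fun k => (hb _ (by positivity)).1
  have hχb : ∀ ε, 0 < ε → ε ≤ 1 →
      IntegrableOn (fun s => timeCutoff t ε s * b s) (Ioi 0) := by
    intro ε hε hε1
    refine hbi.mono' ((contDiff_timeCutoff t ε).continuous.aestronglyMeasurable.mul hbm) ?_
    filter_upwards [ae_restrict_mem measurableSet_Ioi] with s hs using hbound ε hε hε1 s hs
  set ε : ℕ → ℝ := fun k => 1 / ((k : ℝ) + 1) with hεdef
  have hε0 : ∀ k, 0 < ε k := fun k => by simp only [hεdef]; positivity
  have hε1 : ∀ k, ε k ≤ 1 := fun k => by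
    simp only [hεdef]
    rw [div_le_one (by positivity)]
    linarith [(Nat.cast_nonneg k : (0 : ℝ) ≤ k)]
  have hεlim : Tendsto ε atTop (𝓝 0) := tendsto_one_div_add_atTop_nhds_zero_nat
  -- `-deriv (timeCutoff t ε)` is a nonnegative kernel of mass one, concentrated on `[t, t + ε]`, so
  -- the right hand side tends to zero by continuity of `A` at `t`
  have hkey : ∀ k, A 0 - A t + ∫ s in Ioi (0 : ℝ), timeCutoff t (ε k) s * b s =
      -∫ s in Ioi (0 : ℝ), deriv (timeCutoff t (ε k)) s * (A s - A t) := by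
    intro k
    have h1 := h _ (contDiff_timeCutoff t (ε k)) (hasCompactSupport_timeCutoff t (hε0 k))
    rw [integral_add (hχA _ (hε0 k) (hε1 k)) (hχb _ (hε0 k) (hε1 k)),
      timeCutoff_eq_one (hε0 k) (by norm_num) ht, one_mul] at h1
    have h2 : ∫ s in Ioi (0 : ℝ), deriv (timeCutoff t (ε k)) s * (A s - A t) =
        (∫ s in Ioi (0 : ℝ), deriv (timeCutoff t (ε k)) s * A s) + A t := by
      simp only [mul_sub]
      rw [integral_sub (hχA _ (hε0 k) (hε1 k))
        ((integrable_deriv_timeCutoff t (hε0 k)).integrableOn.mul_const _), integral_mul_const,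
        integral_deriv_timeCutoff ht (hε0 k)]
      ring
    rw [h2]
    linarith
  have hlim1 : Tendsto (fun k => A 0 - A t + ∫ s in Ioi (0 : ℝ), timeCutoff t (ε k) s * b s) atTop
      (𝓝 0) := by
    rw [Metric.tendsto_atTop]
    intro δ hδ
    obtain ⟨r, hr, hr2⟩ := Metric.continuousWithinAt_iff.1 (hA t ht) (δ / 2) (by positivity)
    obtain ⟨N, hN⟩ := (Metric.tendsto_atTop.1 hεlim) r hr
    refine ⟨N, fun k hk => ?_⟩
    have hεr : ε k < r := by simpa [abs_of_pos (hε0 k)] using hN k hk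
    rw [hkey k, dist_zero_right, norm_neg]
    have hle : ‖∫ s in Ioi (0 : ℝ), deriv (timeCutoff t (ε k)) s * (A s - A t)‖ ≤
        ∫ s in Ioi (0 : ℝ), -deriv (timeCutoff t (ε k)) s * (δ / 2) := by
      refine norm_integral_le_of_norm_le
        ((integrable_deriv_timeCutoff t (hε0 k)).neg.integrableOn.mul_const _) ?_
      filter_upwards [ae_restrict_mem measurableSet_Ioi] with s hs
      rw [norm_mul, Real.norm_of_nonpos (deriv_timeCutoff_nonpos (hε0 k) hs)]
      by_cases hmem : s ∈ Icc t (t + ε k)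
      · refine mul_le_mul_of_nonneg_left ?_
          (neg_nonneg.2 (deriv_timeCutoff_nonpos (hε0 k) hs))
        have hdist : dist s t < r := by
          rw [Real.dist_eq, abs_of_nonneg (by linarith [hmem.1])]
          linarith [hmem.2]
        exact (hr2 (mem_Ioi.1 hs).le hdist).le
      · simp [deriv_timeCutoff_eq_zero (hε0 k) hs hmem]
    rw [integral_mul_const, integral_neg, integral_deriv_timeCutoff ht (hε0 k)] at hle
    linarith
  have hlim2 : Tendsto (fun k => ∫ s in Ioi (0 : ℝ), timeCutoff t (ε k) s * b s) atTop
      (𝓝 (∫ s in Ioi (0 : ℝ), (Ioc 0 t).indicator b s)) := by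
    refine tendsto_integral_of_dominated_convergence
      (fun s => ‖(Ioc 0 (t + 1)).indicator b s‖)
      (fun k => (hχb _ (hε0 k) (hε1 k)).1) hbi (fun k => ?_) ?_
    · filter_upwards [ae_restrict_mem measurableSet_Ioi] with s hs
        using hbound _ (hε0 k) (hε1 k) s hs
    · filter_upwards [ae_restrict_mem measurableSet_Ioi] with s hs
      rcases le_or_gt s t with hst | hst
      · rw [indicator_of_mem (show s ∈ Ioc 0 t from ⟨hs, hst⟩)]
        refine tendsto_const_nhds.congr fun k => ?_
        rw [timeCutoff_eq_one (hε0 k) (by linarith [mem_Ioi.1 hs]) hst, one_mul]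
      · rw [indicator_of_notMem (fun hm => hst.not_ge hm.2)]
        refine tendsto_const_nhds.congr' ?_
        filter_upwards [hεlim.eventually (gt_mem_nhds (show (0 : ℝ) < s - t by linarith))] with k hk
        rw [timeCutoff_eq_zero (hε0 k) (by linarith), zero_mul]
  have hlim3 := tendsto_nhds_unique hlim1 (hlim2.const_add (A 0 - A t))
  have hset : ∫ s in Ioi (0 : ℝ), (Ioc 0 t).indicator b s = ∫ s in (0 : ℝ)..t, b s := by
    rw [setIntegral_indicator measurableSet_Ioc, intervalIntegral.integral_of_le ht,
      inter_eq_self_of_subset_right Ioc_subset_Ioi_self]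
  rw [hset] at hlim3
  linarith

theorem two_le_smooth : (2 : WithTop ℕ∞) ≤ ((⊤ : ℕ∞) : WithTop ℕ∞) := by
  exact WithTop.coe_le_coe.2 (le_top : (2 : ℕ∞) ≤ ⊤)

/-! ### Laplacians of rescaled test functions -/

theorem laplacian_eq_sum {n : ℕ} (f : Space n → ℝ) (x : Space n) :
    Laplacian.laplacian f x = ∑ i : Fin n, iteratedFDeriv ℝ 2 f x
      ![EuclideanSpace.single i 1, EuclideanSpace.single i 1] := by
  rw [InnerProductSpace.laplacian_eq_iteratedFDeriv_orthonormalBasis f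
    (EuclideanSpace.basisFun (Fin n) ℝ)]
  simp

theorem continuous_laplacian {n : ℕ} {f : Space n → ℝ} (hf : ContDiff ℝ 2 f) :
    Continuous (Laplacian.laplacian f) := by
  rw [show Laplacian.laplacian f = fun x => ∑ i : Fin n, iteratedFDeriv ℝ 2 f x
      ![EuclideanSpace.single i 1, EuclideanSpace.single i 1] from funext (laplacian_eq_sum f)]
  have h := hf.continuous_iteratedFDeriv (m := 2) le_rfl
  refine continuous_finsetSum _ fun i _ => ?_
  exact (ContinuousMultilinearMap.apply ℝ (fun _ : Fin 2 => Space n) ℝ _).continuous.comp h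

theorem exists_bound_laplacian {n : ℕ} {f : Space n → ℝ} (hf : ContDiff ℝ 2 f)
    (hc : HasCompactSupport f) : ∃ C, ∀ x, ‖Laplacian.laplacian f x‖ ≤ C := by
  refine (?_ : HasCompactSupport (Laplacian.laplacian f)).exists_bound_of_continuous
    (continuous_laplacian hf)
  refine HasCompactSupport.of_support_subset_isCompact (hc.iteratedFDeriv (𝕜 := ℝ) 2) ?_
  intro x hx
  by_contra hmem
  refine hx ?_
  rw [laplacian_eq_sum, image_eq_zero_of_notMem_tsupport hmem]
  simp

theorem laplacian_comp_smul {n : ℕ} {f : Space n → ℝ} (hf : ContDiff ℝ 2 f) (a c : ℝ)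
    (x : Space n) : Laplacian.laplacian (fun x => a * f (c • x)) x =
      a * c ^ 2 * Laplacian.laplacian f (c • x) := by
  set g : Space n →L[ℝ] Space n := c • ContinuousLinearMap.id ℝ (Space n) with hg
  have h1 : (fun x : Space n => a * f (c • x)) = a • (f ∘ g) := by
    ext x; simp [hg]
  have hfg : ContDiff ℝ 2 (f ∘ g) := hf.comp g.contDiff
  rw [h1, InnerProductSpace.laplacian_smul a hfg.contDiffAt, laplacian_eq_sum, laplacian_eq_sum,
    smul_eq_mul, mul_assoc, Finset.mul_sum (a := c ^ 2)]
  congr 1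
  refine Finset.sum_congr rfl fun i _ => ?_
  rw [g.iteratedFDeriv_comp_right hf x (i := 2) le_rfl,
    ContinuousMultilinearMap.compContinuousLinearMap_apply]
  have h2 : (fun j : Fin 2 => g ((![EuclideanSpace.single i 1, EuclideanSpace.single i 1] :
      Fin 2 → Space n) j)) = fun j : Fin 2 => (fun _ => c) j •
        (![EuclideanSpace.single i 1, EuclideanSpace.single i 1] : Fin 2 → Space n) j := by
    ext j; simp [hg]
  rw [h2, ContinuousMultilinearMap.map_smul_univ]
  simp [hg]

theorem laplacian_const_mul {n : ℕ} {f : Space n → ℝ} (hf : ContDiff ℝ 2 f) (a : ℝ)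
    (x : Space n) : Laplacian.laplacian (fun x => a * f x) x = a * Laplacian.laplacian f x := by
  simpa using laplacian_comp_smul hf a 1 x

theorem laplacian_coord_mul {n : ℕ} (i j : Fin n) (x : Space n) :
    Laplacian.laplacian (fun x : Space n => x i * x j) x = if i = j then 2 else 0 := by
  have h1 : fderiv ℝ (fun x : Space n => x i * x j) = fun x : Space n =>
      x i • (EuclideanSpace.proj j : Space n →L[ℝ] ℝ) +
        x j • (EuclideanSpace.proj i : Space n →L[ℝ] ℝ) := by
    ext1 x
    exact ((EuclideanSpace.proj i : Space n →L[ℝ] ℝ).hasFDerivAt.mul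
      (EuclideanSpace.proj j : Space n →L[ℝ] ℝ).hasFDerivAt).fderiv
  have h2 : fderiv ℝ (fun x : Space n => x i • (EuclideanSpace.proj j : Space n →L[ℝ] ℝ) +
        x j • (EuclideanSpace.proj i : Space n →L[ℝ] ℝ)) x =
      (EuclideanSpace.proj i : Space n →L[ℝ] ℝ).smulRight (EuclideanSpace.proj j : Space n →L[ℝ] ℝ)
      + (EuclideanSpace.proj j : Space n →L[ℝ] ℝ).smulRight
        (EuclideanSpace.proj i : Space n →L[ℝ] ℝ) := by
    exact (((EuclideanSpace.proj i : Space n →L[ℝ] ℝ).hasFDerivAt (x := x)).smul_const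
      (EuclideanSpace.proj j : Space n →L[ℝ] ℝ)).add
      (((EuclideanSpace.proj j : Space n →L[ℝ] ℝ).hasFDerivAt (x := x)).smul_const
      (EuclideanSpace.proj i : Space n →L[ℝ] ℝ)) |>.fderiv
  rw [laplacian_eq_sum]
  simp only [iteratedFDeriv_two_apply, h1, h2]
  simp only [add_apply, ContinuousLinearMap.smulRight_apply,
    smul_apply, EuclideanSpace.proj, PiLp.proj_apply, Matrix.cons_val_zero,
    Matrix.cons_val_one, smul_eq_mul, PiLp.single_apply]
  split_ifs with hij
  · subst hij
    simp [Finset.sum_add_distrib]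
    norm_num
  · refine Finset.sum_eq_zero fun l _ => ?_
    by_cases h : i = l
    · subst h; simp [Ne.symm hij]
    · simp [h]

/-! ### Moments of weak solutions -/

section WeakSolution

variable {n : ℕ} {m : ℝ} {u : ℝ → Space n → ℝ}

theorem integrable_rpow_mul_prod (hu : IsWeakSolution m u) {T : ℝ} (hT : 0 < T)
    {g : Space n → ℝ} (hg : Continuous g) {C : ℝ} (hC : ∀ x, ‖g x‖ ≤ C) :
    Integrable (fun z : ℝ × Space n => u z.1 z.2 ^ m * g z.2)
      ((volume.restrict (Ioc 0 T)).prod volume) := by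
  refine ((hu.integrable_rpow_prod T hT).norm.mul_const C).mono'
    ((hu.integrable_rpow_prod T hT).1.mul
      (hg.comp continuous_snd).aestronglyMeasurable) (Eventually.of_forall fun z => ?_)
  rw [norm_mul]
  exact mul_le_mul_of_nonneg_left (hC _) (norm_nonneg _)

theorem ae_integrable_rpow (hu : IsWeakSolution m u) :
    ∀ᵐ s ∂(volume.restrict (Ioi (0 : ℝ))), Integrable fun x => u s x ^ m := by
  rw [Ioi_zero_eq_iUnion_Ioc, ae_restrict_iUnion_iff]
  exact fun k => (hu.integrable_rpow_prod _ (by positivity)).prod_right_ae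

/-- The weak formulation at a fixed time, for a test function that does not depend on time. -/
theorem integral_mul_testFunction (hu : IsWeakSolution m u) {φ : Space n → ℝ}
    (hφ : ContDiff ℝ ((⊤ : ℕ∞) : WithTop ℕ∞) φ) (hc : HasCompactSupport φ) {t : ℝ} (ht : 0 ≤ t) :
    ∫ x, u t x * φ x = (∫ x, u 0 x * φ x) +
      ∫ s in (0 : ℝ)..t, ∫ x, u s x ^ m * Laplacian.laplacian φ x := by
  have hφ2 : ContDiff ℝ 2 φ := hφ.of_le two_le_smooth
  obtain ⟨C, hC⟩ := hc.exists_bound_of_continuous hφ.continuous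
  obtain ⟨C', hC'⟩ := exists_bound_laplacian hφ2 hc
  have hint : ∀ s, 0 ≤ s → Integrable fun x => u s x * φ x := fun s hs =>
    (hu.integrable s hs).mul_bdd (c := _) hφ.continuous.aestronglyMeasurable (Eventually.of_forall hC)
  refine eq_add_integral_of_weak_deriv (A := fun s => ∫ x, u s x * φ x)
    (b := fun s => ∫ x, u s x ^ m * Laplacian.laplacian φ x) ?_ ?_ ?_ ht
  · intro t₀ ht₀
    rw [ContinuousWithinAt, tendsto_iff_dist_tendsto_zero]
    have h1 := (hu.continuous_L1 t₀ ht₀).mul_const C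
    rw [zero_mul] at h1
    refine squeeze_zero' (Eventually.of_forall fun _ => dist_nonneg) ?_ h1
    filter_upwards [self_mem_nhdsWithin] with s hs
    rw [Real.dist_eq, ← integral_sub (hint s hs) (hint t₀ ht₀), ← integral_mul_const]
    rw [← Real.norm_eq_abs]
    refine norm_integral_le_of_norm_le
      (((hu.integrable s hs).sub (hu.integrable t₀ ht₀)).norm.mul_const C)
      (Eventually.of_forall fun x => ?_)
    rw [← sub_mul, norm_mul]
    exact mul_le_mul_of_nonneg_left (hC x) (norm_nonneg _)
  · intro T hT
    exact (integrable_rpow_mul_prod hu hT (continuous_laplacian hφ2) hC').integral_prod_left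
  · intro χ hχ hχc
    have hw := hu.weak_eq (fun s x => χ s * φ x)
      ((hχ.comp contDiff_fst).mul (hφ.comp contDiff_snd)) (by
        refine HasCompactSupport.of_support_subset_isCompact (hχc.isCompact.prod hc.isCompact) ?_
        intro z hz
        have hz' : χ z.1 * φ z.2 ≠ 0 := hz
        exact ⟨subset_tsupport _ (left_ne_zero_of_mul hz'),
          subset_tsupport _ (right_ne_zero_of_mul hz')⟩)
    have h0 : ∫ x, u 0 x * (χ 0 * φ x) = χ 0 * ∫ x, u 0 x * φ x := by
      rw [← integral_const_mul]
      congr 1 with x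
      ring
    rw [h0] at hw
    refine Eq.trans (congrArg (· + χ 0 * ∫ x, u 0 x * φ x) (integral_congr_ae ?_)) hw
    filter_upwards [ae_integrable_rpow hu, ae_restrict_mem measurableSet_Ioi] with s hs hs0
    have hΔ : Integrable fun x => u s x ^ m * Laplacian.laplacian φ x :=
      hs.mul_bdd (c := _) (continuous_laplacian hφ2).aestronglyMeasurable (Eventually.of_forall hC')
    have hd : ∀ x, deriv (fun r => χ r * φ x) s = deriv χ s * φ x := fun x =>
      deriv_mul_const ((hχ.differentiable (by simp)) s) _
    simp only [hd, laplacian_const_mul hφ2]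
    rw [← integral_const_mul, ← integral_const_mul, ← integral_add
      ((hint s (mem_Ioi.1 hs0).le).const_mul _) (hΔ.const_mul _)]
    congr 1 with x
    ring

/-- A fixed smooth cut-off function in space, equal to `1` on the unit ball. -/
def spaceCutoff (n : ℕ) : ContDiffBump (0 : Space n) := ⟨1, 2, one_pos, one_lt_two⟩

theorem spaceCutoff_eq_one {x : Space n} (hx : ‖x‖ ≤ 1) : spaceCutoff n x = 1 :=
  (spaceCutoff n).one_of_mem_closedBall (by simpa [spaceCutoff] using hx)

theorem abs_mul_spaceCutoff_le (a : ℝ) (x : Space n) : ‖a * spaceCutoff n x‖ ≤ ‖a‖ := by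
  rw [norm_mul, Real.norm_of_nonneg (spaceCutoff n).nonneg]
  exact mul_le_of_le_one_right (norm_nonneg _) (spaceCutoff n).le_one

/-- The weak formulation tested with `P(x) ζ(c x)`, for a homogeneous `P` of degree `d ≤ 2`. The
Laplacian scales like `c ^ (2 - d)`, so it stays bounded as `c → 0`. -/
theorem integral_mul_homogeneous_cutoff (hu : IsWeakSolution m u) {P : Space n → ℝ} {d : ℕ}
    (hd : d ≤ 2) (hP : ContDiff ℝ ((⊤ : ℕ∞) : WithTop ℕ∞) P)
    (hhom : ∀ (c : ℝ) (x : Space n), P (c • x) = c ^ d * P x) {c : ℝ} (hc : 0 < c) {t : ℝ}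
    (ht : 0 ≤ t) :
    ∫ x, u t x * (P x * spaceCutoff n (c • x)) = (∫ x, u 0 x * (P x * spaceCutoff n (c • x))) +
      ∫ s in (0 : ℝ)..t, ∫ x, u s x ^ m * (c ^ (2 - d) *
        Laplacian.laplacian (fun x => P x * spaceCutoff n x) (c • x)) := by
  have hΦ : ContDiff ℝ ((⊤ : ℕ∞) : WithTop ℕ∞) fun x => P x * spaceCutoff n x :=
    hP.mul (spaceCutoff n).contDiff
  have hΦ2 : ContDiff ℝ 2 fun x => P x * spaceCutoff n x := hΦ.of_le two_le_smooth
  have hΦc : HasCompactSupport fun x => P x * spaceCutoff n x :=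
    (spaceCutoff n).hasCompactSupport.mul_left
  have heq : (fun x => P x * spaceCutoff n (c • x)) =
      fun x => (c ^ d)⁻¹ * ((fun x => P x * spaceCutoff n x) (c • x)) := by
    ext x
    simp only [hhom]
    field_simp
  have hsm : ContDiff ℝ ((⊤ : ℕ∞) : WithTop ℕ∞) fun x => P x * spaceCutoff n (c • x) :=
    hP.mul ((spaceCutoff n).contDiff.comp (contDiff_const_smul c))
  have hcs : HasCompactSupport fun x => P x * spaceCutoff n (c • x) :=
    ((spaceCutoff n).hasCompactSupport.comp_homeomorph
      (Homeomorph.smulOfNeZero c hc.ne')).mul_left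
  rw [integral_mul_testFunction hu hsm hcs ht]
  congr 2
  ext s
  congr 1 with x
  rw [heq, laplacian_comp_smul hΦ2]
  congr 2
  rw [← pow_sub_mul_pow c hd]
  field_simp

/-- The limit `c → 0` of the preceding identity: the weak formulation tested with a homogeneous
function `P` of degree `d ≤ 2`. Its Laplacian contributes for `d = 2` only, where it is constant; for
`d < 2` the factor `0 ^ (2 - d)` is zero. -/
theorem integral_mul_homogeneous (hu : IsWeakSolution m u) {P : Space n → ℝ} {d : ℕ}
    (hd : d ≤ 2) (hP : ContDiff ℝ ((⊤ : ℕ∞) : WithTop ℕ∞) P)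
    (hhom : ∀ (c : ℝ) (x : Space n), P (c • x) = c ^ d * P x) {t : ℝ} (ht : 0 ≤ t)
    (h0 : Integrable fun x => u 0 x * P x) (h1 : Integrable fun x => u t x * P x) :
    ∫ x, u t x * P x = (∫ x, u 0 x * P x) +
      (0 ^ (2 - d) * Laplacian.laplacian P 0) * ∫ s in (0 : ℝ)..t, ∫ x, u s x ^ m := by
  rcases ht.eq_or_lt with rfl | htpos
  · simp
  have hΦ2 : ContDiff ℝ 2 fun x => P x * spaceCutoff n x :=
    (hP.mul (spaceCutoff n).contDiff).of_le two_le_smooth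
  have hΦc : HasCompactSupport fun x => P x * spaceCutoff n x :=
    (spaceCutoff n).hasCompactSupport.mul_left
  obtain ⟨C, hC⟩ := exists_bound_laplacian hΦ2 hΦc
  have hΔ0 : Laplacian.laplacian P 0 = Laplacian.laplacian (fun x => P x * spaceCutoff n x) 0 := by
    refine (InnerProductSpace.laplacian_congr_nhds ?_).self_of_nhds
    filter_upwards [(spaceCutoff n).eventuallyEq_one] with x hx
    simp [hx]
  set c : ℕ → ℝ := fun k => 1 / ((k : ℝ) + 1) with hcdef
  have hc0 : ∀ k, 0 < c k := fun k => by simp only [hcdef]; positivity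
  have hc1 : ∀ k, c k ≤ 1 := fun k => by
    simp only [hcdef]
    rw [div_le_one (by positivity)]
    linarith [(Nat.cast_nonneg k : (0 : ℝ) ≤ k)]
  have hclim : Tendsto c atTop (𝓝 0) := tendsto_one_div_add_atTop_nhds_zero_nat
  have hcx : ∀ x : Space n, Tendsto (fun k => c k • x) atTop (𝓝 0) := fun x => by
    simpa using hclim.smul_const x
  have hlim : ∀ v : Space n → ℝ, Integrable v → Integrable (fun x => v x * P x) →
      Tendsto (fun k => ∫ x, v x * (P x * spaceCutoff n (c k • x))) atTop
        (𝓝 (∫ x, v x * P x)) := by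
    intro v hv hvP
    refine tendsto_integral_of_dominated_convergence (fun x => ‖v x * P x‖) (fun k => ?_) hvP.norm
      (fun k => Eventually.of_forall fun x => ?_) (Eventually.of_forall fun x => ?_)
    · exact hv.1.mul (hP.continuous.mul
        ((spaceCutoff n).continuous.comp (continuous_const_smul (c k)))).aestronglyMeasurable
    · rw [← mul_assoc]; exact abs_mul_spaceCutoff_le _ _
    · have h2 := ((spaceCutoff n).continuous.tendsto 0).comp (hcx x)
      rw [spaceCutoff_eq_one (by simp)] at h2
      simpa using (h2.const_mul (P x)).const_mul (v x)
  have hlimΔ : Tendsto (fun k => ∫ s in (0 : ℝ)..t, ∫ x, u s x ^ m * (c k ^ (2 - d) *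
        Laplacian.laplacian (fun x => P x * spaceCutoff n x) (c k • x))) atTop
      (𝓝 (∫ s in (0 : ℝ)..t, ∫ x, u s x ^ m * (0 ^ (2 - d) * Laplacian.laplacian P 0))) := by
    have hcont : ∀ k, Continuous fun x : Space n => c k ^ (2 - d) *
        Laplacian.laplacian (fun x => P x * spaceCutoff n x) (c k • x) := fun k =>
      continuous_const.mul ((continuous_laplacian hΦ2).comp (continuous_const_smul (c k)))
    have hbd : ∀ k (x : Space n), ‖c k ^ (2 - d) *
        Laplacian.laplacian (fun x => P x * spaceCutoff n x) (c k • x)‖ ≤ C := by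
      intro k x
      rw [norm_mul, norm_pow, Real.norm_of_nonneg (hc0 k).le]
      exact (mul_le_of_le_one_left (norm_nonneg _) (pow_le_one₀ (hc0 k).le (hc1 k))).trans (hC _)
    have hI := fun k => integrable_rpow_mul_prod hu htpos (hcont k) (hbd k)
    have hI0 := integrable_rpow_mul_prod hu htpos (continuous_const (y := (0 : ℝ) ^ (2 - d) *
      Laplacian.laplacian P 0)) (fun _ => le_rfl)
    simp only [intervalIntegral.integral_of_le ht]
    have e1 := fun k => integral_prod _ (hI k)
    have e2 := integral_prod _ hI0
    simp only at e1 e2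
    rw [← e2]
    simp only [← e1]
    refine tendsto_integral_of_dominated_convergence (fun z => ‖u z.1 z.2 ^ m‖ * C)
      (fun k => (hI k).1) ((hu.integrable_rpow_prod t htpos).norm.mul_const C)
      (fun k => Eventually.of_forall fun z => ?_) (Eventually.of_forall fun z => ?_)
    · rw [norm_mul]
      exact mul_le_mul_of_nonneg_left (hbd k z.2) (norm_nonneg _)
    · refine Tendsto.const_mul _ ?_
      rw [hΔ0]
      exact (hclim.pow _).mul (((continuous_laplacian hΦ2).tendsto 0).comp (hcx z.2))
  have hfin := tendsto_nhds_unique (hlim (u t) (hu.integrable t ht) h1)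
    (((hlim (u 0) (hu.integrable 0 le_rfl) h0).add hlimΔ).congr fun k =>
      (integral_mul_homogeneous_cutoff hu hd hP hhom (hc0 k) ht).symm)
  rw [hfin]
  simp only [integral_mul_const, intervalIntegral.integral_mul_const]
  ring

/-- Finiteness of the second moments propagates: tested with `|x|² ζ(c x)`, the weak formulation
bounds the second moment over the ball of radius `1 / c` independently of `c`. -/
theorem integrable_norm_sq_mul (hu : IsWeakSolution m u) (h0 : IsDensity (u 0)) {t : ℝ}
    (ht : 0 ≤ t) : Integrable fun x => ‖x‖ ^ 2 * u t x := by
  rcases ht.eq_or_lt with rfl | htpos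
  · exact h0.second_moment
  have hP : ContDiff ℝ ((⊤ : ℕ∞) : WithTop ℕ∞) fun x : Space n => ‖x‖ ^ 2 := contDiff_norm_sq ℝ
  have hΦ2 : ContDiff ℝ 2 fun x : Space n => ‖x‖ ^ 2 * spaceCutoff n x :=
    (hP.mul (spaceCutoff n).contDiff).of_le two_le_smooth
  have hΦc : HasCompactSupport fun x : Space n => ‖x‖ ^ 2 * spaceCutoff n x :=
    (spaceCutoff n).hasCompactSupport.mul_left
  obtain ⟨C, hC⟩ := exists_bound_laplacian hΦ2 hΦc
  set c : ℕ → ℝ := fun k => 1 / ((k : ℝ) + 1) with hcdef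
  have hc0 : ∀ k, 0 < c k := fun k => by simp only [hcdef]; positivity
  have hball : ∀ k : ℕ, IntegrableOn (fun x => ‖x‖ ^ 2 * u t x)
      (Metric.closedBall (0 : Space n) ((k : ℝ) + 1)) := by
    intro k
    refine ((hu.integrable t ht).norm.const_mul (((k : ℝ) + 1) ^ 2)).integrableOn.mono'
      ((Continuous.aestronglyMeasurable (by fun_prop)).mul (hu.integrable t ht).1.restrict) ?_
    filter_upwards [ae_restrict_mem measurableSet_closedBall] with x hx
    rw [norm_mul, norm_pow, norm_norm]
    have : ‖x‖ ≤ (k : ℝ) + 1 := by simpa using hx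
    gcongr
  have hle : ∀ k : ℕ, ∫ x in Metric.closedBall (0 : Space n) ((k : ℝ) + 1), ‖x‖ ^ 2 * u t x ≤
      (∫ x, ‖x‖ ^ 2 * u 0 x) + ∫ z : ℝ × Space n, ‖u z.1 z.2 ^ m‖ * C
        ∂((volume.restrict (Ioc 0 t)).prod volume) := by
    intro k
    have hcont : Continuous fun x : Space n => c k ^ (2 - 2) *
        Laplacian.laplacian (fun x : Space n => ‖x‖ ^ 2 * spaceCutoff n x) (c k • x) :=
      continuous_const.mul ((continuous_laplacian hΦ2).comp (continuous_const_smul (c k)))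
    have hbd : ∀ x : Space n, ‖c k ^ (2 - 2) *
        Laplacian.laplacian (fun x : Space n => ‖x‖ ^ 2 * spaceCutoff n x) (c k • x)‖ ≤ C := by
      intro x; simpa using hC _
    have hI := integrable_rpow_mul_prod hu htpos hcont hbd
    have hkey := integral_mul_homogeneous_cutoff hu (d := 2) le_rfl hP
      (fun a x => by rw [norm_smul, mul_pow, Real.norm_eq_abs, sq_abs]) (hc0 k) ht
    have hcs : HasCompactSupport fun x : Space n => ‖x‖ ^ 2 * spaceCutoff n (c k • x) :=
      ((spaceCutoff n).hasCompactSupport.comp_homeomorph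
        (Homeomorph.smulOfNeZero (c k) (hc0 k).ne')).mul_left
    have hcc : Continuous fun x : Space n => ‖x‖ ^ 2 * spaceCutoff n (c k • x) :=
      hP.continuous.mul ((spaceCutoff n).continuous.comp (continuous_const_smul (c k)))
    obtain ⟨D, hD⟩ := hcs.exists_bound_of_continuous hcc
    have hint : Integrable fun x => u t x * (‖x‖ ^ 2 * spaceCutoff n (c k • x)) :=
      (hu.integrable t ht).mul_bdd (c := _) hcc.aestronglyMeasurable (Eventually.of_forall hD)
    have hint0 : Integrable fun x => u 0 x * (‖x‖ ^ 2 * spaceCutoff n (c k • x)) :=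
      (hu.integrable 0 le_rfl).mul_bdd (c := _) hcc.aestronglyMeasurable (Eventually.of_forall hD)
    calc ∫ x in Metric.closedBall (0 : Space n) ((k : ℝ) + 1), ‖x‖ ^ 2 * u t x
        = ∫ x in Metric.closedBall (0 : Space n) ((k : ℝ) + 1),
            u t x * (‖x‖ ^ 2 * spaceCutoff n (c k • x)) := by
          refine setIntegral_congr_fun measurableSet_closedBall fun x hx => ?_
          have hx' : ‖x‖ ≤ (k : ℝ) + 1 := by simpa using hx
          have : ‖c k • x‖ ≤ 1 := by
            rw [norm_smul, Real.norm_of_nonneg (hc0 k).le, hcdef]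
            simp only
            rw [one_div_mul_eq_div, div_le_one (by positivity)]
            exact hx'
          rw [spaceCutoff_eq_one this]
          ring
      _ ≤ ∫ x, u t x * (‖x‖ ^ 2 * spaceCutoff n (c k • x)) := by
          refine setIntegral_le_integral hint ?_
          filter_upwards [hu.nonneg t ht] with x hx
          exact mul_nonneg hx (mul_nonneg (by positivity) (spaceCutoff n).nonneg)
      _ = (∫ x, u 0 x * (‖x‖ ^ 2 * spaceCutoff n (c k • x))) +
          ∫ z : ℝ × Space n, u z.1 z.2 ^ m * (c k ^ (2 - 2) *
            Laplacian.laplacian (fun x : Space n => ‖x‖ ^ 2 * spaceCutoff n x) (c k • z.2))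
            ∂((volume.restrict (Ioc 0 t)).prod volume) := by
          rw [hkey, intervalIntegral.integral_of_le ht, integral_prod _ hI]
      _ ≤ _ := by
          refine add_le_add ?_ ?_
          · refine integral_mono_ae hint0 h0.second_moment ?_
            filter_upwards [h0.nonneg] with x hx
            have h2 := mul_le_of_le_one_right (mul_nonneg (sq_nonneg ‖x‖) hx)
              ((spaceCutoff n).le_one (x := c k • x))
            calc u 0 x * (‖x‖ ^ 2 * spaceCutoff n (c k • x)) =
                ‖x‖ ^ 2 * u 0 x * spaceCutoff n (c k • x) := by ring
              _ ≤ _ := h2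
          · refine integral_mono hI ((hu.integrable_rpow_prod t htpos).norm.mul_const C) fun z => ?_
            refine (le_abs_self _).trans ?_
            rw [abs_mul]
            exact mul_le_mul_of_nonneg_left (hbd z.2) (abs_nonneg _)
  have hcover := aecover_closedBall (μ := volume) (x := (0 : Space n)) (l := atTop)
    (r := fun k : ℕ => (k : ℝ) + 1)
    (tendsto_atTop_add_const_right _ _ tendsto_natCast_atTop_atTop)
  refine hcover.integrable_of_integral_bounded_of_nonneg_ae _ hball ?_ (Eventually.of_forall hle)
  filter_upwards [hu.nonneg t ht] with x hx
  positivity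

theorem integrable_mul_of_abs_le {p : Space n → ℝ} (hp : Integrable p)
    (hp2 : Integrable fun x => ‖x‖ ^ 2 * p x) {P : Space n → ℝ} (hP : Continuous P)
    (hle : ∀ x, |P x| ≤ 1 + ‖x‖ ^ 2) : Integrable fun x => p x * P x := by
  refine (hp.norm.add hp2.norm).mono' (hp.1.mul hP.aestronglyMeasurable)
    (Eventually.of_forall fun x => ?_)
  simp only [Pi.add_apply]
  rw [norm_mul, norm_mul, norm_pow, norm_norm, Real.norm_eq_abs (P x)]
  nlinarith [mul_le_mul_of_nonneg_left (hle x) (norm_nonneg (p x))]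

theorem isDensity_of_isWeakSolution (hu : IsWeakSolution m u) (h0 : IsDensity (u 0)) {t : ℝ}
    (ht : 0 ≤ t) : IsDensity (u t) where
  nonneg := hu.nonneg t ht
  integrable := hu.integrable t ht
  second_moment := integrable_norm_sq_mul hu h0 ht
  mass := by
    have h := integral_mul_homogeneous hu (P := fun _ => 1) (d := 0) (by norm_num) contDiff_const
      (by simp) ht (by simpa using h0.integrable) (by simpa using hu.integrable t ht)
    simpa [h0.mass] using h

theorem firstMoment_of_isWeakSolution (hu : IsWeakSolution m u) (h0 : IsDensity (u 0)) {t : ℝ}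
    (ht : 0 ≤ t) : firstMoment (u t) = firstMoment (u 0) := by
  ext i
  have hP : ContDiff ℝ ((⊤ : ℕ∞) : WithTop ℕ∞) fun x : Space n => x i :=
    (EuclideanSpace.proj i : Space n →L[ℝ] ℝ).contDiff
  have hle : ∀ x : Space n, |x i| ≤ 1 + ‖x‖ ^ 2 := fun x =>
    (abs_coord_le x i).trans (by nlinarith [sq_nonneg (‖x‖ - 1)])
  have h := integral_mul_homogeneous hu (P := fun x => x i) (d := 1) (by norm_num) hP
    (by simp) ht (integrable_mul_of_abs_le h0.integrable h0.second_moment hP.continuous hle)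
    (integrable_mul_of_abs_le (hu.integrable t ht) (integrable_norm_sq_mul hu h0 ht)
      hP.continuous hle)
  simpa [firstMoment, mul_comm] using h

theorem secondMoment_of_isWeakSolution (hu : IsWeakSolution m u) (h0 : IsDensity (u 0)) {t : ℝ}
    (ht : 0 ≤ t) : secondMoment (u t) =
      secondMoment (u 0) + momentShift m u t • (1 : Matrix (Fin n) (Fin n) ℝ) := by
  ext i j
  have hP : ContDiff ℝ ((⊤ : ℕ∞) : WithTop ℕ∞) fun x : Space n => x i * x j :=
    (EuclideanSpace.proj i : Space n →L[ℝ] ℝ).contDiff.mul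
      (EuclideanSpace.proj j : Space n →L[ℝ] ℝ).contDiff
  have hle : ∀ x : Space n, |x i * x j| ≤ 1 + ‖x‖ ^ 2 := fun x => by
    rw [abs_mul]
    nlinarith [mul_le_mul (abs_coord_le x i) (abs_coord_le x j) (abs_nonneg _) (norm_nonneg x)]
  have h := integral_mul_homogeneous hu (P := fun x => x i * x j) (d := 2) le_rfl hP
    (fun c x => by simp only [PiLp.smul_apply, smul_eq_mul]; ring) ht
    (integrable_mul_of_abs_le h0.integrable h0.second_moment hP.continuous hle)
    (integrable_mul_of_abs_le (hu.integrable t ht) (integrable_norm_sq_mul hu h0 ht)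
      hP.continuous hle)
  rw [laplacian_coord_mul] at h
  simp only [secondMoment, Matrix.of_apply, Matrix.add_apply, Matrix.smul_apply, Matrix.one_apply,
    momentShift, smul_eq_mul]
  simp only [mul_comm (u _ _)] at h
  rw [h]
  split_ifs <;> simp

/-! ### The function `σ_u` -/

theorem intervalIntegrable_integral_rpow (hu : IsWeakSolution m u) {a b : ℝ} (ha : 0 ≤ a)
    (hb : 0 ≤ b) : IntervalIntegrable (fun s => ∫ x, u s x ^ m) volume a b := by
  have h : IntegrableOn (fun s => ∫ x, u s x ^ m) (Ioc 0 (max a b + 1)) :=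
    (hu.integrable_rpow_prod _ (by positivity)).integral_prod_left
  rw [intervalIntegrable_iff]
  refine h.mono_set fun s hs => ?_
  rw [uIoc, mem_Ioc] at hs
  exact ⟨(le_min ha hb).trans_lt hs.1, hs.2.trans (by linarith)⟩

theorem continuousOn_momentShift (hu : IsWeakSolution m u) :
    ContinuousOn (momentShift m u) (Ici 0) := by
  intro t ht
  have h0 : 0 ≤ t := ht
  have h1 := intervalIntegral.continuousOn_primitive_interval
    (a := 0) (b := t + 1) (μ := volume) (f := fun s => ∫ x, u s x ^ m) (by
      rw [uIcc_of_le (by linarith), integrableOn_Icc_iff_integrableOn_Ioc]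
      exact (hu.integrable_rpow_prod _ (by linarith)).integral_prod_left)
  rw [uIcc_of_le (by linarith)] at h1
  have h2 := (h1 t ⟨h0, by linarith⟩).const_mul 2
  refine h2.mono_of_mem_nhdsWithin ?_
  rw [← Ici_inter_Iic]
  exact inter_mem self_mem_nhdsWithin (mem_nhdsWithin_of_mem_nhds (Iic_mem_nhds (by linarith)))

theorem integral_rpow_pos (hu : IsWeakSolution m u) (h0 : IsDensity (u 0)) {s : ℝ}
    (hs : 0 ≤ s) (hi : Integrable fun x => u s x ^ m) : 0 < ∫ x, u s x ^ m := by
  have hd := isDensity_of_isWeakSolution hu h0 hs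
  have hnn : 0 ≤ᵐ[volume] fun x => u s x ^ m := by
    filter_upwards [hd.nonneg] with x hx using Real.rpow_nonneg hx m
  refine lt_of_le_of_ne (integral_nonneg_of_ae hnn) fun h => ?_
  have hz := (integral_eq_zero_iff_of_nonneg_ae hnn hi).1 h.symm
  have hz' : u s =ᵐ[volume] 0 := by
    filter_upwards [hz, hd.nonneg] with x hx hx0
    exact ((Real.rpow_eq_zero_iff_of_nonneg hx0).1 hx).1
  have := hd.mass
  rw [integral_congr_ae hz'] at this
  simp at this

theorem strictMonoOn_momentShift (hu : IsWeakSolution m u) (h0 : IsDensity (u 0)) :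
    StrictMonoOn (momentShift m u) (Ici 0) := by
  intro a ha b hb hab
  have ha' : 0 ≤ a := ha
  have hb' : 0 ≤ b := hb
  have h1 := intervalIntegral.integral_add_adjacent_intervals
    (intervalIntegrable_integral_rpow hu le_rfl ha') (intervalIntegrable_integral_rpow hu ha' hb')
  have h2 : 0 < ∫ s in a..b, ∫ x, u s x ^ m := by
    refine (intervalIntegral.integral_pos_iff_support_of_nonneg_ae'
      (μ := volume) (f := fun s => ∫ x, u s x ^ m) ?_
      (intervalIntegrable_integral_rpow hu ha' hb')).2 ⟨hab, ?_⟩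
    · rw [uIoc_of_le hab.le]
      filter_upwards [ae_restrict_of_ae_restrict_of_subset
        (show Ioc a b ⊆ Ioi 0 from fun s hs => ha'.trans_lt hs.1) (ae_integrable_rpow hu),
        ae_restrict_mem measurableSet_Ioc] with s hs hmem
      exact (integral_rpow_pos hu h0 (ha'.trans hmem.1.le) hs).le
    -- the inner integral is positive whenever it exists, that is, for almost every `s`
    · have hfull : volume (Ioc a b \ (Function.support (fun s => ∫ x, u s x ^ m) ∩ Ioc a b)) = 0 := by
        have h3 := ae_restrict_of_ae_restrict_of_subset
          (show Ioc a b ⊆ Ioi 0 from fun s hs => ha'.trans_lt hs.1) (ae_integrable_rpow hu)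
        rw [ae_restrict_iff' measurableSet_Ioc, ae_iff] at h3
        refine measure_mono_null (fun s hs => ?_) h3
        simp only [mem_ofPred_eq, Classical.not_imp]
        refine ⟨hs.1, fun hi => hs.2 ⟨?_, hs.1⟩⟩
        exact (integral_rpow_pos hu h0 (ha'.trans hs.1.1.le) hi).ne'
      have hvol : 0 < volume (Ioc a b) := by
        rw [Real.volume_Ioc]; simpa using hab
      refine hvol.trans_le ?_
      calc volume (Ioc a b) ≤ volume
            (Function.support (fun s => ∫ x, u s x ^ m) ∩ Ioc a b) +
            volume (Ioc a b \ (Function.support (fun s => ∫ x, u s x ^ m) ∩ Ioc a b)) := by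
            refine (measure_mono fun s hs => ?_).trans (measure_union_le _ _)
            by_cases h : s ∈ Function.support (fun s => ∫ x, u s x ^ m) ∩ Ioc a b
            · exact Or.inl h
            · exact Or.inr ⟨hs, h⟩
        _ = _ := by rw [hfull, add_zero]
  unfold momentShift
  rw [← h1]
  linarith

end WeakSolution

/-! ### Differentiation of integrals over moving ellipsoids -/

/-- A family of concave quadratic profiles `w(s, ·)`, `s > a`, that becomes the fixed profile
`λ(s) (1 - |y|²)` in the affine coordinates `x = η + B(s) y`, with its time derivative `w'`. For
almost every `x`, the times at which the boundary of `{w > 0}` passes through `x` are countably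
many. -/
structure IsMovingProfile {n : ℕ} (a : ℝ) (w w' : ℝ → Space n → ℝ) (lam : ℝ → ℝ)
    (η : Fin n → ℝ) (B : ℝ → Matrix (Fin n) (Fin n) ℝ) : Prop where
  det_ne_zero : ∀ s ∈ Ioi a, (B s).det ≠ 0
  pos : ∀ s ∈ Ioi a, 0 < lam s
  continuousOn_lam : ContinuousOn lam (Ioi a)
  continuousOn_B : ContinuousOn B (Ioi a)
  apply_affMap : ∀ s ∈ Ioi a, ∀ y, w s (affMap η (B s) y) = lam s * (1 - ‖y‖ ^ 2)
  continuousOn_w : ContinuousOn (fun z : ℝ × Space n => w z.1 z.2) (Ioi a ×ˢ univ)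
  continuousOn_w' : ContinuousOn (fun z : ℝ × Space n => w' z.1 z.2) (Ioi a ×ˢ univ)
  hasDerivAt : ∀ s ∈ Ioi a, ∀ x, HasDerivAt (fun s => w s x) (w' s x) s
  countable : ∀ᵐ x, {s | s ∈ Ioi a ∧ w s x = 0}.Countable

namespace IsMovingProfile

variable {n : ℕ} {a : ℝ} {w w' : ℝ → Space n → ℝ} {lam : ℝ → ℝ} {η : Fin n → ℝ}
  {B : ℝ → Matrix (Fin n) (Fin n) ℝ}

theorem integrable_slice (hw : IsMovingProfile a w w' lam η B) (hn : 1 ≤ n) {e : ℝ} (he : -1 < e)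
    {c : ℝ → Space n → ℝ} (hc : ContinuousOn (fun z : ℝ × Space n => c z.1 z.2) (Ioi a ×ˢ univ))
    {s : ℝ} (hs : s ∈ Ioi a) : Integrable fun x => truncPow e (w s x) * c s x := by
  refine integrable_truncPow_mul hn (hw.det_ne_zero s hs) (hw.pos s hs) (hw.apply_affMap s hs) he ?_
  rw [← continuousOn_univ]
  exact hc.comp (f := fun x => (s, x)) (by fun_prop) fun x _ => ⟨hs, mem_univ _⟩

theorem continuousOn_integral (hw : IsMovingProfile a w w' lam η B) (hn : 1 ≤ n) {e : ℝ}
    (he : -1 < e) {c : ℝ → Space n → ℝ}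
    (hc : ContinuousOn (fun z : ℝ × Space n => c z.1 z.2) (Ioi a ×ˢ univ)) :
    ContinuousOn (fun s => ∫ x, truncPow e (w s x) * c s x) (Ioi a) := by
  have hX : ContinuousOn (fun z : ℝ × Space n => affMap η (B z.1) z.2) (Ioi a ×ˢ univ) := by
    have hB : ContinuousOn (fun z : ℝ × Space n => B z.1) (Ioi a ×ˢ univ) :=
      hw.continuousOn_B.comp continuousOn_fst fun z hz => hz.1
    refine (PiLp.continuous_toLp 2 _).comp_continuousOn ?_
    refine continuousOn_const.add ?_
    have h1 : Continuous fun p : Matrix (Fin n) (Fin n) ℝ × Space n => p.1 *ᵥ p.2.ofLp := by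
      fun_prop
    exact h1.comp_continuousOn (hB.prodMk continuousOn_snd)
  have hcX : ContinuousOn (fun z : ℝ × Space n => c z.1 (affMap η (B z.1) z.2)) (Ioi a ×ˢ univ) :=
    hc.comp (continuousOn_fst.prodMk hX) fun z hz => ⟨hz.1, mem_univ _⟩
  -- in the coordinates `y` the singular weight is fixed, and the rest is locally bounded
  have hball : ContinuousOn (fun s => ∫ y, ballWeight e y * c s (affMap η (B s) y)) (Ioi a) := by
    intro s₀ hs₀
    have hs₀' : a < s₀ := hs₀
    have hsub : Icc ((a + s₀) / 2) (s₀ + 1) ⊆ Ioi a := fun s hs => by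
      have := hs.1
      simp only [mem_Ioi]
      linarith
    obtain ⟨C, hC⟩ := (isCompact_Icc.prod (isCompact_closedBall (0 : Space n)
      1)).exists_bound_of_continuousOn (hcX.mono (prod_mono hsub (subset_univ _)))
    have hcont : ContinuousOn (fun s => ∫ y, ballWeight e y * c s (affMap η (B s) y))
        (Icc ((a + s₀) / 2) (s₀ + 1)) := by
      refine continuousOn_of_dominated (bound := fun y => ballWeight e y * C) (fun s hs => ?_)
        (fun s hs => Eventually.of_forall fun y => ?_) ((integrable_ballWeight hn he).mul_const C)
        (Eventually.of_forall fun y => ?_)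
      · refine (measurable_ballWeight e).aestronglyMeasurable.mul
          (Continuous.aestronglyMeasurable ?_)
        rw [← continuousOn_univ]
        exact hcX.comp (f := fun y => (s, y)) (by fun_prop) fun x _ => ⟨hsub hs, mem_univ _⟩
      · rw [norm_mul, Real.norm_of_nonneg (ballWeight_nonneg _ _)]
        rcases le_or_gt 1 ‖y‖ with hy | hy
        · rw [ballWeight_eq_zero hy]; simp
        · exact mul_le_mul_of_nonneg_left (hC (s, y) ⟨hs, by simpa using hy.le⟩)
            (ballWeight_nonneg _ _)
      · exact continuousOn_const.mul (hcX.comp (f := fun s => (s, y)) (by fun_prop)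
          fun s hs => ⟨hsub hs, mem_univ _⟩)
    exact (hcont.continuousAt (Icc_mem_nhds (by linarith) (by linarith))).continuousWithinAt
  have hdet : ContinuousOn (fun s => |(B s).det|) (Ioi a) := by
    have h1 : Continuous fun M : Matrix (Fin n) (Fin n) ℝ => |M.det| := by fun_prop
    exact h1.comp_continuousOn hw.continuousOn_B
  have hlam : ContinuousOn (fun s => lam s ^ e) (Ioi a) :=
    hw.continuousOn_lam.rpow_const fun s hs => Or.inl (hw.pos s hs).ne'
  refine ((hdet.mul hlam).mul hball).congr fun s hs => ?_
  exact integral_truncPow_mul (hw.det_ne_zero s hs) (hw.pos s hs) (hw.apply_affMap s hs) e (c s)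

theorem integrable_prod (hw : IsMovingProfile a w w' lam η B) (hn : 1 ≤ n) {e : ℝ}
    (he : -1 < e) {c : ℝ → Space n → ℝ}
    (hc : ContinuousOn (fun z : ℝ × Space n => c z.1 z.2) (Ioi a ×ˢ univ)) {s₁ s₂ : ℝ}
    (hs₁ : a < s₁) :
    Integrable (fun z : ℝ × Space n => truncPow e (w z.1 z.2) * c z.1 z.2)
      ((volume.restrict (Ioc s₁ s₂)).prod volume) := by
  have hsub : Ioc s₁ s₂ ⊆ Ioi a := fun s hs => hs₁.trans hs.1
  have hmeas : AEStronglyMeasurable (fun z : ℝ × Space n => truncPow e (w z.1 z.2) * c z.1 z.2)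
      ((volume.restrict (Ioc s₁ s₂)).prod volume) := by
    have hm : (volume.restrict (Ioc s₁ s₂)).prod (volume : Measure (Space n)) =
        (volume.prod volume).restrict (Ioc s₁ s₂ ×ˢ univ) := by
      rw [← Measure.prod_restrict, Measure.restrict_univ]
    have hset : MeasurableSet (Ioc s₁ s₂ ×ˢ (univ : Set (Space n))) :=
      measurableSet_Ioc.prod MeasurableSet.univ
    rw [hm]
    have h1 := (hw.continuousOn_w.mono (prod_mono hsub subset_rfl)).aestronglyMeasurable
      (μ := volume.prod volume) hset
    have h2 := (hc.mono (prod_mono hsub subset_rfl)).aestronglyMeasurable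
      (μ := volume.prod volume) hset
    exact ((measurable_truncPow e).comp_aemeasurable h1.aemeasurable).aestronglyMeasurable.mul h2
  rw [integrable_prod_iff hmeas]
  constructor
  · filter_upwards [ae_restrict_mem measurableSet_Ioc] with s hs
      using hw.integrable_slice hn he hc (hsub hs)
  · have h1 := hw.continuousOn_integral hn he (c := fun s x => ‖c s x‖) hc.norm
    have h2 : IntegrableOn (fun s => ∫ x, truncPow e (w s x) * ‖c s x‖) (Ioc s₁ s₂) :=
      ((h1.mono fun s hs => hs₁.trans_le hs.1).integrableOn_Icc (a := s₁) (b := s₂)).mono_set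
        Ioc_subset_Icc_self
    refine h2.congr (Eventually.of_forall fun s => ?_)
    simp only [norm_mul, Real.norm_of_nonneg (truncPow_nonneg _ _)]

/-- Differentiation under the integral sign. The derivative of the integrand is unbounded near the
moving boundary when `j < 1`; the formula follows from the fundamental theorem of calculus along
almost every vertical line and Fubini's theorem, since the right hand side is continuous. -/
theorem hasDerivAt_integral (hw : IsMovingProfile a w w' lam η B) (hn : 1 ≤ n) {j : ℝ}
    (hj : 0 < j) {c c' : ℝ → Space n → ℝ}
    (hc : ContinuousOn (fun z : ℝ × Space n => c z.1 z.2) (Ioi a ×ˢ univ))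
    (hc' : ContinuousOn (fun z : ℝ × Space n => c' z.1 z.2) (Ioi a ×ˢ univ))
    (hcc' : ∀ s ∈ Ioi a, ∀ x, HasDerivAt (fun s => c s x) (c' s x) s) {s₀ : ℝ} (hs₀ : a < s₀) :
    HasDerivAt (fun s => ∫ x, truncPow j (w s x) * c s x)
      ((∫ x, truncPow (j - 1) (w s₀ x) * (j * w' s₀ x * c s₀ x)) +
        ∫ x, truncPow j (w s₀ x) * c' s₀ x) s₀ := by
  have hj1 : -1 < j - 1 := by linarith
  have hj0 : -1 < j := by linarith
  have hd : ContinuousOn (fun z : ℝ × Space n => j * w' z.1 z.2 * c z.1 z.2) (Ioi a ×ˢ univ) :=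
    (continuousOn_const.mul hw.continuousOn_w').mul hc
  set G' : ℝ → Space n → ℝ := fun s x => truncPow (j - 1) (w s x) * (j * w' s x * c s x) +
    truncPow j (w s x) * c' s x with hG'
  set H : ℝ → ℝ := fun s => (∫ x, truncPow (j - 1) (w s x) * (j * w' s x * c s x)) +
    ∫ x, truncPow j (w s x) * c' s x with hH
  have hHcont : ContinuousOn H (Ioi a) :=
    (hw.continuousOn_integral hn hj1 (c := fun s x => j * w' s x * c s x) hd).add
      (hw.continuousOn_integral hn hj0 hc')
  have hHeq : ∀ s ∈ Ioi a, ∫ x, G' s x = H s := fun s hs =>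
    integral_add (hw.integrable_slice hn hj1 (c := fun s x => j * w' s x * c s x) hd hs)
      (hw.integrable_slice hn hj0 hc' hs)
  have hFTC : ∀ s₁ s₂, a < s₁ → s₁ ≤ s₂ →
      (∫ x, truncPow j (w s₂ x) * c s₂ x) =
        (∫ x, truncPow j (w s₁ x) * c s₁ x) + ∫ s in s₁..s₂, H s := by
    intro s₁ s₂ hs₁ hle
    have hint : Integrable (fun z : ℝ × Space n => G' z.1 z.2)
        ((volume.restrict (Ioc s₁ s₂)).prod volume) :=
      (hw.integrable_prod hn hj1 (c := fun s x => j * w' s x * c s x) hd hs₁).add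
        (hw.integrable_prod hn hj0 hc' hs₁)
    have hline : ∀ᵐ x, ∫ s in Ioc s₁ s₂, G' s x =
        truncPow j (w s₂ x) * c s₂ x - truncPow j (w s₁ x) * c s₁ x := by
      filter_upwards [hw.countable, hint.prod_left_ae] with x hx hix
      rw [← intervalIntegral.integral_of_le hle]
      have hsub : Icc s₁ s₂ ⊆ Ioi a := fun s hs => hs₁.trans_le hs.1
      -- the integrand is continuous, and differentiable off the boundary of `{w > 0}`
      refine integral_eq_of_hasDerivAt_off_countable_of_le
        (fun s => truncPow j (w s x) * c s x) (fun s => G' s x) hle hx ?_ ?_ ?_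
      · have h1 : ContinuousOn (fun s => w s x) (Icc s₁ s₂) := fun s hs =>
          (hw.hasDerivAt s (hsub hs) x).continuousAt.continuousWithinAt
        have h2 : ContinuousOn (fun s => c s x) (Icc s₁ s₂) := fun s hs =>
          (hcc' s (hsub hs) x).continuousAt.continuousWithinAt
        exact ((continuous_truncPow hj).comp_continuousOn h1).mul h2
      · intro s hs
        have hsa : s ∈ Ioi a := hsub ⟨hs.1.1.le, hs.1.2.le⟩
        have hne : w s x ≠ 0 := fun h0 => hs.2 ⟨hsa, h0⟩
        have h1 := ((hasDerivAt_truncPow (e := j) hne).comp s (hw.hasDerivAt s hsa x)).mul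
          (hcc' s hsa x)
        refine HasDerivAt.congr_deriv h1 ?_
        change j * truncPow (j - 1) (w s x) * w' s x * c s x + truncPow j (w s x) * c' s x =
          truncPow (j - 1) (w s x) * (j * w' s x * c s x) + truncPow j (w s x) * c' s x
        ring
      · exact (intervalIntegrable_iff_integrableOn_Ioc_of_le hle).2 hix
    have hs₂ : a < s₂ := hs₁.trans_le hle
    have h1 : ∫ s in s₁..s₂, H s = ∫ s in Ioc s₁ s₂, ∫ x, G' s x := by
      rw [intervalIntegral.integral_of_le hle]
      exact setIntegral_congr_fun measurableSet_Ioc fun s hs => (hHeq s (hs₁.trans hs.1)).symm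
    rw [h1, integral_integral_swap hint, integral_congr_ae hline,
      integral_sub (hw.integrable_slice hn hj0 hc hs₂) (hw.integrable_slice hn hj0 hc hs₁)]
    ring
  have hmid : a < (a + s₀) / 2 := by linarith
  have hmid' : (a + s₀) / 2 < s₀ := by linarith
  have hloc : (fun s => ∫ x, truncPow j (w s x) * c s x) =ᶠ[𝓝 s₀] fun s =>
      (∫ x, truncPow j (w ((a + s₀) / 2) x) * c ((a + s₀) / 2) x) +
        ∫ r in ((a + s₀) / 2)..s, H r := by
    filter_upwards [lt_mem_nhds hmid'] with s hs using hFTC _ _ hmid hs.le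
  refine HasDerivAt.congr_of_eventuallyEq ?_ hloc
  refine HasDerivAt.const_add _ ?_
  refine intervalIntegral.integral_hasDerivAt_right ?_ ?_
    (hHcont.continuousAt (Ioi_mem_nhds hs₀))
  · refine ContinuousOn.intervalIntegrable (hHcont.mono fun s hs => ?_)
    rw [uIcc_of_le hmid'.le] at hs
    exact hmid.trans_le hs.1
  · exact hHcont.stronglyMeasurableAtFilter isOpen_Ioi _ hs₀

end IsMovingProfile

/-! ### Smoothness of the normalizing constant -/

/-- The coordinate domain as a normed space: matrices are not normed by default, functions of two
indices are. -/
abbrev Coord (n : ℕ) := Space n × (Fin n → Fin n → ℝ)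

/-- The coordinates of a pair of a vector and a matrix. -/
def toCoord {n : ℕ} (ω : Param n) : Coord n := (ω.1, fun i j => ω.2 i j)

/-- The closed form of the normalizing constant, on the normed coordinate space. -/
def psiFun {n : ℕ} (m : ℝ) (p : Coord n) : ℝ :=
  (1 + (m - 1) * height ((p.1, Matrix.of p.2) : Param n) - peak n m (-(Matrix.of p.2)).det) /
    (m - 1)

theorem psi_eq_psiFun {n : ℕ} {m : ℝ} (hm : 1 < m) {ω : Param n} (hω : ω ∈ paramDomain n) :
    psi (2 - m) ω = psiFun m (toCoord ω) := psi_eq hm hω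

theorem toCoord_add {n : ℕ} (ω z : Param n) : toCoord (ω + z) = toCoord ω + toCoord z := rfl

theorem toCoord_smul {n : ℕ} (t : ℝ) (z : Param n) : toCoord (t • z) = t • toCoord z := rfl

theorem contDiff_det {E : Type*} [NormedAddCommGroup E] [NormedSpace ℝ E] {n : ℕ}
    {k : WithTop ℕ∞} {M : E → Matrix (Fin n) (Fin n) ℝ} (h : ∀ i j, ContDiff ℝ k fun p => M p i j) :
    ContDiff ℝ k fun p => (M p).det := by
  simp only [Matrix.det_apply]
  refine ContDiff.sum fun σ _ => ?_
  exact (contDiff_prod fun i _ => h _ _).const_smul _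

/-- Three derivatives are enough for the second one to be continuous along smooth curves. The entries
of the inverse matrix are smooth by Cramer's rule. -/
theorem contDiffAt_psiFun {n : ℕ} {m : ℝ} (hm : 1 < m) {ω : Param n} (hω : ω ∈ paramDomain n) :
    ContDiffAt ℝ 3 (psiFun m) (toCoord ω) := by
  have hm' : 0 < m - 1 := by linarith
  have hdetpos : 0 < (-(Matrix.of (toCoord ω).2)).det := hω.det_pos
  have hentry : ∀ i j : Fin n, ContDiff ℝ 3 fun p : Coord n => (-(Matrix.of p.2)) i j := by
    intro i j
    have : ContDiff ℝ 3 fun p : Coord n => p.2 i j := by fun_prop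
    exact this.neg
  have hdet : ContDiff ℝ 3 fun p : Coord n => (-(Matrix.of p.2)).det := contDiff_det hentry
  have hadj : ∀ i j : Fin n, ContDiff ℝ 3 fun p : Coord n => (-(Matrix.of p.2)).adjugate i j := by
    intro i j
    simp only [Matrix.adjugate_apply]
    refine contDiff_det fun k l => ?_
    by_cases hk : k = j
    · subst hk
      simp only [Matrix.updateRow_self]
      exact contDiff_const
    · simp only [Matrix.updateRow_ne hk]
      exact hentry k l
  have hheight : ContDiffAt ℝ 3 (fun p : Coord n => height ((p.1, Matrix.of p.2) : Param n))
      (toCoord ω) := by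
    have h1 : (fun p : Coord n => height ((p.1, Matrix.of p.2) : Param n)) = fun p : Coord n =>
        (1 / 2) * ∑ i, p.1 i * ((1 / 2) * ∑ j, ((-(Matrix.of p.2)).det)⁻¹ *
          (-(Matrix.of p.2)).adjugate i j * p.1 j) := by
      ext p
      simp only [height, center, Matrix.inv_def, dotProduct, Pi.smul_apply, Matrix.mulVec,
        Matrix.smul_apply, smul_eq_mul, Ring.inverse_eq_inv']
    rw [h1]
    refine contDiffAt_const.mul (ContDiffAt.sum fun i _ => ?_)
    have hcoord : ∀ i : Fin n, ContDiffAt ℝ 3 (fun p : Coord n => p.1 i) (toCoord ω) := by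
      intro i
      have : ContDiff ℝ 3 fun p : Coord n => p.1 i := by fun_prop
      exact this.contDiffAt
    refine (hcoord i).mul (contDiffAt_const.mul (ContDiffAt.sum fun j _ => ?_))
    exact ((hdet.contDiffAt.inv hdetpos.ne').mul (hadj i j).contDiffAt).mul (hcoord j)
  have hpeak : ContDiffAt ℝ 3 (fun p : Coord n => peak n m (-(Matrix.of p.2)).det)
      (toCoord ω) := by
    have hK := integral_ballWeight_pos n (e := 1 / (m - 1)) (by positivity)
    have hs := Real.sqrt_pos.2 hdetpos
    unfold peak
    refine ContDiffAt.rpow_const_of_ne ?_ ?_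
    · exact (contDiffAt_const.mul (hdet.contDiffAt.sqrt hdetpos.ne')).div_const _
    · positivity
  exact ((contDiffAt_const.add (contDiffAt_const.mul hheight)).sub hpeak).div_const _

/-- The derivative of the normalizing constant. -/
def dpsi {n : ℕ} (m : ℝ) (ω z : Param n) : ℝ := fderiv ℝ (psiFun m) (toCoord ω) (toCoord z)

/-- The second derivative of the normalizing constant in the direction `z`. -/
def d2psi {n : ℕ} (m : ℝ) (ω z : Param n) : ℝ :=
  fderiv ℝ (fderiv ℝ (psiFun m)) (toCoord ω) (toCoord z) (toCoord z)

theorem hasFDerivAt_psiFun {n : ℕ} {m : ℝ} (hm : 1 < m) {ω : Param n} (hω : ω ∈ paramDomain n) :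
    HasFDerivAt (psiFun m) (fderiv ℝ (psiFun m) (toCoord ω)) (toCoord ω) :=
  ((contDiffAt_psiFun hm hω).differentiableAt (by norm_num)).hasFDerivAt

theorem hasFDerivAt_fderiv_psiFun {n : ℕ} {m : ℝ} (hm : 1 < m) {ω : Param n}
    (hω : ω ∈ paramDomain n) :
    HasFDerivAt (fderiv ℝ (psiFun m)) (fderiv ℝ (fderiv ℝ (psiFun m)) (toCoord ω)) (toCoord ω) :=
  (((contDiffAt_psiFun hm hω).fderiv_right (m := 1) (by norm_num)).differentiableAt
    (by norm_num)).hasFDerivAt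

/-- The coordinate domain is open in the tangent directions, by compactness of the unit sphere. -/
theorem eventually_add_smul_mem {n : ℕ} {ω z : Param n} (hω : ω ∈ paramDomain n)
    (hz : IsTangent z) : ∀ᶠ t : ℝ in 𝓝 0, ω + t • z ∈ paramDomain n := by
  have hA : (-ω.2).PosDef := hω
  have hzs : z.2ᵀ = z.2 := hz
  have hAs : (-ω.2)ᵀ = -ω.2 := by
    have := hA.1
    rwa [Matrix.IsHermitian, Matrix.conjTranspose_eq_transpose_of_trivial] at this
  have hcpt : ∀ᶠ t : ℝ in 𝓝 0, ∀ v ∈ Metric.sphere (0 : Fin n → ℝ) 1,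
      0 < v ⬝ᵥ ((-ω.2 - t • z.2) *ᵥ v) := by
    refine (isCompact_sphere (0 : Fin n → ℝ) 1).eventually_forall_of_forall_eventually
      fun v hv => ?_
    have hv0 : v ≠ 0 := by
      rintro rfl
      simp at hv
    have hpos : 0 < v ⬝ᵥ ((-ω.2 - (0 : ℝ) • z.2) *ᵥ v) := by
      rw [zero_smul, sub_zero]
      simpa using hA.dotProduct_mulVec_pos hv0
    have hcont' : Continuous fun p : ℝ × (Fin n → ℝ) =>
      p.2 ⬝ᵥ ((-ω.2 - p.1 • z.2) *ᵥ p.2) := by fun_prop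
    exact hcont'.continuousAt.eventually (lt_mem_nhds hpos)
  filter_upwards [hcpt] with t ht
  have heq : -(ω + t • z).2 = -ω.2 - t • z.2 := by
    simp only [Prod.snd_add, Prod.smul_snd]
    abel
  change (-(ω + t • z).2).PosDef
  rw [heq]
  refine Matrix.PosDef.of_dotProduct_mulVec_pos ?_ fun v hv => ?_
  · rw [Matrix.IsHermitian, Matrix.conjTranspose_eq_transpose_of_trivial, Matrix.transpose_sub,
      hAs, Matrix.transpose_smul, hzs]
  · have hnv : 0 < ‖v‖ := norm_pos_iff.2 hv
    have h1 := ht (‖v‖⁻¹ • v) (by simp [norm_smul, hnv.ne'])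
    rw [Matrix.mulVec_smul, dotProduct_smul, smul_dotProduct, smul_eq_mul, smul_eq_mul] at h1
    have h2 : 0 < ‖v‖⁻¹ := by positivity
    have h3 := pos_of_mul_pos_right (pos_of_mul_pos_right h1 h2.le) h2.le
    simpa using h3

theorem hasDerivAt_psi_line {n : ℕ} {m : ℝ} (hm : 1 < m) {ω z : Param n} (hω : ω ∈ paramDomain n)
    (hz : IsTangent z) : HasDerivAt (fun t : ℝ => psi (2 - m) (ω + t • z)) (dpsi m ω z) 0 := by
  have h1 : (fun t : ℝ => psi (2 - m) (ω + t • z)) =ᶠ[𝓝 0]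
      fun t : ℝ => psiFun m (toCoord ω + t • toCoord z) := by
    filter_upwards [eventually_add_smul_mem hω hz] with t ht
    rw [psi_eq_psiFun hm ht, toCoord_add, toCoord_smul]
  refine HasDerivAt.congr_of_eventuallyEq ?_ h1
  have h2 : HasDerivAt (fun t : ℝ => toCoord ω + t • toCoord z) (toCoord z) 0 := by
    simpa using ((hasDerivAt_id (0 : ℝ)).smul_const (toCoord z)).const_add (toCoord ω)
  have h3 : HasFDerivAt (psiFun m) (fderiv ℝ (psiFun m) (toCoord ω))
      (toCoord ω + (0 : ℝ) • toCoord z) := by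
    simpa using hasFDerivAt_psiFun hm hω
  exact h3.comp_hasDerivAt 0 h2

theorem hasDerivAt_line_apply {E : Type*} [NormedAddCommGroup E] [NormedSpace ℝ E]
    {f : E → E →L[ℝ] ℝ} {f' : E →L[ℝ] E →L[ℝ] ℝ} {p : E} (hf : HasFDerivAt f f' p) (z : E) :
    HasDerivAt (fun t : ℝ => f (p + t • z) z) (f' z z) 0 := by
  have h2 : HasDerivAt (fun t : ℝ => p + t • z) z 0 := by
    simpa using ((hasDerivAt_id (0 : ℝ)).smul_const z).const_add p
  have h3 : HasFDerivAt f f' (p + (0 : ℝ) • z) := by simpa using hf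
  have h4 : HasDerivAt (fun t : ℝ => f (p + t • z)) (f' z) 0 := h3.comp_hasDerivAt 0 h2
  exact (ContinuousLinearMap.apply ℝ ℝ z).hasFDerivAt.comp_hasDerivAt 0 h4

theorem hasDerivAt_dpsi_line {n : ℕ} {m : ℝ} (hm : 1 < m) {ω : Param n} (hω : ω ∈ paramDomain n)
    (z : Param n) : HasDerivAt (fun t : ℝ => dpsi m (ω + t • z) z) (d2psi m ω z) 0 :=
  hasDerivAt_line_apply (hasFDerivAt_fderiv_psiFun hm hω) (toCoord z)

/-! ### Directional derivatives of the family -/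

/-- The derivative of the pressure profile at `x` in the direction `z`. -/
def dpressure {n : ℕ} (m : ℝ) (ω z : Param n) (x : Space n) : ℝ :=
  (m - 1) * (quadForm z x - dpsi m ω z)

theorem hasDerivAt_pressure_line {n : ℕ} {m : ℝ} (hm : 1 < m) {ω z : Param n}
    (hω : ω ∈ paramDomain n) (hz : IsTangent z) (x : Space n) :
    HasDerivAt (fun t : ℝ => pressure m (ω + t • z) x) (dpressure m ω z x) 0 := by
  unfold pressure dpressure
  simp only [quadForm_add, quadForm_smul]
  have h1 : HasDerivAt (fun t : ℝ => quadForm ω x + t * quadForm z x) (quadForm z x) 0 := by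
    simpa using ((hasDerivAt_id (0 : ℝ)).mul_const (quadForm z x)).const_add (quadForm ω x)
  exact ((h1.sub (hasDerivAt_psi_line hm hω hz)).const_mul (m - 1)).const_add 1

theorem lineDeriv_qGauss {n : ℕ} {m : ℝ} (hm : 1 < m) {ω z : Param n} (hω : ω ∈ paramDomain n)
    (hz : IsTangent z) {x : Space n} (hx : pressure m ω x ≠ 0) :
    lineDeriv ℝ (fun ω' => qGauss (2 - m) ω' x) ω z =
      truncPow (1 / (m - 1) - 1) (pressure m ω x) * (1 / (m - 1) * dpressure m ω z x) := by
  have h0 : pressure m (ω + (0 : ℝ) • z) x = pressure m ω x := by simp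
  have h1 := (hasDerivAt_truncPow (e := 1 / (m - 1)) (w := pressure m (ω + (0 : ℝ) • z) x)
    (by rwa [h0])).comp (0 : ℝ) (hasDerivAt_pressure_line hm hω hz x)
  rw [h0] at h1
  rw [lineDeriv]
  simp only [qGauss_eq hm]
  rw [show (fun t : ℝ => truncPow (1 / (m - 1)) (pressure m (ω + t • z) x)) =
    truncPow (1 / (m - 1)) ∘ fun t : ℝ => pressure m (ω + t • z) x from rfl, h1.deriv]
  ring

theorem lineDeriv_lineDeriv_qGauss {n : ℕ} {m : ℝ} (hm : 1 < m) {ω z : Param n}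
    (hω : ω ∈ paramDomain n) (hz : IsTangent z) {x : Space n} (hx : pressure m ω x ≠ 0) :
    lineDeriv ℝ (fun ω' => lineDeriv ℝ (fun ω'' => qGauss (2 - m) ω'' x) ω' z) ω z =
      truncPow (1 / (m - 1) - 1 - 1) (pressure m ω x) *
        ((1 / (m - 1) - 1) * dpressure m ω z x * (1 / (m - 1) * dpressure m ω z x)) +
      truncPow (1 / (m - 1) - 1) (pressure m ω x) *
        (1 / (m - 1) * ((m - 1) * -d2psi m ω z)) := by
  have hP := hasDerivAt_pressure_line hm hω hz x
  have h0 : pressure m (ω + (0 : ℝ) • z) x = pressure m ω x := by simp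
  have h0' : dpressure m (ω + (0 : ℝ) • z) z x = dpressure m ω z x := by simp
  have hev : (fun t : ℝ => lineDeriv ℝ (fun ω'' => qGauss (2 - m) ω'' x) (ω + t • z) z) =ᶠ[𝓝 0]
      fun t : ℝ => truncPow (1 / (m - 1) - 1) (pressure m (ω + t • z) x) *
        (1 / (m - 1) * dpressure m (ω + t • z) z x) := by
    have hne : ∀ᶠ t : ℝ in 𝓝 0, pressure m (ω + t • z) x ≠ 0 :=
      hP.continuousAt.eventually_ne (by rwa [h0])
    filter_upwards [eventually_add_smul_mem hω hz, hne] with t ht htx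
    exact lineDeriv_qGauss hm ht hz htx
  rw [lineDeriv, hev.deriv_eq]
  have h1 := (hasDerivAt_truncPow (e := 1 / (m - 1) - 1) (w := pressure m (ω + (0 : ℝ) • z) x)
    (by rwa [h0])).comp (0 : ℝ) hP
  have h2 : HasDerivAt (fun t : ℝ => dpressure m (ω + t • z) z x) ((m - 1) * -d2psi m ω z) 0 :=
    ((hasDerivAt_dpsi_line hm hω z).const_sub (quadForm z x)).const_mul (m - 1)
  have h3 := h1.mul (h2.const_mul (1 / (m - 1)))
  have h4 : (truncPow (1 / (m - 1) - 1) ∘ fun t : ℝ => pressure m (ω + t • z) x) *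
      (fun t : ℝ => 1 / (m - 1) * dpressure m (ω + t • z) z x) =
      fun t : ℝ => truncPow (1 / (m - 1) - 1) (pressure m (ω + t • z) x) *
        (1 / (m - 1) * dpressure m (ω + t • z) z x) := rfl
  rw [h4] at h3
  rw [h3.deriv]
  simp only [Function.comp_apply, h0, h0']
  ring

/-- Outside of the support, `ln_q p_ω` has the constant value `ln_q 0 = -1 / (1 - q)`, and its
derivative is zero. -/
theorem lineDeriv_lnq_qGauss {n : ℕ} {m : ℝ} (hm : 1 < m) {ω z : Param n}
    (hω : ω ∈ paramDomain n) (hz : IsTangent z) {x : Space n} (hx : pressure m ω x ≠ 0) :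
    lineDeriv ℝ (fun ω' => lnq (2 - m) (qGauss (2 - m) ω' x)) ω z =
      if 0 < pressure m ω x then quadForm z x - dpsi m ω z else 0 := by
  have hm' : 0 < m - 1 := by linarith
  have hP := hasDerivAt_pressure_line hm hω hz x
  have h0 : pressure m (ω + (0 : ℝ) • z) x = pressure m ω x := by simp
  rw [lineDeriv]
  split_ifs with hpos
  · have hev : (fun t : ℝ => lnq (2 - m) (qGauss (2 - m) (ω + t • z) x)) =ᶠ[𝓝 0]
        fun t : ℝ => (pressure m (ω + t • z) x - 1) / (m - 1) := by
      filter_upwards [hP.continuousAt.eventually (lt_mem_nhds (b := pressure m (ω + (0 : ℝ) • z) x)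
        (by rwa [h0]))] with t ht
      rw [lnq_eq, qGauss_eq hm, truncPow_of_pos ht, ← Real.rpow_mul ht.le,
        one_div_mul_cancel hm'.ne', Real.rpow_one]
    rw [hev.deriv_eq, ((hP.sub_const 1).div_const (m - 1)).deriv, dpressure]
    field_simp
  · have hneg : pressure m ω x < 0 := lt_of_le_of_ne (not_lt.1 hpos) hx
    have hev : (fun t : ℝ => lnq (2 - m) (qGauss (2 - m) (ω + t • z) x)) =ᶠ[𝓝 0]
        fun _ : ℝ => lnq (2 - m) 0 := by
      filter_upwards [hP.continuousAt.eventually_lt_const (show pressure m (ω + (0 : ℝ) • z) x < 0 by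
        rwa [h0])] with t ht
      rw [qGauss_eq hm, truncPow_of_nonpos (le_of_lt ht)]
    rw [hev.deriv_eq, deriv_const]

theorem ae_pressure_ne_zero {n : ℕ} (hn : 1 ≤ n) {m : ℝ} (hm : 1 < m) {ω : Param n}
    (hω : ω ∈ paramDomain n) : ∀ᵐ x, pressure m ω x ≠ 0 := by
  obtain ⟨B, hB, -, hW⟩ := exists_pressure_affMap hm hω
  refine ae_affMap (center ω) hB ?_
  filter_upwards [ae_norm_ne_one hn] with y hy
  rw [hW]
  refine mul_ne_zero (peak_pos n hm hω.det_pos).ne' fun h => hy ?_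
  have : ‖y‖ ^ 2 = 1 := by linarith
  exact (pow_eq_one_iff_of_nonneg (norm_nonneg y) two_ne_zero).1 this

theorem truncPow_mul_ite (e w a : ℝ) : truncPow e w * (if 0 < w then a else 0) = truncPow e w * a := by
  split_ifs with h
  · rfl
  · rw [truncPow_of_nonpos (not_lt.1 h), zero_mul, zero_mul]

theorem metric_eq {n : ℕ} (hn : 1 ≤ n) {m : ℝ} (hm : 1 < m) {ω v z : Param n}
    (hω : ω ∈ paramDomain n) (hv : IsTangent v) (hz : IsTangent z) :
    metric (2 - m) ω v z = ∫ x, truncPow (1 / (m - 1) - 1) (pressure m ω x) *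
      (1 / (m - 1) * dpressure m ω v x * (quadForm z x - dpsi m ω z)) := by
  unfold metric
  refine integral_congr_ae ?_
  filter_upwards [ae_pressure_ne_zero hn hm hω] with x hx
  rw [lineDeriv_qGauss hm hω hv hx, lineDeriv_lnq_qGauss hm hω hz hx, mul_assoc, mul_comm
    (1 / (m - 1) * dpressure m ω v x), ← mul_assoc, truncPow_mul_ite]
  ring

/-- The exponent `1 / (m - 1) - 2` may be negative, but is larger than `-1` when `m < 2`. -/
theorem mConnection_eq {n : ℕ} (hn : 1 ≤ n) {m : ℝ} (hm : 1 < m) {ω v z : Param n}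
    (hω : ω ∈ paramDomain n) (hv : IsTangent v) (hz : IsTangent z) :
    mConnection (2 - m) ω v v z = ∫ x, (truncPow (1 / (m - 1) - 1 - 1) (pressure m ω x) *
        ((1 / (m - 1) - 1) * dpressure m ω v x * (1 / (m - 1) * dpressure m ω v x *
          (quadForm z x - dpsi m ω z))) +
      truncPow (1 / (m - 1) - 1) (pressure m ω x) *
        (1 / (m - 1) * ((m - 1) * -d2psi m ω v) * (quadForm z x - dpsi m ω z))) := by
  unfold mConnection
  refine integral_congr_ae ?_
  filter_upwards [ae_pressure_ne_zero hn hm hω] with x hx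
  rw [lineDeriv_lineDeriv_qGauss hm hω hv hx, lineDeriv_lnq_qGauss hm hω hz hx, add_mul,
    mul_right_comm, truncPow_mul_ite, mul_right_comm (truncPow (1 / (m - 1) - 1) _),
    truncPow_mul_ite]
  ring

/-! ### The `q`-Gaussian with given moments -/

/-- The factor `τ` for which the `q`-Gaussian with covariance matrix `Σ`, `det Σ = D`, has the
quadratic part `Θ = -τ Σ⁻¹`. -/
def precScale (n : ℕ) (m D : ℝ) : ℝ :=
  (covRatio n m ^ (1 / (m - 1) + (n : ℝ) / 2) * ((m - 1) ^ ((n : ℝ) / 2) /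
    (√D * ∫ y : Space n, ballWeight (1 / (m - 1)) y))) ^ (m - 1)

theorem precScale_pos {n : ℕ} (hn : 1 ≤ n) {m D : ℝ} (hm : 1 < m) (hD : 0 < D) :
    0 < precScale n m D := by
  have h : 0 < m - 1 := by linarith
  have hK := integral_ballWeight_pos n (e := 1 / (m - 1)) (by positivity)
  have hc := covRatio_pos hn hm
  have := Real.sqrt_pos.2 hD
  unfold precScale
  positivity

/-- The equation that determines `precScale`. -/
theorem covRatio_mul_peak {n : ℕ} (hn : 1 ≤ n) {m D : ℝ} (hm : 1 < m) (hD : 0 < D) :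
    covRatio n m * peak n m (precScale n m D ^ n * D⁻¹) = precScale n m D := by
  have h : 0 < m - 1 := by linarith
  have hK := integral_ballWeight_pos n (e := 1 / (m - 1)) (by positivity)
  have hc := covRatio_pos hn hm
  have hτ := precScale_pos hn hm hD
  have hs := Real.sqrt_pos.2 hD
  have hpow : precScale n m D ^ (1 / (m - 1)) = covRatio n m ^ (1 / (m - 1) + (n : ℝ) / 2) *
      ((m - 1) ^ ((n : ℝ) / 2) / (√D * ∫ y : Space n, ballWeight (1 / (m - 1)) y)) := by
    rw [precScale, ← Real.rpow_mul (by positivity), mul_one_div_cancel h.ne', Real.rpow_one]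
  have hE : 0 < 1 / (m - 1) + (n : ℝ) / 2 := by positivity
  have hsqrt : √(precScale n m D ^ n * D⁻¹) = precScale n m D ^ ((n : ℝ) / 2) / √D := by
    rw [Real.sqrt_mul (by positivity), Real.sqrt_inv, Real.sqrt_eq_rpow, ← Real.rpow_natCast,
      ← Real.rpow_mul hτ.le, mul_one_div, div_eq_mul_inv _ √D]
  have hbase : (m - 1) ^ ((n : ℝ) / 2) * √(precScale n m D ^ n * D⁻¹) /
      (∫ y : Space n, ballWeight (1 / (m - 1)) y) =
      (precScale n m D / covRatio n m) ^ (1 / (m - 1) + (n : ℝ) / 2) := by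
    rw [Real.div_rpow hτ.le hc.le, Real.rpow_add hτ, hpow, hsqrt]
    have : 0 < covRatio n m ^ (1 / (m - 1) + (n : ℝ) / 2) := by positivity
    field_simp
  rw [peak, hbase, ← Real.rpow_mul (by positivity), mul_one_div_cancel hE.ne', Real.rpow_one]
  field_simp

/-- The coordinates of the `q`-Gaussian with mean `η` and covariance matrix `S`. -/
def ofMeanCov {n : ℕ} (m : ℝ) (η : Fin n → ℝ) (S : Matrix (Fin n) (Fin n) ℝ) : Param n :=
  (WithLp.toLp 2 ((2 * precScale n m S.det) • (S⁻¹ *ᵥ η)), -(precScale n m S.det • S⁻¹))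

theorem neg_ofMeanCov_snd {n : ℕ} (m : ℝ) (η : Fin n → ℝ) (S : Matrix (Fin n) (Fin n) ℝ) :
    -(ofMeanCov m η S).2 = precScale n m S.det • S⁻¹ := neg_neg _

section OfMeanCov

variable {n : ℕ} {m : ℝ} {S : Matrix (Fin n) (Fin n) ℝ}

theorem ofMeanCov_mem (hn : 1 ≤ n) (hm : 1 < m) (η : Fin n → ℝ) (hS : S.PosDef) :
    ofMeanCov m η S ∈ paramDomain n := by
  change (-(ofMeanCov m η S).2).PosDef
  rw [neg_ofMeanCov_snd]
  exact hS.inv.smul (precScale_pos hn hm hS.det_pos)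

theorem inv_neg_ofMeanCov_snd (hn : 1 ≤ n) (hm : 1 < m) (η : Fin n → ℝ) (hS : S.PosDef) :
    (-(ofMeanCov m η S).2)⁻¹ = (precScale n m S.det)⁻¹ • S := by
  have hτ := precScale_pos hn hm hS.det_pos
  rw [neg_ofMeanCov_snd]
  refine Matrix.inv_eq_right_inv ?_
  rw [Matrix.smul_mul, Matrix.mul_smul, smul_smul, mul_inv_cancel₀ hτ.ne', one_smul,
    Matrix.nonsing_inv_mul _ (isUnit_iff_ne_zero.2 hS.det_pos.ne')]

theorem center_ofMeanCov (hn : 1 ≤ n) (hm : 1 < m) (η : Fin n → ℝ) (hS : S.PosDef) :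
    center (ofMeanCov m η S) = η := by
  have hτ := precScale_pos hn hm hS.det_pos
  rw [center, inv_neg_ofMeanCov_snd hn hm η hS]
  simp only [ofMeanCov]
  rw [Matrix.smul_mulVec, Matrix.mulVec_smul, Matrix.mulVec_mulVec,
    Matrix.mul_nonsing_inv _ (isUnit_iff_ne_zero.2 hS.det_pos.ne'), Matrix.one_mulVec, smul_smul,
    smul_smul]
  rw [show 1 / 2 * (precScale n m S.det)⁻¹ * (2 * precScale n m S.det) = 1 by field_simp,
    one_smul]

theorem covRatio_mul_peak_ofMeanCov (hn : 1 ≤ n) (hm : 1 < m) (η : Fin n → ℝ) (hS : S.PosDef) :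
    covRatio n m * peak n m (-(ofMeanCov m η S).2).det = precScale n m S.det := by
  rw [neg_ofMeanCov_snd, Matrix.det_smul, Fintype.card_fin, Matrix.det_nonsing_inv,
    Ring.inverse_eq_inv']
  exact covRatio_mul_peak hn hm hS.det_pos

theorem firstMoment_ofMeanCov (hn : 1 ≤ n) (hm : 1 < m) (η : Fin n → ℝ) (hS : S.PosDef) :
    firstMoment (qGauss (2 - m) (ofMeanCov m η S)) = η := by
  rw [firstMoment_qGauss hn hm (ofMeanCov_mem hn hm η hS), center_ofMeanCov hn hm η hS]

theorem secondMoment_ofMeanCov (hn : 1 ≤ n) (hm : 1 < m) (η : Fin n → ℝ) (hS : S.PosDef) :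
    secondMoment (qGauss (2 - m) (ofMeanCov m η S)) = Matrix.vecMulVec η η + S := by
  have hτ := precScale_pos hn hm hS.det_pos
  rw [secondMoment_qGauss hn hm (ofMeanCov_mem hn hm η hS), center_ofMeanCov hn hm η hS,
    covRatio_mul_peak_ofMeanCov hn hm η hS, inv_neg_ofMeanCov_snd hn hm η hS, smul_smul,
    mul_inv_cancel₀ hτ.ne', one_smul]

end OfMeanCov

/-! ### Smooth curves of coordinates -/

/-- A curve of coordinates that is smooth on `(a, ∞)`. -/
def IsSmoothCurve {n : ℕ} (a : ℝ) (γ : ℝ → Param n) : Prop :=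
  ContDiffOn ℝ (⊤ : ℕ∞) (fun s => toCoord (γ s)) (Ioi a)

namespace IsSmoothCurve

variable {n : ℕ} {a : ℝ} {γ : ℝ → Param n}

theorem contDiffOn_fst (h : IsSmoothCurve a γ) : ContDiffOn ℝ (⊤ : ℕ∞) (fun s => (γ s).1) (Ioi a) := by
  have h1 : ContDiff ℝ (⊤ : ℕ∞) fun p : Coord n => p.1 := contDiff_fst
  exact h1.comp_contDiffOn h

theorem contDiffOn_snd (h : IsSmoothCurve a γ) (i j : Fin n) :
    ContDiffOn ℝ (⊤ : ℕ∞) (fun s => (γ s).2 i j) (Ioi a) := by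
  have h1 : ContDiff ℝ (⊤ : ℕ∞) fun p : Coord n => p.2 i j := by fun_prop
  exact h1.comp_contDiffOn h

theorem hasDerivAt (h : IsSmoothCurve a γ) {s : ℝ} (hs : a < s) :
    HasDerivAt (fun s => toCoord (γ s)) (toCoord (velocity γ s)) s := by
  have hnhds : Ioi a ∈ 𝓝 s := Ioi_mem_nhds hs
  have h1 : HasDerivAt (fun s => (γ s).1) (velocity γ s).1 s :=
    ((h.contDiffOn_fst.contDiffAt hnhds).differentiableAt (by simp)).hasDerivAt
  have h2 : HasDerivAt (fun s => fun i j => (γ s).2 i j) (fun i j => (velocity γ s).2 i j) s :=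
    hasDerivAt_pi.2 fun i => hasDerivAt_pi.2 fun j =>
      (((h.contDiffOn_snd i j).contDiffAt hnhds).differentiableAt (by simp)).hasDerivAt
  exact h1.prodMk h2

theorem velocity (h : IsSmoothCurve a γ) : IsSmoothCurve a (velocity γ) := by
  have h1 : ContDiffOn ℝ (⊤ : ℕ∞) (deriv fun s => toCoord (γ s)) (Ioi a) :=
    ContDiffOn.deriv_of_isOpen h isOpen_Ioi (by simp)
  exact h1.congr fun s hs => (h.hasDerivAt hs).deriv.symm

theorem hasDerivAt_quadForm (h : IsSmoothCurve a γ) {s : ℝ} (hs : a < s) (x : Space n) :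
    HasDerivAt (fun s => quadForm (γ s) x) (quadForm (PMEGeometry.velocity γ s) x) s := by
  have h1 := h.hasDerivAt hs
  have h2 : HasDerivAt (fun s => (toCoord (γ s)).1) (toCoord (PMEGeometry.velocity γ s)).1 s :=
    (ContinuousLinearMap.fst ℝ (Space n) (Fin n → Fin n → ℝ)).hasFDerivAt.comp_hasDerivAt s h1
  have h3 : HasDerivAt (fun s => (toCoord (γ s)).2) (toCoord (PMEGeometry.velocity γ s)).2 s :=
    (ContinuousLinearMap.snd ℝ (Space n) (Fin n → Fin n → ℝ)).hasFDerivAt.comp_hasDerivAt s h1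
  have hf : ∀ i, HasDerivAt (fun s => (γ s).1 i) ((PMEGeometry.velocity γ s).1 i) s := fun i =>
    (EuclideanSpace.proj (𝕜 := ℝ) i).hasFDerivAt.comp_hasDerivAt s h2
  have hg : ∀ i j, HasDerivAt (fun s => (γ s).2 i j) ((PMEGeometry.velocity γ s).2 i j) s :=
    fun i j => hasDerivAt_pi.1 (hasDerivAt_pi.1 h3 i) j
  simp only [quadForm_eq_sum]
  exact (HasDerivAt.fun_sum fun i _ => (hf i).mul_const _).add
    (HasDerivAt.fun_sum fun i _ => HasDerivAt.fun_sum fun j _ => (hg i j).mul_const _)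

theorem continuousOn_quadForm (h : IsSmoothCurve a γ) :
    ContinuousOn (fun z : ℝ × Space n => quadForm (γ z.1) z.2) (Ioi a ×ˢ univ) := by
  have hf : ContinuousOn (fun z : ℝ × Space n => toCoord (γ z.1)) (Ioi a ×ˢ univ) :=
    h.continuousOn.comp continuousOn_fst fun z hz => hz.1
  have hq : Continuous fun p : Coord n × Space n =>
      ∑ i, p.1.1 i * p.2 i + ∑ i, ∑ j, p.1.2 i j * (p.2 i * p.2 j) := by fun_prop
  simp only [quadForm_eq_sum]
  exact hq.comp_continuousOn (hf.prodMk continuousOn_snd)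

end IsSmoothCurve

theorem isTangent_velocity {n : ℕ} {γ : ℝ → Param n} (h : ∀ s, IsTangent (γ s)) (s : ℝ) :
    IsTangent (velocity γ s) := by
  ext i j
  simp only [velocity, Matrix.transpose_apply, Matrix.of_apply]
  congr 1
  ext r
  exact (h r).apply i j

/-! ### Derivatives of the pressure along a curve -/

theorem hasDerivAt_clm_apply_curve {E : Type*} [NormedAddCommGroup E] [NormedSpace ℝ E]
    {f : E → E →L[ℝ] ℝ} {f' : E →L[ℝ] E →L[ℝ] ℝ} {c v : ℝ → E} {c' v' : E} {s : ℝ}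
    (hf : HasFDerivAt f f' (c s)) (hc : HasDerivAt c c' s) (hv : HasDerivAt v v' s) :
    HasDerivAt (fun s => f (c s) (v s)) (f' c' (v s) + f (c s) v') s := by
  have h : HasDerivAt (fun s => f (c s)) (f' c') s := hf.comp_hasDerivAt s hc
  exact h.clm_apply hv

namespace IsSmoothCurve

variable {n : ℕ} {a m : ℝ} {γ : ℝ → Param n}

theorem hasDerivAt_pressure (h : IsSmoothCurve a γ) (hm : 1 < m)
    (hmem : ∀ s ∈ Ioi a, γ s ∈ paramDomain n) {s : ℝ} (hs : s ∈ Ioi a) (x : Space n) :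
    HasDerivAt (fun s => pressure m (γ s) x) (dpressure m (γ s) (PMEGeometry.velocity γ s) x) s := by
  have h1 : HasDerivAt (fun s => psiFun m (toCoord (γ s))) (dpsi m (γ s) (PMEGeometry.velocity γ s))
      s :=
    HasFDerivAt.comp_hasDerivAt (f := fun s => toCoord (γ s)) s (hasFDerivAt_psiFun hm (hmem s hs))
      (h.hasDerivAt hs)
  have h2 : (fun s => psi (2 - m) (γ s)) =ᶠ[𝓝 s] fun s => psiFun m (toCoord (γ s)) := by
    filter_upwards [Ioi_mem_nhds hs] with r hr using psi_eq_psiFun hm (hmem r hr)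
  exact (((h.hasDerivAt_quadForm hs x).sub (h1.congr_of_eventuallyEq h2)).const_mul
    (m - 1)).const_add 1

theorem hasDerivAt_dpressure (h : IsSmoothCurve a γ) (hm : 1 < m)
    (hmem : ∀ s ∈ Ioi a, γ s ∈ paramDomain n) {s : ℝ} (hs : s ∈ Ioi a) (x : Space n) :
    HasDerivAt (fun s => dpressure m (γ s) (PMEGeometry.velocity γ s) x)
      (dpressure m (γ s) (PMEGeometry.velocity (PMEGeometry.velocity γ) s) x +
        (m - 1) * -d2psi m (γ s) (PMEGeometry.velocity γ s)) s := by
  have h1 : HasDerivAt (fun s => dpsi m (γ s) (PMEGeometry.velocity γ s))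
      (d2psi m (γ s) (PMEGeometry.velocity γ s) +
        dpsi m (γ s) (PMEGeometry.velocity (PMEGeometry.velocity γ) s)) s :=
    hasDerivAt_clm_apply_curve (hasFDerivAt_fderiv_psiFun hm (hmem s hs)) (h.hasDerivAt hs)
      (h.velocity.hasDerivAt hs)
  refine (((h.velocity.hasDerivAt_quadForm hs x).sub h1).const_mul (m - 1)).congr_deriv ?_
  unfold dpressure
  ring

theorem continuousOn_dpsi (h : IsSmoothCurve a γ) (hm : 1 < m)
    (hmem : ∀ s ∈ Ioi a, γ s ∈ paramDomain n) {ζ : ℝ → Param n} (hζ : IsSmoothCurve a ζ) :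
    ContinuousOn (fun s => dpsi m (γ s) (ζ s)) (Ioi a) := fun s hs => by
  have h1 := (((contDiffAt_psiFun hm (hmem s hs)).fderiv_right (m := 2)
    (by norm_num)).continuousAt).comp_continuousWithinAt (f := fun s => toCoord (γ s))
    (h.continuousOn s hs)
  exact h1.clm_apply (hζ.continuousOn s hs)

theorem continuousOn_d2psi (h : IsSmoothCurve a γ) (hm : 1 < m)
    (hmem : ∀ s ∈ Ioi a, γ s ∈ paramDomain n) {ζ : ℝ → Param n} (hζ : IsSmoothCurve a ζ) :
    ContinuousOn (fun s => d2psi m (γ s) (ζ s)) (Ioi a) := fun s hs => by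
  have h1 := ((((contDiffAt_psiFun hm (hmem s hs)).fderiv_right (m := 2)
    (by norm_num)).fderiv_right (m := 1) (by norm_num)).continuousAt).comp_continuousWithinAt
    (f := fun s => toCoord (γ s)) (h.continuousOn s hs)
  exact (h1.clm_apply (hζ.continuousOn s hs)).clm_apply (hζ.continuousOn s hs)

theorem continuousOn_dpressure (h : IsSmoothCurve a γ) (hm : 1 < m)
    (hmem : ∀ s ∈ Ioi a, γ s ∈ paramDomain n) {ζ : ℝ → Param n} (hζ : IsSmoothCurve a ζ) :
    ContinuousOn (fun z : ℝ × Space n => dpressure m (γ z.1) (ζ z.1) z.2) (Ioi a ×ˢ univ) :=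
  continuousOn_const.mul (hζ.continuousOn_quadForm.sub
    ((h.continuousOn_dpsi hm hmem hζ).comp continuousOn_fst fun _ hz => hz.1))

theorem continuousOn_pressure (h : IsSmoothCurve a γ) (hm : 1 < m)
    (hmem : ∀ s ∈ Ioi a, γ s ∈ paramDomain n) :
    ContinuousOn (fun z : ℝ × Space n => pressure m (γ z.1) z.2) (Ioi a ×ˢ univ) := by
  have h1 : ContinuousOn (fun s => psi (2 - m) (γ s)) (Ioi a) := by
    refine ContinuousOn.congr (f := fun s => psiFun m (toCoord (γ s))) (fun s hs => ?_)
      fun s hs => psi_eq_psiFun hm (hmem s hs)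
    exact ((contDiffAt_psiFun hm (hmem s hs)).continuousAt).comp_continuousWithinAt
      (f := fun s => toCoord (γ s)) (h.continuousOn s hs)
  exact continuousOn_const.add (continuousOn_const.mul (h.continuousOn_quadForm.sub
    (h1.comp continuousOn_fst fun _ hz => hz.1)))

end IsSmoothCurve

/-! ### Curves with affine moments are m-geodesics -/

/-- The integrals of quadratic polynomials against `p_γ(s)` are affine in `s` when the moments are.
Differentiating them twice under the integral sign gives the geodesic equation. -/
theorem isMGeodesic_of_affine_moments {n : ℕ} (hn : 1 ≤ n) {a m : ℝ} (hm : 1 < m) (hm₂ : m < 2)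
    {γ : ℝ → Param n} (hγ : IsSmoothCurve a γ) (hmem : ∀ s ∈ Ioi a, γ s ∈ paramDomain n)
    (htan : ∀ s, IsTangent (γ s)) {lam : ℝ → ℝ} {η : Fin n → ℝ}
    {B : ℝ → Matrix (Fin n) (Fin n) ℝ}
    (hprof : IsMovingProfile a (fun s => pressure m (γ s))
      (fun s => dpressure m (γ s) (velocity γ s)) lam η B)
    {S R : Matrix (Fin n) (Fin n) ℝ}
    (h1 : ∀ s ∈ Ioi a, firstMoment (qGauss (2 - m) (γ s)) = η)
    (h2 : ∀ s ∈ Ioi a, secondMoment (qGauss (2 - m) (γ s)) = S + s • R) :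
    IsMGeodesic (2 - m) γ (Ioi a) where
  mem := hmem
  contDiff_fst := hγ.contDiffOn_fst.of_le two_le_smooth
  contDiff_snd i j := (hγ.contDiffOn_snd i j).of_le two_le_smooth
  geodesic_eq s₀ hs₀ z hz := by
    have hm' : 0 < m - 1 := by linarith
    have hk : 1 < 1 / (m - 1) := by
      rw [lt_div_iff₀ hm']; linarith
    set k := 1 / (m - 1) with hkdef
    -- on the support of the density at `s₀`, `φ` is the derivative of `ln_q p` in the direction `z`
    set φ : Space n → ℝ := fun x => quadForm z x - dpsi m (γ s₀) z with hφ
    have hφc : ContinuousOn (fun p : ℝ × Space n => φ p.2) (Ioi a ×ˢ univ) :=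
      (((continuous_quadForm z).sub continuous_const).comp continuous_snd).continuousOn
    have hw' := hγ.continuousOn_dpressure hm hmem hγ.velocity
    have hw'' : ContinuousOn (fun p : ℝ × Space n =>
        dpressure m (γ p.1) (velocity (velocity γ) p.1) p.2 +
          (m - 1) * -d2psi m (γ p.1) (velocity γ p.1)) (Ioi a ×ˢ univ) :=
      (hγ.continuousOn_dpressure hm hmem hγ.velocity.velocity).add (continuousOn_const.mul
        ((hγ.continuousOn_d2psi hm hmem hγ.velocity).comp continuousOn_fst fun _ hp => hp.1).neg)
    -- the first derivative is the slope of an affine function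
    have hfirst : ∀ s ∈ Ioi a, ∫ x, truncPow (k - 1) (pressure m (γ s) x) *
        (k * dpressure m (γ s) (velocity γ s) x * φ x) = ∑ i, ∑ j, z.2 i j * R i j := by
      intro s hs
      have hd := hprof.hasDerivAt_integral hn (j := k) (by linarith) (c := fun _ x => φ x)
        (c' := fun _ _ => 0) hφc continuousOn_const (fun s _ x => hasDerivAt_const s (φ x)) hs
      simp only [mul_zero, integral_zero, add_zero] at hd
      have he : (fun s => ∫ x, truncPow k (pressure m (γ s) x) * φ x) =ᶠ[𝓝 s] fun s =>
          (∑ i, z.1 i * η i + ∑ i, ∑ j, z.2 i j * (S i j + s * R i j)) - dpsi m (γ s₀) z := by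
        filter_upwards [Ioi_mem_nhds hs] with r hr
        have hden := isDensity_qGauss hn hm (hmem r hr)
        have hi := integral_mul_quadForm hden z
        rw [h1 r hr, h2 r hr, quadMoment] at hi
        simp only [Matrix.add_apply, Matrix.smul_apply, smul_eq_mul] at hi
        have hq : Integrable fun x => qGauss (2 - m) (γ r) x * quadForm z x :=
          integrable_mul_quadForm hden z
        rw [← hi, ← one_mul (dpsi m (γ s₀) z), ← hden.mass, ← integral_mul_const,
          ← integral_sub hq (hden.integrable.mul_const _)]
        refine integral_congr_ae (Eventually.of_forall fun x => ?_)
        simp only [qGauss_eq hm, hφ]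
        ring
      have haff : HasDerivAt (fun s : ℝ =>
          (∑ i, z.1 i * η i + ∑ i, ∑ j, z.2 i j * (S i j + s * R i j)) - dpsi m (γ s₀) z)
          (∑ i, ∑ j, z.2 i j * R i j) s := by
        refine HasDerivAt.sub_const _ (HasDerivAt.const_add _ ?_)
        refine HasDerivAt.fun_sum fun i _ => HasDerivAt.fun_sum fun j _ => ?_
        simpa using (((hasDerivAt_id s).mul_const (R i j)).const_add (S i j)).const_mul (z.2 i j)
      exact hd.unique (haff.congr_of_eventuallyEq he)
    -- hence the second derivative vanishes; differentiation under the integral sign computes it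
    have hd := hprof.hasDerivAt_integral hn (j := k - 1) (by linarith)
      (c := fun s x => k * dpressure m (γ s) (velocity γ s) x * φ x)
      (c' := fun s x => k * (dpressure m (γ s) (velocity (velocity γ) s) x +
        (m - 1) * -d2psi m (γ s) (velocity γ s)) * φ x)
      ((continuousOn_const.mul hw').mul hφc) ((continuousOn_const.mul hw'').mul hφc)
      (fun s hs x => ((hγ.hasDerivAt_dpressure hm hmem hs x).const_mul k).mul_const (φ x)) hs₀
    have hconst : HasDerivAt (fun s => ∫ x, truncPow (k - 1) (pressure m (γ s) x) *
        (k * dpressure m (γ s) (velocity γ s) x * φ x)) 0 s₀ := by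
      refine (hasDerivAt_const s₀ (∑ i, ∑ j, z.2 i j * R i j)).congr_of_eventuallyEq ?_
      filter_upwards [Ioi_mem_nhds hs₀] with r hr using hfirst r hr
    have hzero := hd.unique hconst
    have hv := isTangent_velocity htan
    rw [mConnection_eq hn hm (hmem s₀ hs₀) (hv s₀) hz, metric_eq hn hm (hmem s₀ hs₀)
      (isTangent_velocity hv s₀) hz, ← hzero, ← hkdef]
    have i1 := hprof.integrable_slice hn (e := k - 1 - 1) (by linarith)
      (c := fun s x => (k - 1) * dpressure m (γ s) (velocity γ s) x *
        (k * dpressure m (γ s) (velocity γ s) x * φ x))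
      ((continuousOn_const.mul hw').mul ((continuousOn_const.mul hw').mul hφc)) hs₀
    have i2 := hprof.integrable_slice hn (e := k - 1) (by linarith)
      (c := fun _ x => k * ((m - 1) * -d2psi m (γ s₀) (velocity γ s₀)) * φ x)
      (continuousOn_const.mul hφc) hs₀
    have i3 := hprof.integrable_slice hn (e := k - 1) (by linarith)
      (c := fun s x => k * dpressure m (γ s) (velocity (velocity γ) s) x * φ x)
      ((continuousOn_const.mul (hγ.continuousOn_dpressure hm hmem hγ.velocity.velocity)).mul hφc)
      hs₀
    rw [integral_add i1 i2, add_assoc, ← integral_add i2 i3]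
    congr 1
    refine integral_congr_ae (Eventually.of_forall fun x => ?_)
    ring

/-! ### Matrices diagonalized by a fixed orthogonal matrix -/

section Orthogonal

variable {n : ℕ} {V : Matrix (Fin n) (Fin n) ℝ}

theorem conj_diagonal_apply (V : Matrix (Fin n) (Fin n) ℝ) (e : Fin n → ℝ) (i j : Fin n) :
    (V * Matrix.diagonal e * Vᵀ) i j = ∑ l, V i l * e l * V j l := by
  rw [Matrix.mul_apply]
  simp only [Matrix.mul_diagonal, Matrix.transpose_apply]

theorem transpose_conj_diagonal (V : Matrix (Fin n) (Fin n) ℝ) (e : Fin n → ℝ) :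
    (V * Matrix.diagonal e * Vᵀ)ᵀ = V * Matrix.diagonal e * Vᵀ := by
  simp [Matrix.transpose_mul, Matrix.mul_assoc]

theorem conj_diagonal_mul (hV : Vᵀ * V = 1) (e f : Fin n → ℝ) :
    V * Matrix.diagonal e * Vᵀ * (V * Matrix.diagonal f * Vᵀ) =
      V * Matrix.diagonal (fun i => e i * f i) * Vᵀ := by
  rw [← Matrix.diagonal_mul_diagonal]
  calc _ = V * Matrix.diagonal e * (Vᵀ * V) * Matrix.diagonal f * Vᵀ := by
        simp only [Matrix.mul_assoc]
    _ = _ := by rw [hV, Matrix.mul_one]; simp only [Matrix.mul_assoc]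

theorem conj_diagonal_inv (hV : Vᵀ * V = 1) (hV' : V * Vᵀ = 1) {e : Fin n → ℝ}
    (he : ∀ i, e i ≠ 0) :
    (V * Matrix.diagonal e * Vᵀ)⁻¹ = V * Matrix.diagonal (fun i => (e i)⁻¹) * Vᵀ := by
  refine Matrix.inv_eq_right_inv ?_
  rw [conj_diagonal_mul hV]
  simp only [mul_inv_cancel₀ (he _), Matrix.diagonal_one, Matrix.mul_one, hV']

theorem det_conj_diagonal (hV : Vᵀ * V = 1) (e : Fin n → ℝ) :
    (V * Matrix.diagonal e * Vᵀ).det = ∏ i, e i := by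
  have h := congrArg Matrix.det hV
  rw [Matrix.det_mul, Matrix.det_one] at h
  rw [Matrix.det_mul, Matrix.det_mul, Matrix.det_diagonal, mul_right_comm, mul_comm V.det, h,
    one_mul]

theorem dotProduct_conj_diagonal (hV : Vᵀ * V = 1) (e b y : Fin n → ℝ) :
    ((V * Matrix.diagonal b) *ᵥ y) ⬝ᵥ
      ((V * Matrix.diagonal e * Vᵀ) *ᵥ ((V * Matrix.diagonal b) *ᵥ y)) =
      ∑ l, e l * (b l * y l) ^ 2 := by
  have h : Vᵀ *ᵥ ((V * Matrix.diagonal b) *ᵥ y) = fun l => b l * y l := by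
    rw [Matrix.mulVec_mulVec, ← Matrix.mul_assoc, hV, Matrix.one_mul]
    ext l
    rw [Matrix.mulVec_diagonal]
  generalize (V * Matrix.diagonal b) *ᵥ y = w at h ⊢
  rw [← Matrix.mulVec_mulVec, ← Matrix.mulVec_mulVec, Matrix.dotProduct_mulVec,
    ← Matrix.mulVec_transpose, h]
  simp only [dotProduct, Matrix.mulVec_diagonal]
  exact Finset.sum_congr rfl fun l _ => by ring

theorem posDef_conj_diagonal (hV' : V * Vᵀ = 1) {e : Fin n → ℝ} (he : ∀ i, 0 < e i) :
    (V * Matrix.diagonal e * Vᵀ).PosDef := by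
  have h := (Matrix.PosDef.diagonal he).mul_mul_conjTranspose_same (B := V) (by
    refine Matrix.vecMul_injective_of_isUnit ?_
    exact IsUnit.of_mul_eq_one _ hV')
  rwa [Matrix.conjTranspose_eq_transpose_of_trivial] at h

theorem conj_diagonal_add_smul_one (hV' : V * Vᵀ = 1) (d : Fin n → ℝ) (s : ℝ) :
    V * Matrix.diagonal (fun i => d i + s) * Vᵀ = V * Matrix.diagonal d * Vᵀ + s • 1 := by
  rw [← Matrix.diagonal_add, Matrix.mul_add, Matrix.add_mul, ← hV']
  congr 1
  rw [← Matrix.smul_one_eq_diagonal, Matrix.mul_smul, Matrix.mul_one, Matrix.smul_mul]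

end Orthogonal

/-! ### The curve of `q`-Gaussians with covariance matrices `S + s I` -/

/-- The curve of `q`-Gaussians with mean `η` and covariance matrices `V diag(d + s) Vᵀ`. -/
def spreadCurve {n : ℕ} (m : ℝ) (η : Fin n → ℝ) (V : Matrix (Fin n) (Fin n) ℝ) (d : Fin n → ℝ)
    (s : ℝ) : Param n :=
  ofMeanCov m η (V * Matrix.diagonal (fun i => d i + s) * Vᵀ)

section SpreadCurve

variable {n : ℕ} {a m : ℝ} {V : Matrix (Fin n) (Fin n) ℝ} {d : Fin n → ℝ}

theorem isTangent_spreadCurve (m : ℝ) (η : Fin n → ℝ) (V : Matrix (Fin n) (Fin n) ℝ)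
    (d : Fin n → ℝ) (s : ℝ) : IsTangent (spreadCurve m η V d s) := by
  change (-(_ • _))ᵀ = _
  rw [Matrix.transpose_neg, Matrix.transpose_smul, Matrix.transpose_nonsing_inv,
    transpose_conj_diagonal]
  rfl

theorem contDiffOn_precScale (hn : 1 ≤ n) (hm : 1 < m) (hd : ∀ s ∈ Ioi a, ∀ i, 0 < d i + s) :
    ContDiffOn ℝ (⊤ : ℕ∞) (fun s => precScale n m (∏ i, (d i + s))) (Ioi a) := fun s hs => by
  have hD : 0 < ∏ i, (d i + s) := Finset.prod_pos fun i _ => hd s hs i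
  have hK := integral_ballWeight_pos n (e := 1 / (m - 1)) (by
    have : 0 < m - 1 := by linarith
    positivity)
  have hsq := Real.sqrt_pos.2 hD
  have hc := covRatio_pos hn hm
  have hm' : 0 < m - 1 := by linarith
  have h1 : ContDiffAt ℝ (⊤ : ℕ∞) (fun s => ∏ i, (d i + s)) s :=
    (contDiff_prod fun i _ => contDiff_const.add contDiff_id).contDiffAt
  unfold precScale
  refine (ContDiffAt.rpow_const_of_ne ?_ ?_).contDiffWithinAt
  · exact contDiffAt_const.mul (contDiffAt_const.div ((h1.sqrt hD.ne').mul contDiffAt_const)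
      (by positivity))
  · positivity

theorem isSmoothCurve_spreadCurve (hn : 1 ≤ n) (hm : 1 < m) (hV : Vᵀ * V = 1) (hV' : V * Vᵀ = 1)
    (hd : ∀ s ∈ Ioi a, ∀ i, 0 < d i + s) (η : Fin n → ℝ) :
    IsSmoothCurve a (spreadCurve m η V d) := by
  have hτ := contDiffOn_precScale hn hm hd
  have hinv : ∀ i j, ContDiffOn ℝ (⊤ : ℕ∞) (fun s => ∑ l, V i l * (d l + s)⁻¹ * V j l) (Ioi a) :=
    fun i j => ContDiffOn.sum fun l _ => (contDiffOn_const.mul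
      ((contDiffOn_const.add contDiffOn_id).inv fun s hs => (hd s hs l).ne')).mul contDiffOn_const
  have h1 : ContDiffOn ℝ (⊤ : ℕ∞) (fun s => (WithLp.toLp 2 fun i => 2 *
      precScale n m (∏ i, (d i + s)) * ∑ j, (∑ l, V i l * (d l + s)⁻¹ * V j l) * η j : Space n))
      (Ioi a) := by
    refine contDiffOn_euclidean.2 fun i => ?_
    exact (contDiffOn_const.mul hτ).mul
      (ContDiffOn.sum fun j _ => (hinv i j).mul contDiffOn_const)
  have h2 : ContDiffOn ℝ (⊤ : ℕ∞) (fun s => fun i j =>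
      -(precScale n m (∏ i, (d i + s)) * ∑ l, V i l * (d l + s)⁻¹ * V j l)) (Ioi a) :=
    contDiffOn_pi.2 fun i => contDiffOn_pi.2 fun j => (hτ.mul (hinv i j)).neg
  refine (h1.prodMk h2).congr fun s hs => ?_
  simp only [toCoord, spreadCurve, ofMeanCov, det_conj_diagonal hV,
    conj_diagonal_inv hV hV' fun i => (hd s hs i).ne']
  refine Prod.ext ?_ ?_
  · ext i
    simp only [Pi.smul_apply, smul_eq_mul, Matrix.mulVec, dotProduct, conj_diagonal_apply]
  · ext i j
    simp only [Matrix.neg_apply, Matrix.smul_apply, smul_eq_mul, conj_diagonal_apply]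

theorem pressure_spreadCurve (hn : 1 ≤ n) (hm : 1 < m) (hV : Vᵀ * V = 1) (hV' : V * Vᵀ = 1)
    {s : ℝ} (hd : ∀ i, 0 < d i + s) (η b : Fin n → ℝ) (y : Space n) :
    pressure m (spreadCurve m η V d s) (affMap η (V * Matrix.diagonal b) y) =
      precScale n m (∏ i, (d i + s)) *
        ((covRatio n m)⁻¹ - (m - 1) * ∑ l, (d l + s)⁻¹ * (b l * y l) ^ 2) := by
  have hS := posDef_conj_diagonal hV' hd
  have hmem := ofMeanCov_mem hn hm η hS
  have hc := covRatio_pos hn hm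
  have hm' : 0 < m - 1 := by linarith
  have hq := quadForm_affMap_center hmem (V * Matrix.diagonal b) y
  have hp := covRatio_mul_peak_ofMeanCov hn hm η hS
  rw [center_ofMeanCov hn hm η hS, neg_ofMeanCov_snd, Matrix.smul_mulVec, dotProduct_smul,
    conj_diagonal_inv hV hV' fun i => (hd i).ne', dotProduct_conj_diagonal hV,
    smul_eq_mul] at hq
  rw [spreadCurve, pressure, psi_eq hm hmem, hq, ← det_conj_diagonal hV,
    ← mul_right_inj' hc.ne', ← hp]
  field_simp
  ring

/-- The ellipsoids on which the densities are positive all have the axes given by `V`. They grow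
strictly, so that each `x` is on the boundary at one time at most. -/
theorem isMovingProfile_spreadCurve (hn : 1 ≤ n) (hm : 1 < m) (hV : Vᵀ * V = 1)
    (hV' : V * Vᵀ = 1) (hd : ∀ s ∈ Ioi a, ∀ i, 0 < d i + s) (η : Fin n → ℝ) :
    IsMovingProfile a (fun s => pressure m (spreadCurve m η V d s))
      (fun s => dpressure m (spreadCurve m η V d s) (velocity (spreadCurve m η V d) s))
      (fun s => precScale n m (∏ i, (d i + s)) * (covRatio n m)⁻¹) η
      (fun s => V * Matrix.diagonal fun i => √((d i + s) / ((m - 1) * covRatio n m))) := by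
  have hm' : 0 < m - 1 := by linarith
  have hc := covRatio_pos hn hm
  have hγ := isSmoothCurve_spreadCurve hn hm hV hV' hd η
  have hmem : ∀ s ∈ Ioi a, spreadCurve m η V d s ∈ paramDomain n := fun s hs =>
    ofMeanCov_mem hn hm η (posDef_conj_diagonal hV' (hd s hs))
  have hτ : ∀ s ∈ Ioi a, 0 < precScale n m (∏ i, (d i + s)) := fun s hs =>
    precScale_pos hn hm (Finset.prod_pos fun i _ => hd s hs i)
  refine ⟨fun s hs => ?_, fun s hs => ?_, ?_, ?_, fun s hs y => ?_, ?_, ?_, fun s hs x => ?_, ?_⟩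
  · have h := congrArg Matrix.det hV
    rw [Matrix.det_mul, Matrix.det_one] at h
    rw [Matrix.det_mul, Matrix.det_diagonal]
    refine mul_ne_zero (right_ne_zero_of_mul_eq_one h) (Finset.prod_ne_zero_iff.2 fun i _ => ?_)
    have := hd s hs i
    positivity
  · have := hτ s hs
    positivity
  · exact (contDiffOn_precScale hn hm hd).continuousOn.mul continuousOn_const
  · have : Continuous fun s : ℝ =>
        V * Matrix.diagonal fun i => √((d i + s) / ((m - 1) * covRatio n m)) := by fun_prop
    exact this.continuousOn
  · rw [pressure_spreadCurve hn hm hV hV' (hd s hs), EuclideanSpace.real_norm_sq_eq]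
    have h1 : ∀ l, (d l + s)⁻¹ * (√((d l + s) / ((m - 1) * covRatio n m)) * y l) ^ 2 =
        ((m - 1) * covRatio n m)⁻¹ * y l ^ 2 := by
      intro l
      have := hd s hs l
      rw [mul_pow, Real.sq_sqrt (by positivity)]
      field_simp
    simp only [h1, ← Finset.mul_sum]
    field_simp
  · exact hγ.continuousOn_pressure hm hmem
  · exact hγ.continuousOn_dpressure hm hmem hγ.velocity
  · exact hγ.hasDerivAt_pressure hm hmem hs x
  · refine Eventually.of_forall fun x => Set.Subsingleton.countable ?_
    have hdet : (V * Matrix.diagonal fun _ => (1 : ℝ)).det ≠ 0 := by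
      have h := congrArg Matrix.det hV
      rw [Matrix.det_mul, Matrix.det_one] at h
      rw [Matrix.diagonal_one, Matrix.mul_one]
      exact right_ne_zero_of_mul_eq_one h
    obtain ⟨y, rfl⟩ := surjective_affMap η hdet x
    -- `y` holds the coordinates of `x - η` with respect to the axes
    have hsum : ∀ s ∈ Ioi a, pressure m (spreadCurve m η V d s)
        (affMap η (V * Matrix.diagonal fun _ => (1 : ℝ)) y) = 0 →
        ∑ l, (d l + s)⁻¹ * (1 * y l) ^ 2 = ((m - 1) * covRatio n m)⁻¹ := by
      intro s hs h
      rw [pressure_spreadCurve hn hm hV hV' (hd s hs)] at h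
      have h1 := (mul_eq_zero.1 h).resolve_left (hτ s hs).ne'
      rw [mul_inv, ← div_eq_inv_mul, eq_div_iff hm'.ne']
      linarith
    have hlt : ∀ s ∈ Ioi a, ∀ r, s < r → ∑ l, (d l + s)⁻¹ * (1 * y l) ^ 2 =
        ((m - 1) * covRatio n m)⁻¹ → ∑ l, (d l + r)⁻¹ * (1 * y l) ^ 2 <
        ∑ l, (d l + s)⁻¹ * (1 * y l) ^ 2 := by
      intro s hs r hsr h
      have hne : ∃ l ∈ Finset.univ, (d l + s)⁻¹ * (1 * y l) ^ 2 ≠ 0 := by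
        refine Finset.exists_ne_zero_of_sum_ne_zero ?_
        rw [h]
        positivity
      obtain ⟨l, -, hl⟩ := hne
      refine Finset.sum_lt_sum (fun i _ => ?_) ⟨l, Finset.mem_univ l, ?_⟩
      · have := hd s hs i
        gcongr
      · have := hd s hs l
        have hy : 0 < (1 * y l) ^ 2 := by
          refine lt_of_le_of_ne (sq_nonneg _) fun h0 => hl ?_
          rw [← h0, mul_zero]
        gcongr
    intro s hs r hr
    rcases lt_trichotomy s r with h | h | h
    · have h1 := hsum s hs.1 hs.2
      have h2 := hsum r hr.1 hr.2
      have := hlt s hs.1 r h h1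
      linarith
    · exact h
    · have h1 := hsum s hs.1 hs.2
      have h2 := hsum r hr.1 hr.2
      have := hlt r hr.1 s h h2
      linarith

theorem isMGeodesic_spreadCurve (hn : 1 ≤ n) (hm : 1 < m) (hm₂ : m < 2) (hV : Vᵀ * V = 1)
    (hV' : V * Vᵀ = 1) (hd : ∀ s ∈ Ioi a, ∀ i, 0 < d i + s) (η : Fin n → ℝ) :
    IsMGeodesic (2 - m) (spreadCurve m η V d) (Ioi a) := by
  refine isMGeodesic_of_affine_moments hn hm hm₂ (isSmoothCurve_spreadCurve hn hm hV hV' hd η)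
    (fun s hs => ofMeanCov_mem hn hm η (posDef_conj_diagonal hV' (hd s hs)))
    (isTangent_spreadCurve m η V d) (isMovingProfile_spreadCurve hn hm hV hV' hd η)
    (S := Matrix.vecMulVec η η + V * Matrix.diagonal d * Vᵀ) (R := 1)
    (fun s hs => firstMoment_ofMeanCov hn hm η (posDef_conj_diagonal hV' (hd s hs))) fun s hs => ?_
  rw [spreadCurve, secondMoment_ofMeanCov hn hm η (posDef_conj_diagonal hV' (hd s hs)),
    conj_diagonal_add_smul_one hV', add_assoc]

end SpreadCurve

/-! ### Covariance matrices are positive definite -/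

theorem ae_dotProduct_ne {n : ℕ} {v : Fin n → ℝ} (hv : v ≠ 0) (c : ℝ) :
    ∀ᵐ x : Space n, v ⬝ᵥ x.ofLp ≠ c := by
  let A : AffineSubspace ℝ (Space n) :=
    { carrier := {x | v ⬝ᵥ x.ofLp = c}
      smul_vsub_vadd_mem' := by
        intro t x y z hx hy hz
        simp only [mem_ofPred_eq] at hx hy hz ⊢
        simp [dotProduct_add, dotProduct_smul, dotProduct_sub, hx, hy, hz] }
  have hA : A ≠ ⊤ := by
    intro h
    have h0 : (0 : Space n) ∈ A := h ▸ AffineSubspace.mem_top ℝ _ _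
    have h1 : (WithLp.toLp 2 v : Space n) ∈ A := h ▸ AffineSubspace.mem_top ℝ _ _
    have h0' : v ⬝ᵥ (0 : Fin n → ℝ) = c := h0
    have h1' : v ⬝ᵥ v = c := h1
    rw [dotProduct_zero] at h0'
    exact hv (dotProduct_self_eq_zero.1 (h1'.trans h0'.symm))
  have h : volume {x : Space n | v ⬝ᵥ x.ofLp = c} = 0 :=
    Measure.addHaar_affineSubspace (volume : Measure (Space n)) A hA
  simpa only [ae_iff, ne_eq, not_not] using h

theorem posDef_covariance {n : ℕ} {p : Space n → ℝ} (hp : IsDensity p) :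
    (secondMoment p - Matrix.vecMulVec (firstMoment p) (firstMoment p)).PosDef := by
  refine Matrix.PosDef.of_dotProduct_mulVec_pos ?_ fun v hv => ?_
  · ext i j
    simp only [Matrix.conjTranspose_apply, star_trivial, Matrix.sub_apply, secondMoment,
      Matrix.of_apply, Matrix.vecMulVec_apply, mul_comm]
  · set η := firstMoment p
    -- the quadratic form at `v` is the integral of `p x (v·x - v·η)²`, whose second factor vanishes
    -- on a hyperplane only
    let z : Param n := (WithLp.toLp 2 ((-2 * (v ⬝ᵥ η)) • v), Matrix.vecMulVec v v)
    have hz : ∀ x : Space n, quadForm z x + (v ⬝ᵥ η) ^ 2 = (v ⬝ᵥ x.ofLp - v ⬝ᵥ η) ^ 2 := by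
      intro x
      have : x.ofLp ⬝ᵥ (Matrix.vecMulVec v v *ᵥ x.ofLp) = (v ⬝ᵥ x.ofLp) ^ 2 := by
        rw [Matrix.vecMulVec_mulVec, dotProduct_smul, dotProduct_comm]
        simp [sq]
      simp only [quadForm, z, this, smul_dotProduct, smul_eq_mul]
      ring
    have hi := integrable_mul_quadForm hp z
    have hint : Integrable fun x => p x * (v ⬝ᵥ x.ofLp - v ⬝ᵥ η) ^ 2 := by
      refine (hi.add (hp.integrable.mul_const ((v ⬝ᵥ η) ^ 2))).congr
        (Eventually.of_forall fun x => ?_)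
      simp only [Pi.add_apply, ← hz]
      ring
    have hval : ∫ x, p x * (v ⬝ᵥ x.ofLp - v ⬝ᵥ η) ^ 2 =
        v ⬝ᵥ ((secondMoment p - Matrix.vecMulVec η η) *ᵥ v) := by
      simp only [← hz, mul_add]
      rw [integral_add hi (hp.integrable.mul_const _), integral_mul_const, hp.mass,
        integral_mul_quadForm hp, quadMoment, Matrix.sub_mulVec, dotProduct_sub,
        Matrix.vecMulVec_mulVec, dotProduct_smul]
      have e1 : ∑ i, z.1 i * firstMoment p i = -2 * (v ⬝ᵥ η) * (v ⬝ᵥ η) := by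
        simp only [z, Pi.smul_apply, smul_eq_mul, dotProduct, mul_assoc, Finset.mul_sum]
        rfl
      have e2 : ∑ i, ∑ j, z.2 i j * secondMoment p i j = v ⬝ᵥ (secondMoment p *ᵥ v) := by
        simp only [z, Matrix.vecMulVec_apply, dotProduct, Matrix.mulVec, Finset.mul_sum]
        exact Finset.sum_congr rfl fun i _ => Finset.sum_congr rfl fun j _ => by ring
      rw [e1, e2, dotProduct_comm η v]
      simp
      ring
    rw [star_trivial, ← hval]
    have hnn : 0 ≤ᵐ[volume] fun x => p x * (v ⬝ᵥ x.ofLp - v ⬝ᵥ η) ^ 2 := by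
      filter_upwards [hp.nonneg] with x hx using mul_nonneg hx (sq_nonneg _)
    refine lt_of_le_of_ne (integral_nonneg_of_ae hnn) fun h0 => ?_
    have h1 := (integral_eq_zero_iff_of_nonneg_ae hnn hint).1 h0.symm
    have h2 : p =ᵐ[volume] 0 := by
      filter_upwards [h1, ae_dotProduct_ne hv (v ⬝ᵥ η)] with x hx hne
      have := mul_eq_zero.1 hx
      exact this.resolve_right (pow_ne_zero 2 (sub_ne_zero.2 hne))
    have h3 := hp.mass
    rw [integral_congr_ae h2] at h3
    simp at h3

end PMEGeometry

end

theorem theorem1 (n : ℕ) (hn : 1 ≤ n) (m q : ℝ) (hm₁ : 1 < m) (hm₂ : m < 2) (hq : m = 2 - q)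
    (η₀ : Fin n → ℝ) (H₀ : Matrix (Fin n) (Fin n) ℝ)
    (hmom : ∃ p : Space n → ℝ, IsDensity p ∧ firstMoment p = η₀ ∧ secondMoment p = H₀) :
    ∃ (a : ℝ) (γ : ℝ → Param n), a < 0 ∧
      -- `γ` is an m-geodesic on `(a, ∞)`, hence on `[0, ∞)` ...
      IsMGeodesic q γ (Ioi a) ∧
      -- ... which starts at the unique `q`-Gaussian with the moments `η₀`, `H₀` ...
      (∀ ω ∈ paramDomain n,
        (firstMoment (qGauss q ω) = η₀ ∧ secondMoment (qGauss q ω) = H₀) ↔ ω = γ 0) ∧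
      -- ... and is a straight line in the expectation coordinates.
      (∀ s, 0 ≤ s → IsDensity (qGauss q (γ s)) ∧ firstMoment (qGauss q (γ s)) = η₀ ∧
        secondMoment (qGauss q (γ s)) = H₀ + s • (1 : Matrix (Fin n) (Fin n) ℝ)) ∧
      -- Every solution with these initial moments:
      ∀ u : ℝ → Space n → ℝ, IsWeakSolution m u → IsDensity (u 0) →
        firstMoment (u 0) = η₀ → secondMoment (u 0) = H₀ →
        -- `σ_u` is continuous and strictly increasing from `0`;
        momentShift m u 0 = 0 ∧
        ContinuousOn (momentShift m u) (Ici 0) ∧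
        StrictMonoOn (momentShift m u) (Ici 0) ∧
        ∀ t, 0 ≤ t →
          -- evolution of the moments;
          IsDensity (u t) ∧
          firstMoment (u t) = η₀ ∧
          secondMoment (u t) = H₀ + momentShift m u t • (1 : Matrix (Fin n) (Fin n) ℝ) ∧
          -- `γ (σ_u t)` is the unique m-projection of `u t`;
          (∀ ω, IsMProjection q (u t) ω ↔ ω = γ (momentShift m u t)) ∧
          -- it is the plain strict minimizer of the divergence when `∫ u(x, t) ^ m dx < ∞`.
          (Integrable (fun x => u t x ^ m) →
            (∀ ω ∈ paramDomain n, Integrable (divIntegrand q (u t) ω)) ∧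
            ∀ ω ∈ paramDomain n, ω ≠ γ (momentShift m u t) →
              bregmanDiv q (u t) (γ (momentShift m u t)) < bregmanDiv q (u t) ω) := by
  obtain ⟨p, hp, rfl, rfl⟩ := hmom
  obtain rfl : q = 2 - m := by linarith
  set η₀ := firstMoment p
  obtain ⟨V, d, hV, hV', hd0, hS⟩ := exists_orthogonal_diagonalization (posDef_covariance hp)
  have : Nonempty (Fin n) := ⟨⟨0, hn⟩⟩
  obtain ⟨i₀, -, hi₀⟩ := Finset.exists_min_image Finset.univ d Finset.univ_nonempty
  have hd : ∀ s ∈ Ioi (-d i₀), ∀ i, 0 < d i + s := fun s hs i => by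
    have h1 := hi₀ i (Finset.mem_univ i)
    have h2 : -d i₀ < s := hs
    linarith
  -- the curve is defined as long as all eigenvalues of the covariance matrix are positive
  have hdom : ∀ s, 0 ≤ s → s ∈ Ioi (-d i₀) := fun s hs => by
    have := hd0 i₀
    simp only [mem_Ioi]
    linarith
  have hmem : ∀ s, 0 ≤ s → spreadCurve m η₀ V d s ∈ paramDomain n := fun s hs =>
    ofMeanCov_mem hn hm₁ η₀ (posDef_conj_diagonal hV' (hd s (hdom s hs)))
  have hfirst : ∀ s, 0 ≤ s → firstMoment (qGauss (2 - m) (spreadCurve m η₀ V d s)) = η₀ :=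
    fun s hs => firstMoment_ofMeanCov hn hm₁ η₀ (posDef_conj_diagonal hV' (hd s (hdom s hs)))
  have hsecond : ∀ s, 0 ≤ s → secondMoment (qGauss (2 - m) (spreadCurve m η₀ V d s)) =
      secondMoment p + s • (1 : Matrix (Fin n) (Fin n) ℝ) := fun s hs => by
    rw [spreadCurve, secondMoment_ofMeanCov hn hm₁ η₀ (posDef_conj_diagonal hV' (hd s (hdom s hs))),
      conj_diagonal_add_smul_one hV', ← hS, ← add_assoc, add_sub_cancel]
  refine ⟨-d i₀, spreadCurve m η₀ V d, neg_lt_zero.2 (hd0 i₀),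
    isMGeodesic_spreadCurve hn hm₁ hm₂ hV hV' hd η₀, fun ω hω => ⟨fun h => ?_, ?_⟩,
    fun s hs => ⟨isDensity_qGauss hn hm₁ (hmem s hs), hfirst s hs, hsecond s hs⟩,
    fun u hu h0 hu₁ hu₂ => ?_⟩
  · refine eq_of_moments_eq hn hm₁ hω (hmem 0 le_rfl) ?_ ?_
    · rw [h.1, hfirst 0 le_rfl]
    · rw [h.2, hsecond 0 le_rfl, zero_smul, add_zero]
  · rintro rfl
    refine ⟨hfirst 0 le_rfl, ?_⟩
    rw [hsecond 0 le_rfl, zero_smul, add_zero]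
  · have hzero : momentShift m u 0 = 0 := by simp [momentShift]
    have hmono := strictMonoOn_momentShift hu h0
    refine ⟨hzero, continuousOn_momentShift hu, hmono, fun t ht => ?_⟩
    have hσ : 0 ≤ momentShift m u t :=
      hzero.symm.le.trans (hmono.monotoneOn self_mem_Ici ht ht)
    have hden := isDensity_of_isWeakSolution hu h0 ht
    have hm1 := (firstMoment_of_isWeakSolution hu h0 ht).trans hu₁
    have hm2 := secondMoment_of_isWeakSolution hu h0 ht
    rw [hu₂] at hm2
    have e1 := (hfirst _ hσ).trans hm1.symm
    have e2 := (hsecond _ hσ).trans hm2.symm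
    exact ⟨hden, hm1, hm2, isMProjection_iff_eq hn hm₁ hden (hmem _ hσ) e1 e2, fun hpm =>
      ⟨fun ω hω => integrable_divIntegrand hn hm₁ hden hpm hω, fun ω hω hne =>
        bregmanDiv_lt hn hm₁ hden hpm hω (hmem _ hσ) e1 e2 hne⟩⟩
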